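/- Let $d\in\{2,3\}$. For $n\ge 1$ let $B_n=\{0,1,\dots,n-1\}^d\subset\mathbb Z^d$, let $E_n$ be the set of edges $(x,x+e_j)$ with both endpoints in $B_n$, and let $B_n'$ be the set of plaquettes of $B_n$, that is, of triples $(x,j,k)$ with $1\le j<k\le d$ such that $x,\ x+e_j,\ x+e_k,\ x+e_j+e_k$ all lie in $B_n$. *The constant $K_d$.* For $t\in\mathbb R^{E_n}$ put $t(y,x):=-t(x,y)$ for $(x,y)\in E_n$, and $$t(x,j,k):=t(x,x+e_j)+t(x+e_j,x+e_j+e_k)+t(x+e_j+e_k,x+e_k)+t(x+e_k,x),\qquad M_n(t):=\sum_{(x,j,k)\in B_n'}t(x,j,k)^2 .$$ Let $E_n^0$ be the set of edges $(x,x+e_j)\in E_n$ such that $x_i=0$ for all $i>j$, let $E_n^1:=E_n\setminus E_n^0$, and let $M_n^0$ be the restriction of the quadratic form $M_n$ to $\{t: t=0 \text{ on } E_n^0\}\cong\mathbb R^{E_n^1}$, regarded as a symmetric $|E_n^1|\times|E_n^1|$ matrix. Put $K_{n,d}:=-\log\det M_n^0/(2n^d)$. *The partition function.* Let $N\ge1$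 and let $U(N)$ be the group of $N\times N$ unitary matrices. A configuration $U$ assigns to every edge $(x,y)\in E_n$ a matrix $U(x,y)\in U(N)$, with $U(y,x):=U(x,y)^{-1}$. Put $$U(x,j,k):=U(x,x+e_j)\,U(x+e_j,x+e_j+e_k)\,U(x+e_j+e_k,x+e_k)\,U(x+e_k,x),\qquad S(U):=\sum_{(x,j,k)\in B_n'}\operatorname{Re}\operatorname{Tr}\bigl(I-U(x,j,k)\bigr).$$ For $g>0$ and $\epsilon>0$, the partition function of $d$-dimensional $U(N)$ lattice gauge theory with coupling strength $g$ in the box $\{0,\epsilon,\dots,(n-1)\epsilon\}^d$ is $$Z(n,\epsilon,g):=\int \exp\Bigl(-\frac{1}{g^2\epsilon^{4-d}}\,S(U)\Bigr)\prod_{(x,y)\in E_n}d\sigma(U(x,y)),$$ where $\sigma$ is the Haar probability measure on $U(N)$. **Theorem.** The limit $K_d:=\lim_{n\to\infty}K_{n,d}$ exists and is finite. For every $N\ge 1$ and every $g>0$, if $n\to\infty$ and $\epsilon\to0^+$ simultaneously in such a way that $n\epsilon$ stays bounded away from zero, then $$\log Z(n,\epsilon,g)=n^d\left(\tfrac12(d-1)N^2\log\bigl(g^2\epsilon^{4-d}\bigr)+(d-1)\log\left(\frac{\prod_{j=1}^{N-1}j!}{(2\pi)^{N/2}}\right)+N^2K_d\right)+o(n^d),$$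 where $o(n^d)$ denotes a term that tends to zero when divided by $n^d$. -/

import Mathlib

open MeasureTheory Filter Topology Asymptotics
open scoped Nat

noncomputable section

namespace LatticeGauge

/-! ### The lattice: edges and plaquettes -/

/-- Vertices of the lattice `ℤ^d`. -/
abbrev Site (d : ℕ) : Type := Fin d → ℤ

/-- The standard basis vector `e_j`. -/
def unitVec {d : ℕ} (j : Fin d) : Site d := Pi.single j 1

/-- The positively oriented nearest-neighbour edges with both endpoints in `Λ`.  The edge
`(x, x + e_j)` is encoded by the pair `(x, j)`; these are exactly the pairs of adjacent vertices
whose first vertex is lexicographically smaller than the second. -/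
def edges {d : ℕ} (Λ : Finset (Site d)) : Finset (Site d × Fin d) :=
  {e ∈ Λ ×ˢ Finset.univ | e.1 + unitVec e.2 ∈ Λ}

/-- The plaquettes `(x, j, k)`, `j < k`, all of whose four vertices lie in `Λ`. -/
def plaquettes {d : ℕ} (Λ : Finset (Site d)) : Finset (Site d × Fin d × Fin d) :=
  {p ∈ Λ ×ˢ Finset.univ | p.2.1 < p.2.2 ∧ p.1 + unitVec p.2.1 ∈ Λ ∧ p.1 + unitVec p.2.2 ∈ Λ ∧
    p.1 + unitVec p.2.1 + unitVec p.2.2 ∈ Λ}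

namespace Plaquette

variable {d : ℕ} {Λ : Finset (Site d)}

/-- The edge `(x, x + e_j)` of the plaquette `(x, j, k)`. -/
def edge₁ (p : plaquettes Λ) : edges Λ :=
  ⟨(p.1.1, p.1.2.1), by
    have h := p.2
    simp only [plaquettes, edges, Finset.mem_filter, Finset.mem_product, Finset.mem_univ] at h ⊢
    exact ⟨⟨h.1.1, trivial⟩, h.2.2.1⟩⟩

/-- The edge `(x + e_j, x + e_j + e_k)` of the plaquette `(x, j, k)`. -/
def edge₂ (p : plaquettes Λ) : edges Λ :=
  ⟨(p.1.1 + unitVec p.1.2.1, p.1.2.2), by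
    have h := p.2
    simp only [plaquettes, edges, Finset.mem_filter, Finset.mem_product, Finset.mem_univ] at h ⊢
    exact ⟨⟨h.2.2.1, trivial⟩, h.2.2.2.2⟩⟩

/-- The edge `(x + e_k, x + e_k + e_j)` of the plaquette `(x, j, k)`. -/
def edge₃ (p : plaquettes Λ) : edges Λ :=
  ⟨(p.1.1 + unitVec p.1.2.2, p.1.2.1), by
    have h := p.2
    simp only [plaquettes, edges, Finset.mem_filter, Finset.mem_product, Finset.mem_univ] at h ⊢
    refine ⟨⟨h.2.2.2.1, trivial⟩, ?_⟩
    rw [add_right_comm]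
    exact h.2.2.2.2⟩

/-- The edge `(x, x + e_k)` of the plaquette `(x, j, k)`. -/
def edge₄ (p : plaquettes Λ) : edges Λ :=
  ⟨(p.1.1, p.1.2.2), by
    have h := p.2
    simp only [plaquettes, edges, Finset.mem_filter, Finset.mem_product, Finset.mem_univ] at h ⊢
    exact ⟨⟨h.1.1, trivial⟩, h.2.2.2.1⟩⟩

end Plaquette

/-- The box `B_n = {0, 1, …, n-1}^d`. -/
def box (d n : ℕ) : Finset (Site d) := Fintype.piFinset fun _ => Finset.Ico (0 : ℤ) n

/-! ### The unitary group and its Haar probability measure -/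

/-- The unitary group `U(N)`, with its topology as a set of complex matrices. -/
abbrev UN (N : ℕ) : Type := Matrix.unitaryGroup (Fin N) ℂ

instance instMeasurableSpaceUN (N : ℕ) : MeasurableSpace (UN N) := borel (UN N)

instance instBorelSpaceUN (N : ℕ) : BorelSpace (UN N) := ⟨rfl⟩

instance instCompactSpaceUN (N : ℕ) : CompactSpace (UN N) := by
  refine isCompact_iff_compactSpace.mp
    (?_ : IsCompact (Matrix.unitaryGroup (Fin N) ℂ : Set (Matrix (Fin N) (Fin N) ℂ)))
  have hK : IsCompact (Set.univ.pi fun _ : Fin N => Set.univ.pi fun _ : Fin N =>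
      Metric.closedBall (0 : ℂ) 1) :=
    isCompact_univ_pi fun _ => isCompact_univ_pi fun _ => isCompact_closedBall 0 1
  refine IsCompact.of_isClosed_subset hK (isClosed_unitary (R := Matrix (Fin N) (Fin N) ℂ)) ?_
  intro U hU i _ j _
  simpa using entry_norm_bound_of_unitary hU i j

/-- The Haar measure on `U(N)`, normalized to have total mass `1`. -/
def haarUN (N : ℕ) : Measure (UN N) := Measure.haarMeasure ⊤

/-! ### Lattice gauge theory -/

/-- `φ(U) = Re Tr (I - U)`. -/
def phi {N : ℕ} (U : UN N) : ℝ := (Matrix.trace (1 - (U : Matrix (Fin N) (Fin N) ℂ))).re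

/-- A configuration: a unitary matrix on each positively oriented edge `(x, y)`.  The matrix on
the reversed edge is `U(y, x) = U(x, y)⁻¹`. -/
abbrev Config {d : ℕ} (N : ℕ) (Λ : Finset (Site d)) : Type := edges Λ → UN N

/-- `U(x,j,k) = U(x, x+e_j) U(x+e_j, x+e_j+e_k) U(x+e_j+e_k, x+e_k) U(x+e_k, x)`, where the last
two edges are traversed against their positive orientation. -/
def holonomy {d N : ℕ} {Λ : Finset (Site d)} (U : Config N Λ) (p : plaquettes Λ) : UN N :=
  U (Plaquette.edge₁ p) * U (Plaquette.edge₂ p) * (U (Plaquette.edge₃ p))⁻¹ *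
    (U (Plaquette.edge₄ p))⁻¹

/-- The Wilson action `S_Λ(U)`. -/
def wilsonAction {d N : ℕ} {Λ : Finset (Site d)} (U : Config N Λ) : ℝ :=
  ∑ p : plaquettes Λ, phi (holonomy U p)

/-- The partition function of `U(N)` lattice gauge theory on `Λ`, the coupling strength `g₀`
being given through its square: the integral of `exp(-S_Λ(U) / g₀²)` with respect to the product
Haar measure. -/
def partitionFunction {d : ℕ} (N : ℕ) (Λ : Finset (Site d)) (g₀sq : ℝ) : ℝ :=
  ∫ U : Config N Λ, Real.exp (-(1 / g₀sq) * wilsonAction U) ∂Measure.pi fun _ => haarUN N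

/-- The partition function `Z(n, ε, g)` of the theory in the box `{0, ε, …, (n-1)ε}^d` of the
scaled lattice `ε ℤ^d`: the theory in `B_n` with `g₀²` replaced by `g² ε^(4-d)`. -/
def scaledPartitionFunction (d N n : ℕ) (ε g : ℝ) : ℝ :=
  partitionFunction N (box d n) (g ^ 2 * ε ^ (4 - (d : ℤ)))

/-! ### The lattice Maxwell form and the constants `K_{n,d}` -/

/-- The linear functional `t ↦ t(x,j,k)
= t(x, x+e_j) + t(x+e_j, x+e_j+e_k) + t(x+e_j+e_k, x+e_k) + t(x+e_k, x)`,
where `t(y, x) = -t(x, y)`. -/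
def circulation {d : ℕ} {Λ : Finset (Site d)} (p : plaquettes Λ) : (edges Λ → ℝ) →ₗ[ℝ] ℝ :=
  let t (e : edges Λ) : (edges Λ → ℝ) →ₗ[ℝ] ℝ := LinearMap.proj e
  t (Plaquette.edge₁ p) + t (Plaquette.edge₂ p) - t (Plaquette.edge₃ p) - t (Plaquette.edge₄ p)

/-- The quadratic form `M_n(t) = ∑ t(x,j,k)²` on `ℝ^{E_n}`, the sum being over the plaquettes
of `B_n`. -/
def maxwellForm (d n : ℕ) : QuadraticForm ℝ (edges (box d n) → ℝ) :=
  ∑ p : plaquettes (box d n), (QuadraticMap.sq (R := ℝ)).comp (circulation p)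

/-- The edges in `E_n^0`: those edges `(x, x + e_j)` for which all coordinates of `x` after the
`j`-th one vanish. -/
def IsAxial {d : ℕ} (e : Site d × Fin d) : Prop := ∀ i, e.2 < i → e.1 i = 0

instance instDecidablePredIsAxial {d : ℕ} : DecidablePred (IsAxial (d := d)) := fun e =>
  inferInstanceAs (Decidable (∀ i, e.2 < i → e.1 i = 0))

/-- The set `E_n^1 = E_n \ E_n^0`. -/
abbrev FreeEdge (d n : ℕ) : Type := {e : edges (box d n) // ¬ IsAxial e.1}

/-- The form `M_n^0`: the restriction of `M_n` to the functions vanishing on `E_n^0`, viewed as a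
form on `ℝ^{E_n^1}` through extension by zero. -/
def maxwellForm₀ (d n : ℕ) : QuadraticForm ℝ (FreeEdge d n → ℝ) :=
  (maxwellForm d n).comp (Function.ExtendByZero.linearMap ℝ Subtype.val)

/-- `K_{n,d} = - log det M_n^0 / (2 n^d)`. -/
def Knd (n d : ℕ) : ℝ := -Real.log (maxwellForm₀ d n).toMatrix'.det / (2 * (n : ℝ) ^ d)

end LatticeGauge

end

/-! Put β = 1/(g²ε^(4−d)), so that β → ∞. In a box of fixed side this is Laplace's method. The axial
edges form a tree, and a gauge transformation sets them to the identity. The action is half the sum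
of the squared Hilbert–Schmidt distances of the holonomies from 1, and near the identity it becomes
N² independent copies of half the Maxwell form, one for each real coordinate of U(N). Each of the
roughly (d − 1)n^d free edges contributes the Haar density at the identity, ∏ k!/(2π)^(k+1), times
(2π/β)^(N²/2), and the forms contribute (det M⁰)^(−N²/2).

Since n may be far larger than any given power of β, the Gaussian approximation cannot be controlled
on the whole box. The box is therefore cut into blocks of side m with m^60 ≤ β < (m + 1)^60. On one
block every error is a power of m: in axial gauge a function is at most d·m times its largest
circulation (`le_of_axial_increments`), which gives a spectral gap of order m^(−5) and confines the
configuration near the identity (`eventually_fixedZ_le`, `eventually_le_fixedZ`). From blocks to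
box, the upper bound drops the plaquettes lying in no block (`lintegral_weight_le_pow`). The lower
bound keeps the free edges that are not interior to a block in a tiny ball around the identity
(`le_fixedZ_free`); their proportion is O(1/m) and each costs O(log m). The lower bound on nε
guarantees m² ≤ n.

The limit K_d comes from the same blocks. Deleting rows and columns changes a determinant by
controlled factors (`Matrix.det_principal_submatrix_bounds`) and disjoint blocks decouple
(`log_det_blockInterior_le`), so log det per site is almost subadditive. It is nonnegative because
the determinant is a positive integer (`one_le_det_curlMat`).

The Haar density is found by induction on N (`HaarChart`). The first column of a Haar unitary is the
direction of a complex Gaussian vector (`lintegral_haarUN_succ`), whose law in projective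
coordinates is explicit (`lintegral_gaussC_succ`). -/

noncomputable section

open scoped ENNReal NNReal

/-! ### Finite products of measures -/

namespace MeasureTheory

theorem lintegral_fin_prod_eq_prod {n : ℕ} {E : Type*} {mE : MeasurableSpace E}
    {μ : Measure E} [SigmaFinite μ] (f : Fin n → E → ℝ≥0∞) (hf : ∀ i, Measurable (f i)) :
    ∫⁻ x : Fin n → E, ∏ i, f i (x i) ∂(Measure.pi fun _ => μ) = ∏ i, ∫⁻ x, f i x ∂μ := by
  induction n with
  | zero => simp
  | succ n ih =>
    rw [← ((measurePreserving_piFinSuccAbove (fun _ : Fin (n + 1) => μ) 0).symm).lintegral_comp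
      (by fun_prop)]
    simp_rw [MeasurableEquiv.piFinSuccAbove_symm_apply, Fin.insertNthEquiv,
      Fin.prod_univ_succ, Fin.insertNth_zero, Equiv.coe_fn_mk, Fin.cons_succ, Fin.cons_zero]
    simp only [cast_eq]
    rw [lintegral_prod_mul (f := f 0) (g := fun z : Fin n → E => ∏ i, f i.succ (z i))
      (hf 0).aemeasurable
      (Finset.measurable_prod _ fun i _ => (hf _).comp (measurable_pi_apply i)).aemeasurable,
      ← ih _ fun i => hf i.succ]

theorem lintegral_fintype_prod_eq_prod {ι : Type*} [Fintype ι] {E : Type*}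
    {mE : MeasurableSpace E} {μ : Measure E} [SigmaFinite μ] (f : ι → E → ℝ≥0∞)
    (hf : ∀ i, Measurable (f i)) :
    ∫⁻ x : ι → E, ∏ i, f i (x i) ∂(Measure.pi fun _ => μ) = ∏ i, ∫⁻ x, f i x ∂μ := by
  let e := (Fintype.equivFin ι).symm
  rw [← (measurePreserving_piCongrLeft (fun _ : ι => μ) e).lintegral_comp (by fun_prop)]
  simp_rw [← e.prod_comp, MeasurableEquiv.coe_piCongrLeft, Equiv.piCongrLeft_apply_apply]
  exact lintegral_fin_prod_eq_prod _ fun i => hf _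

/-- Currying preserves finite product measures. -/
theorem measurePreserving_curry_pi {ι κ E : Type*} [Fintype ι] [Fintype κ] {mE : MeasurableSpace E}
    (μ : Measure E) [SigmaFinite μ] :
    MeasurePreserving (fun (x : ι × κ → E) i j => x (i, j)) (Measure.pi fun _ => μ)
      (Measure.pi fun _ => Measure.pi fun _ => μ) := by
  have hm : Measurable (fun (x : ι × κ → E) i j => x (i, j)) := by fun_prop
  refine ⟨hm, ?_⟩
  symm
  -- It suffices to test products of rectangles, a generating π-system, on which both measures are
  -- the same product of factors.
  refine Measure.pi_eq_generateFrom (C := fun _ => Set.pi Set.univ ''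
      Set.pi Set.univ fun _ : κ => {s : Set E | MeasurableSet s})
    (fun _ => generateFrom_pi) (fun _ => isPiSystem_pi)
    (fun _ => Measure.FiniteSpanningSetsIn.pi fun _ => μ.toFiniteSpanningSetsIn) ?_
  intro s hs
  choose t ht hst using hs
  rw [Measure.map_apply hm (MeasurableSet.univ_pi fun i => by
    rw [← hst i]; exact MeasurableSet.univ_pi fun j => ht i j trivial)]
  have : (fun (x : ι × κ → E) i j => x (i, j)) ⁻¹' Set.univ.pi s =
      Set.univ.pi fun p : ι × κ => t p.1 p.2 := by
    ext x
    simp only [Set.mem_preimage, Set.mem_univ_pi, ← hst, Prod.forall]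
  rw [this, Measure.pi_pi, Fintype.prod_prod_type]
  refine Finset.prod_congr rfl fun i _ => ?_
  rw [← hst i, Measure.pi_pi]

/-- Fubini's theorem for a product of functions of disjoint blocks of coordinates, the remaining
coordinates entering through a product of functions of one coordinate. -/
theorem lintegral_pi_blocks {B K ι E : Type*} [Fintype B] [Fintype K] [Fintype ι]
    {mE : MeasurableSpace E} (μ : Measure E) [SigmaFinite μ] (p : ι → Prop) [DecidablePred p]
    (e : B × K ≃ {i // p i}) (f : (K → E) → ℝ≥0∞)
    (hf : Measurable f) (g : E → ℝ≥0∞) (hg : Measurable g) :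
    ∫⁻ x : ι → E, (∏ b, f fun k => x (e (b, k))) *
        ∏ i : {i // ¬ p i}, g (x i) ∂(Measure.pi fun _ => μ) =
      (∫⁻ y, f y ∂(Measure.pi fun _ => μ)) ^ Fintype.card B *
        (∫⁻ y, g y ∂μ) ^ (Fintype.card ι - Fintype.card B * Fintype.card K) := by
  have m1 : Measurable fun z : {i // p i} → E => ∏ b, f fun k => z (e (b, k)) := by fun_prop
  have m2 : Measurable fun z : {i // ¬ p i} → E => ∏ i, g (z i) := by fun_prop
  have h1 := (measurePreserving_piEquivPiSubtypeProd (fun _ : ι => μ) p).lintegral_comp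
    (f := fun z => (∏ b, f fun k => z.1 (e (b, k))) * ∏ i, g (z.2 i)) (by fun_prop)
  refine h1.trans ?_
  rw [lintegral_prod_mul (f := fun z : {i // p i} → E => ∏ b, f fun k => z (e (b, k)))
    (g := fun z : {i // ¬ p i} → E => ∏ i, g (z i)) m1.aemeasurable m2.aemeasurable]
  congr 1
  · rw [← (measurePreserving_piCongrLeft (fun _ : {i // p i} => μ) e).lintegral_comp m1]
    have h3 : ∀ (x : B × K → E) b k, (MeasurableEquiv.piCongrLeft
        (fun _ : {i // p i} => E) e) x (e (b, k)) = x (b, k) := fun x b k => by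
      rw [MeasurableEquiv.coe_piCongrLeft]
      exact Equiv.piCongrLeft_apply_apply (fun _ : {i // p i} => E) e x (b, k)
    simp only [h3]
    rw [(measurePreserving_curry_pi μ).lintegral_comp
      (f := fun z : B → K → E => ∏ b, f fun k => z b k) (by fun_prop)]
    rw [lintegral_fintype_prod_eq_prod (fun _ => f) fun _ => hf]
    simp
  · rw [lintegral_fintype_prod_eq_prod (fun _ => g) fun _ => hg]
    simp only [Finset.prod_const, Finset.card_univ]
    congr 1
    -- The truncated subtraction is exact, since `e` shows that the blocks use exactly `card B *
    -- card K` coordinates.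
    rw [Fintype.card_subtype_compl, ← Fintype.card_prod, Fintype.card_congr e]

/-- The product outer measure is the largest one bounded on boxes by the product of the sides, so
comparing on boxes is enough. This carries density bounds for a chart of U(N) to all edges at once.
-/
theorem Measure.pi_le_smul_pi {ι : Type*} [Fintype ι] {E : Type*} {mE : MeasurableSpace E}
    {μ ν : Measure E} [SigmaFinite μ] [SigmaFinite ν] {c : ℝ≥0∞} (hc0 : c ≠ 0) (hct : c ≠ ∞)
    (h : μ ≤ c • ν) :
    Measure.pi (fun _ : ι => μ) ≤ c ^ Fintype.card ι • Measure.pi fun _ : ι => ν := by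
  have hk0 : c ^ Fintype.card ι ≠ 0 := pow_ne_zero _ hc0
  have hkt : c ^ Fintype.card ι ≠ ∞ := ENNReal.pow_ne_top hct
  have key : ((c ^ Fintype.card ι)⁻¹ • Measure.pi (fun _ : ι => μ)).toOuterMeasure ≤
      OuterMeasure.pi fun _ : ι => ν.toOuterMeasure := by
    rw [OuterMeasure.le_pi]
    intro s _
    change (c ^ Fintype.card ι)⁻¹ * Measure.pi (fun _ : ι => μ) (Set.univ.pi s) ≤ ∏ i, ν (s i)
    rw [Measure.pi_pi, ENNReal.inv_mul_le_iff hk0 hkt]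
    calc ∏ i, μ (s i) ≤ ∏ i, c * ν (s i) := Finset.prod_le_prod' fun i _ => h (s i)
      _ = _ := by rw [Finset.prod_mul_distrib]; simp
  refine Measure.le_iff.2 fun s hs => ?_
  have h2 : (c ^ Fintype.card ι)⁻¹ * Measure.pi (fun _ : ι => μ) s ≤
      Measure.pi (fun _ : ι => ν) s := by
    refine (key s).trans ?_
    rw [Measure.pi]
    exact le_toMeasure_apply _ _ _
  rwa [ENNReal.inv_mul_le_iff hk0 hkt] at h2

end MeasureTheory

end

noncomputable section

open scoped ENNReal NNReal

/-! ### Gaussian integrals and determinants of principal submatrices -/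

namespace Matrix

open scoped MatrixOrder Matrix.Norms.L2Operator in
theorem PosDef.exists_eq_transpose_mul_self {K : Type*} [Fintype K] [DecidableEq K]
    {M : Matrix K K ℝ} (hM : M.PosDef) : ∃ A : Matrix K K ℝ, M = Aᵀ * A := by
  obtain ⟨A, hA⟩ := CStarAlgebra.nonneg_iff_eq_star_mul_self.mp
    (nonneg_iff_posSemidef.2 hM.posSemidef)
  exact ⟨A, hA⟩

end Matrix

theorem lintegral_exp_neg_sq_half :
    ∫⁻ y : ℝ, ENNReal.ofReal (Real.exp (-(y ^ 2) / 2)) =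
      ENNReal.ofReal (Real.sqrt (2 * Real.pi)) := by
  have h := integral_gaussian (1 / 2)
  have h2 := integrable_exp_neg_mul_sq (b := 1 / 2) (by norm_num)
  have h3 := ofReal_integral_eq_lintegral_ofReal h2 (ae_of_all _ fun _ => (Real.exp_pos _).le)
  rw [h] at h3
  rw [show 2 * Real.pi = Real.pi / (1 / 2) by ring, h3]
  refine lintegral_congr fun y => ?_
  rw [show -(y ^ 2) / 2 = -(1 / 2) * y ^ 2 by ring]

/-- The Gaussian integral of a positive definite quadratic form. -/
theorem lintegral_exp_neg_half_posDef {K : Type*} [Fintype K] [DecidableEq K] {M : Matrix K K ℝ}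
    (hM : M.PosDef) :
    ∫⁻ x : K → ℝ, ENNReal.ofReal (Real.exp (-(x ⬝ᵥ M.mulVec x) / 2)) =
      ENNReal.ofReal (Real.sqrt ((2 * Real.pi) ^ Fintype.card K / M.det)) := by
  obtain ⟨A, rfl⟩ := hM.exists_eq_transpose_mul_self
  have hd : 0 < A.det * A.det := by simpa using hM.det_pos
  have hA : A.det ≠ 0 := by rintro h; simp [h] at hd
  have hmeas : Measurable fun y : K → ℝ => ENNReal.ofReal (Real.exp (-(∑ k, y k ^ 2) / 2)) := by
    fun_prop
  have h1 : ∀ x : K → ℝ, ENNReal.ofReal (Real.exp (-(x ⬝ᵥ (A.transpose * A).mulVec x) / 2)) =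
      ENNReal.ofReal (Real.exp (-(∑ k, (Matrix.toLin' A x) k ^ 2) / 2)) := by
    intro x
    rw [← Matrix.mulVec_mulVec, Matrix.dotProduct_mulVec, Matrix.vecMul_transpose]
    simp [dotProduct, sq]
  simp only [h1]
  -- The substitution y = Ax, where M = AᵀA and so (det A)² = det M, turns the form into a sum of
  -- squares.
  rw [← lintegral_map (f := fun y : K → ℝ => ENNReal.ofReal (Real.exp (-(∑ k, y k ^ 2) / 2)))
    hmeas (by fun_prop), Real.map_matrix_volume_pi_eq_smul_volume_pi hA, lintegral_smul_measure]
  have h2 : ∀ y : K → ℝ, ENNReal.ofReal (Real.exp (-(∑ k, y k ^ 2) / 2)) =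
      ∏ k, ENNReal.ofReal (Real.exp (-(y k ^ 2) / 2)) := by
    intro y
    rw [← ENNReal.ofReal_prod_of_nonneg fun _ _ => (Real.exp_pos _).le, ← Real.exp_sum,
      ← Finset.sum_div, Finset.sum_neg_distrib]
  simp only [h2]
  rw [volume_pi, lintegral_fintype_prod_eq_prod (fun _ y => ENNReal.ofReal
    (Real.exp (-(y ^ 2) / 2))) (fun _ => by fun_prop)]
  simp only [lintegral_exp_neg_sq_half, Finset.prod_const, Finset.card_univ, smul_eq_mul]
  rw [← ENNReal.ofReal_pow (Real.sqrt_nonneg _), ← ENNReal.ofReal_mul (abs_nonneg _)]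
  congr 1
  rw [Real.sqrt_div (by positivity), Matrix.det_mul, Matrix.det_transpose, Real.sqrt_mul_self_eq_abs,
    abs_inv, Real.sqrt_eq_rpow, Real.sqrt_eq_rpow, ← Real.rpow_natCast, ← Real.rpow_natCast,
    ← Real.rpow_mul (by positivity), ← Real.rpow_mul (by positivity), mul_comm (1 / 2 : ℝ)]
  field_simp

namespace Matrix

theorem IsHermitian.pow_le_det {K : Type*} [Fintype K] [DecidableEq K] {S : Matrix K K ℝ}
    (hS : S.IsHermitian) {a : ℝ} (ha : 0 ≤ a) (h : ∀ x, a * (x ⬝ᵥ x) ≤ x ⬝ᵥ S *ᵥ x) :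
    a ^ Fintype.card K ≤ S.det := by
  rw [hS.det_eq_prod_eigenvalues, ← Finset.card_univ, ← Finset.prod_const]
  refine Finset.prod_le_prod (fun _ _ => ha) fun i _ => ?_
  have h1 := h (hS.eigenvectorBasis i)
  have h2 := hS.eigenvalues_eq i
  simp only [star_trivial, RCLike.re_to_real] at h2
  have h3 : (hS.eigenvectorBasis i).ofLp ⬝ᵥ (hS.eigenvectorBasis i).ofLp = 1 := by
    have := EuclideanSpace.inner_eq_star_dotProduct (hS.eigenvectorBasis i) (hS.eigenvectorBasis i)
    rw [star_trivial] at this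
    rw [← this]
    simp
  rw [h3, mul_one, ← h2] at h1
  exact h1

theorem PosSemidef.det_le_pow {K : Type*} [Fintype K] [DecidableEq K] {S : Matrix K K ℝ}
    (hS : S.PosSemidef) {b : ℝ} (h : ∀ x, x ⬝ᵥ S *ᵥ x ≤ b * (x ⬝ᵥ x)) :
    S.det ≤ b ^ Fintype.card K := by
  rw [hS.1.det_eq_prod_eigenvalues, ← Finset.card_univ, ← Finset.prod_const]
  refine Finset.prod_le_prod (fun i _ => hS.eigenvalues_nonneg i) fun i _ => ?_
  have h1 := h (hS.1.eigenvectorBasis i)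
  have h2 := hS.1.eigenvalues_eq i
  simp only [star_trivial, RCLike.re_to_real] at h2
  have h3 : (hS.1.eigenvectorBasis i).ofLp ⬝ᵥ (hS.1.eigenvectorBasis i).ofLp = 1 := by
    have := EuclideanSpace.inner_eq_star_dotProduct (hS.1.eigenvectorBasis i)
      (hS.1.eigenvectorBasis i)
    rw [star_trivial] at this
    rw [← this]
    simp
  rw [h3, mul_one, ← h2] at h1
  exact h1

/-- If `a ≤ M ≤ b`, removing the rows and columns where `p` fails changes the determinant at most
by the factors `a` and `b` for each of them. -/
theorem det_principal_submatrix_bounds {K : Type*} [Fintype K] [DecidableEq K]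
    {M : Matrix K K ℝ} (hM : M.IsHermitian) {a b : ℝ} (ha : 0 < a)
    (hl : ∀ x, a * (x ⬝ᵥ x) ≤ x ⬝ᵥ M *ᵥ x) (hu : ∀ x, x ⬝ᵥ M *ᵥ x ≤ b * (x ⬝ᵥ x))
    (p : K → Prop) [DecidablePred p] :
    a ^ Fintype.card {i // ¬ p i} * (M.submatrix (Subtype.val : {i // p i} → K) Subtype.val).det ≤
        M.det ∧
      M.det ≤ b ^ Fintype.card {i // ¬ p i} *
        (M.submatrix (Subtype.val : {i // p i} → K) Subtype.val).det := by
  have hdet : M.det = (M.submatrix (Equiv.sumCompl p) (Equiv.sumCompl p)).det :=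
    (det_submatrix_equiv_self _ _).symm
  set A := M.submatrix (Subtype.val : {i // p i} → K) Subtype.val with hAdef
  set B := M.submatrix (Subtype.val : {i // p i} → K) (Subtype.val : {i // ¬ p i} → K) with hBdef
  set D := M.submatrix (Subtype.val : {i // ¬ p i} → K) Subtype.val with hDdef
  have hblocks : M.submatrix (Equiv.sumCompl p) (Equiv.sumCompl p) = fromBlocks A B Bᴴ D := by
    ext i j
    rcases i with i | i <;> rcases j with j | j <;> simp [hAdef, hBdef, hDdef]
    simpa using hM.apply j.1 i.1
  have hquad : ∀ (x : {i // p i} → ℝ) (y : {i // ¬ p i} → ℝ),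
      ∃ z : K → ℝ, z ⬝ᵥ z = x ⬝ᵥ x + y ⬝ᵥ y ∧
        z ⬝ᵥ M *ᵥ z = Sum.elim x y ⬝ᵥ fromBlocks A B Bᴴ D *ᵥ Sum.elim x y := by
    intro x y
    refine ⟨Sum.elim x y ∘ (Equiv.sumCompl p).symm, ?_, ?_⟩
    · have h : (Sum.elim x y ∘ (Equiv.sumCompl p).symm) ∘ Equiv.sumCompl p = Sum.elim x y := by
        ext i; simp only [Function.comp_apply, Equiv.symm_apply_apply]
      rw [comp_equiv_symm_dotProduct, h, sumElim_dotProduct_sumElim]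
    · rw [comp_equiv_symm_dotProduct, ← hblocks, submatrix_mulVec_equiv]
  have hAq : ∀ x, a * (x ⬝ᵥ x) ≤ x ⬝ᵥ A *ᵥ x := by
    intro x
    obtain ⟨z, h1, h2⟩ := hquad x 0
    have := hl z
    rw [h1, h2] at this
    simpa [fromBlocks_mulVec, sumElim_dotProduct_sumElim] using this
  have hDq : ∀ y, y ⬝ᵥ D *ᵥ y ≤ b * (y ⬝ᵥ y) := by
    intro y
    obtain ⟨z, h1, h2⟩ := hquad 0 y
    have := hu z
    rw [h1, h2] at this
    simpa [fromBlocks_mulVec, sumElim_dotProduct_sumElim] using this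
  have hA : A.PosDef := PosDef.of_dotProduct_mulVec_pos (hM.submatrix _) fun x hx => by
    refine lt_of_lt_of_le ?_ (hAq x)
    have : 0 < x ⬝ᵥ x := by simpa using dotProduct_star_self_pos_iff.2 hx
    positivity
  have := hA.isUnit.invertible
  have hBAB : (Bᴴ * A⁻¹ * B).PosSemidef := hA.posSemidef.inv.conjTranspose_mul_mul_same B
  have hS : (D - Bᴴ * A⁻¹ * B).IsHermitian := (hM.submatrix _).sub hBAB.1
  have hSl : ∀ y, a * (y ⬝ᵥ y) ≤ y ⬝ᵥ (D - Bᴴ * A⁻¹ * B) *ᵥ y := by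
    intro y
    -- For fixed y the form of M is smallest at the first block −A⁻¹By, where it equals the Schur
    -- complement at y. This vector is at least as long as y.
    obtain ⟨z, h1, h2⟩ := hquad (-((A⁻¹ * B) *ᵥ y)) y
    have h3 := schur_complement_eq₁₁ B D (-((A⁻¹ * B) *ᵥ y)) y hA.1
    simp only [neg_add_cancel, dotProduct_zero, zero_add, ← dotProduct_mulVec, star_trivial] at h3
    rw [← h3, ← h2]
    refine le_trans ?_ (hl z)
    rw [h1]
    have : 0 ≤ (-((A⁻¹ * B) *ᵥ y)) ⬝ᵥ (-((A⁻¹ * B) *ᵥ y)) := by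
      simpa using dotProduct_star_self_nonneg (-((A⁻¹ * B) *ᵥ y))
    nlinarith
  have hSu : ∀ y, y ⬝ᵥ (D - Bᴴ * A⁻¹ * B) *ᵥ y ≤ b * (y ⬝ᵥ y) := by
    intro y
    -- The Schur complement is D minus a positive semidefinite matrix.
    refine le_trans ?_ (hDq y)
    rw [sub_mulVec, dotProduct_sub]
    have := hBAB.dotProduct_mulVec_nonneg y
    simp only [star_trivial] at this
    linarith
  have hSpos : (D - Bᴴ * A⁻¹ * B).PosSemidef :=
    PosSemidef.of_dotProduct_mulVec_nonneg hS fun y => by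
      refine le_trans ?_ (hSl y)
      have : 0 ≤ y ⬝ᵥ y := by simpa using dotProduct_star_self_nonneg y
      positivity
  have hd : M.det = A.det * (D - Bᴴ * A⁻¹ * B).det := by
    rw [hdet, hblocks, det_fromBlocks₁₁, invOf_eq_nonsing_inv]
  have hAd := hA.det_pos
  constructor
  · rw [hd, mul_comm]
    exact mul_le_mul_of_nonneg_left (hS.pow_le_det ha.le hSl) hAd.le
  · rw [hd, mul_comm]
    exact mul_le_mul_of_nonneg_right (hSpos.det_le_pow hSu) hAd.le

end Matrix

end

noncomputable section

open scoped ENNReal NNReal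

namespace LatticeGauge

/-! ### The Hilbert–Schmidt norm -/

/-- The Hilbert–Schmidt norm of a square matrix. -/
def hs {N : ℕ} (A : Matrix (Fin N) (Fin N) ℂ) : ℝ := Real.sqrt (∑ i, ∑ j, ‖A i j‖ ^ 2)

section HS

variable {N : ℕ} (A B : Matrix (Fin N) (Fin N) ℂ) (U : UN N)

theorem hs_nonneg : 0 ≤ hs A := Real.sqrt_nonneg _

theorem hs_sq : hs A ^ 2 = ∑ i, ∑ j, ‖A i j‖ ^ 2 := Real.sq_sqrt (by positivity)

open scoped Matrix.Norms.Frobenius in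
theorem hs_eq_frobenius_norm : hs A = ‖A‖ := by
  rw [Matrix.frobenius_norm_def, hs, Real.sqrt_eq_rpow]
  simp

theorem hs_add_le : hs (A + B) ≤ hs A + hs B := by
  open scoped Matrix.Norms.Frobenius in
  simpa only [hs_eq_frobenius_norm] using norm_add_le A B

theorem hs_sub_le : hs (A - B) ≤ hs A + hs B := by
  open scoped Matrix.Norms.Frobenius in
  simpa only [hs_eq_frobenius_norm] using norm_sub_le A B

theorem hs_sub_comm : hs (A - B) = hs (B - A) := by
  open scoped Matrix.Norms.Frobenius in
  simpa only [hs_eq_frobenius_norm] using norm_sub_rev A B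

theorem hs_mul_le : hs (A * B) ≤ hs A * hs B := by
  open scoped Matrix.Norms.Frobenius in
  simpa only [hs_eq_frobenius_norm] using Matrix.frobenius_norm_mul A B

@[simp] theorem hs_zero : hs (0 : Matrix (Fin N) (Fin N) ℂ) = 0 := by simp [hs]

theorem continuous_hs : Continuous (hs : Matrix (Fin N) (Fin N) ℂ → ℝ) := by
  unfold hs; fun_prop

theorem norm_apply_le_hs (i j : Fin N) : ‖A i j‖ ≤ hs A := by
  refine Real.le_sqrt_of_sq_le ?_
  refine le_trans ?_ (Finset.single_le_sum (f := fun i => ∑ j, ‖A i j‖ ^ 2)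
    (fun i _ => by positivity) (Finset.mem_univ i))
  exact Finset.single_le_sum (f := fun j => ‖A i j‖ ^ 2) (fun i _ => by positivity)
    (Finset.mem_univ j)

theorem hs_le_of_forall_le {c : ℝ} (hc : ∀ i j, ‖A i j‖ ≤ c) : hs A ≤ N * c := by
  rcases Nat.eq_zero_or_pos N with rfl | hN
  · simp [hs]
  · have h0 : 0 ≤ c := (norm_nonneg _).trans (hc ⟨0, hN⟩ ⟨0, hN⟩)
    refine Real.sqrt_le_iff.2 ⟨by positivity, ?_⟩
    calc ∑ i, ∑ j, ‖A i j‖ ^ 2 ≤ ∑ _i : Fin N, ∑ _j : Fin N, c ^ 2 := by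
          gcongr; exact hc _ _
      _ = _ := by simp; ring

theorem hs_sq_eq_trace : hs A ^ 2 = (Matrix.trace (A.conjTranspose * A)).re := by
  rw [hs_sq, Finset.sum_comm]
  simp [Matrix.trace, Matrix.mul_apply, ← Complex.normSq_eq_conj_mul_self,
    Complex.normSq_eq_norm_sq, -Complex.ofReal_pow]

theorem hs_unitary_mul : hs ((U : Matrix (Fin N) (Fin N) ℂ) * A) = hs A := by
  rw [← sq_eq_sq₀ (hs_nonneg _) (hs_nonneg _), hs_sq_eq_trace, hs_sq_eq_trace,
    Matrix.conjTranspose_mul, Matrix.mul_assoc, ← Matrix.mul_assoc _ (U : Matrix (Fin N) (Fin N) ℂ) A]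
  have : (U : Matrix (Fin N) (Fin N) ℂ).conjTranspose * U = 1 := Unitary.coe_star_mul_self U
  rw [this, Matrix.one_mul]

theorem hs_conjTranspose : hs A.conjTranspose = hs A := by
  rw [hs, hs, Finset.sum_comm]
  simp

theorem hs_mul_unitary : hs (A * (U : Matrix (Fin N) (Fin N) ℂ)) = hs A := by
  rw [← hs_conjTranspose, Matrix.conjTranspose_mul]
  exact (hs_unitary_mul A.conjTranspose (star U)).trans (hs_conjTranspose A)

/-- The distance of a unitary matrix to the identity. -/
def udist {N : ℕ} (U : UN N) : ℝ := hs ((U : Matrix (Fin N) (Fin N) ℂ) - 1)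

theorem udist_nonneg : 0 ≤ udist U := hs_nonneg _

@[simp] theorem udist_one : udist (1 : UN N) = 0 := by simp [udist]

theorem continuous_udist : Continuous (udist : UN N → ℝ) :=
  continuous_hs.comp (continuous_subtype_val.sub continuous_const)

/-- Unitarity gives ‖U − 1‖² = 2 Re Tr(1 − U). The action is thus half a sum of squares, the
nonlinear analogue of the Maxwell form. -/
theorem phi_eq : phi U = udist U ^ 2 / 2 := by
  have : (U : Matrix (Fin N) (Fin N) ℂ).conjTranspose * U = 1 := Unitary.coe_star_mul_self U
  rw [udist, hs_sq_eq_trace, phi, Matrix.conjTranspose_sub, Matrix.sub_mul, Matrix.mul_sub,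
    Matrix.mul_sub, this]
  simp only [Matrix.mul_one, Matrix.conjTranspose_one, Matrix.one_mul, Matrix.trace_sub,
    Complex.sub_re, Matrix.trace_conjTranspose, Complex.star_def, Complex.conj_re]
  ring

theorem phi_nonneg : 0 ≤ phi U := by rw [phi_eq]; positivity

theorem continuous_phi : Continuous (phi : UN N → ℝ) := by
  have : (phi : UN N → ℝ) = fun U => udist U ^ 2 / 2 := funext phi_eq
  rw [this]
  exact (continuous_udist.pow 2).div_const 2

theorem udist_mul_le (V : UN N) : udist (U * V) ≤ udist U + udist V := by
  have : ((U * V : UN N) : Matrix (Fin N) (Fin N) ℂ) - 1 = U * (V - 1) + (U - 1) := by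
    rw [Matrix.mul_sub]; simp
  rw [udist, this]
  refine (hs_add_le _ _).trans ?_
  rw [hs_unitary_mul, add_comm]
  rfl

theorem udist_inv : udist U⁻¹ = udist U := by
  have : ((U⁻¹ : UN N) : Matrix (Fin N) (Fin N) ℂ) - 1 = (U⁻¹ : UN N) * (1 - U) := by
    rw [Matrix.mul_sub, Matrix.mul_one, ← Submonoid.coe_mul, inv_mul_cancel]; simp
  rw [udist, this, hs_unitary_mul, hs_sub_comm]
  rfl

/-- The distance to the identity of the product along a plaquette. -/
theorem udist_plaquette (a b c d : UN N) : udist (a * b * c⁻¹ * d⁻¹) =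
    hs ((a : Matrix (Fin N) (Fin N) ℂ) * (b : Matrix (Fin N) (Fin N) ℂ) -
      (d : Matrix (Fin N) (Fin N) ℂ) * (c : Matrix (Fin N) (Fin N) ℂ)) := by
  rw [udist, ← hs_mul_unitary _ (d * c), Matrix.sub_mul, Matrix.one_mul, ← Submonoid.coe_mul,
    mul_assoc, mul_assoc (a * b), inv_mul_cancel_left, inv_mul_cancel, mul_one]
  rfl

end HS

/-! ### The Haar measure -/

section Haar

variable {N : ℕ}

instance : IsProbabilityMeasure (haarUN N) := ⟨Measure.haarMeasure_self⟩

instance : (haarUN N).IsHaarMeasure := inferInstanceAs (Measure.haarMeasure ⊤).IsHaarMeasure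

instance : SecondCountableTopology (UN N) :=
  have : SecondCountableTopology (Matrix (Fin N) (Fin N) ℂ) :=
    inferInstanceAs (SecondCountableTopology (Fin N → Fin N → ℂ))
  Topology.IsInducing.subtypeVal.secondCountableTopology

theorem eq_haarUN_of_invariant (μ : Measure (UN N)) [IsProbabilityMeasure μ]
    (h : ∀ V : UN N, μ.map (V * ·) = μ) : μ = haarUN N := by
  have : μ.IsMulLeftInvariant := ⟨h⟩
  have h1 := Measure.isMulInvariant_eq_smul_of_compactSpace μ (haarUN N)
  have h2 := congrArg (fun ν : Measure (UN N) => ν Set.univ) h1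
  simp only [measure_univ, Measure.smul_apply, ENNReal.smul_def, smul_eq_mul, mul_one] at h2
  rw [h1, ENNReal.smul_def, ← h2, one_smul]

/-- A right translate of Haar measure is a left invariant probability measure, so uniqueness
applies. Both invariances are needed because a gauge transformation acts on an edge from both sides.
-/
instance : (haarUN N).IsMulRightInvariant := by
  refine ⟨fun g => ?_⟩
  have : IsProbabilityMeasure ((haarUN N).map (· * g)) :=
    Measure.isProbabilityMeasure_map (by fun_prop)
  refine eq_haarUN_of_invariant _ fun V => ?_
  rw [Measure.map_map (by fun_prop) (by fun_prop)]
  have : ((V * ·) ∘ (· * g)) = ((· * g) ∘ (V * ·) : UN N → UN N) := by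
    ext1 x; simp [mul_assoc]
  rw [this, ← Measure.map_map (by fun_prop) (by fun_prop), map_mul_left_eq_self]

end Haar

end LatticeGauge

end

noncomputable section

open scoped ENNReal NNReal

namespace LatticeGauge

/-! ### Matrices split along the first coordinate -/

section Blk

open Matrix

variable {N : ℕ}

/-- The matrix with corner `a`, first row `r`, first column `c` and remaining block `D`. -/
def blk (a : ℂ) (r c : Fin N → ℂ) (D : Matrix (Fin N) (Fin N) ℂ) :
    Matrix (Fin (N + 1)) (Fin (N + 1)) ℂ :=
  Matrix.of (Fin.cons (Fin.cons a r) fun i => Fin.cons (c i) (D i))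

variable (a : ℂ) (r c : Fin N → ℂ) (D : Matrix (Fin N) (Fin N) ℂ)

@[simp] theorem blk_zero_zero : blk a r c D 0 0 = a := rfl
@[simp] theorem blk_zero_succ (j : Fin N) : blk a r c D 0 j.succ = r j := rfl
@[simp] theorem blk_succ_zero (i : Fin N) : blk a r c D i.succ 0 = c i := rfl
@[simp] theorem blk_succ_succ (i j : Fin N) : blk a r c D i.succ j.succ = D i j := rfl

theorem ext_blk {A B : Matrix (Fin (N + 1)) (Fin (N + 1)) ℂ} (h00 : A 0 0 = B 0 0)
    (h0 : ∀ j : Fin N, A 0 j.succ = B 0 j.succ) (h1 : ∀ i : Fin N, A i.succ 0 = B i.succ 0)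
    (h : ∀ i j : Fin N, A i.succ j.succ = B i.succ j.succ) : A = B := by
  ext i j
  refine Fin.cases ?_ (fun i => ?_) i <;> refine Fin.cases ?_ (fun j => ?_) j
  exacts [h00, h0 j, h1 i, h i j]

theorem one_eq_blk : (1 : Matrix (Fin (N + 1)) (Fin (N + 1)) ℂ) = blk 1 0 0 1 := by
  refine ext_blk rfl (fun j => ?_) (fun i => ?_) fun i j => ?_
  · simp [(Fin.succ_ne_zero j).symm]
  · simp
  · simp [Matrix.one_apply]

theorem blk_mul (a' : ℂ) (r' c' : Fin N → ℂ) (D' : Matrix (Fin N) (Fin N) ℂ) :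
    blk a r c D * blk a' r' c' D' =
      blk (a * a' + r ⬝ᵥ c') (a • r' + r ᵥ* D') (a' • c + D *ᵥ c')
        (vecMulVec c r' + D * D') := by
  refine ext_blk ?_ (fun j => ?_) (fun i => ?_) fun i j => ?_ <;>
    simp [Matrix.mul_apply, Fin.sum_univ_succ, dotProduct, vecMul, mulVec, vecMulVec_apply,
      mul_comm a']

theorem blk_conjTranspose : (blk a r c D)ᴴ = blk (star a) (star c) (star r) Dᴴ := by
  refine ext_blk ?_ (fun j => ?_) (fun i => ?_) fun i j => ?_ <;>
    simp [Matrix.conjTranspose_apply]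

theorem hs_blk_sq : hs (blk a r c D) ^ 2 =
    ‖a‖ ^ 2 + ∑ j, ‖r j‖ ^ 2 + ∑ i, ‖c i‖ ^ 2 + hs D ^ 2 := by
  rw [hs_sq, hs_sq]
  simp only [Fin.sum_univ_succ, blk_zero_zero, blk_zero_succ, blk_succ_zero, blk_succ_succ,
    Finset.sum_add_distrib]
  ring

theorem blk_sub (a' : ℂ) (r' c' : Fin N → ℂ) (D' : Matrix (Fin N) (Fin N) ℂ) :
    blk a r c D - blk a' r' c' D' = blk (a - a') (r - r') (c - c') (D - D') :=
  ext_blk rfl (fun _ => rfl) (fun _ => rfl) fun _ _ => rfl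

theorem blk_add (a' : ℂ) (r' c' : Fin N → ℂ) (D' : Matrix (Fin N) (Fin N) ℂ) :
    blk a r c D + blk a' r' c' D' = blk (a + a') (r + r') (c + c') (D + D') :=
  ext_blk rfl (fun _ => rfl) (fun _ => rfl) fun _ _ => rfl

theorem hs_corner : hs (blk 0 0 0 D) = hs D := by
  rw [← sq_eq_sq₀ (hs_nonneg _) (hs_nonneg _), hs_blk_sq]; simp

theorem continuous_blk {X : Type*} [TopologicalSpace X] {a : X → ℂ} {r c : X → Fin N → ℂ}
    {D : X → Matrix (Fin N) (Fin N) ℂ} (ha : Continuous a) (hr : Continuous r)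
    (hc : Continuous c) (hD : Continuous D) :
    Continuous fun x => blk (a x) (r x) (c x) (D x) := by
  refine continuous_matrix fun i j => ?_
  refine Fin.cases ?_ (fun i => ?_) i <;> refine Fin.cases ?_ (fun j => ?_) j
  · exact ha
  · exact (continuous_apply j).comp hr
  · exact (continuous_apply i).comp hc
  · exact hD.matrix_elem i j

/-- The embedding of `U(N)` in `U(N+1)` as the stabilizer of the first basis vector. -/
def liftUN (U : UN N) : UN (N + 1) :=
  ⟨blk 1 0 0 (U : Matrix (Fin N) (Fin N) ℂ), by
    rw [mem_unitaryGroup_iff', star_eq_conjTranspose, blk_conjTranspose, blk_mul, one_eq_blk]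
    have : (U : Matrix (Fin N) (Fin N) ℂ)ᴴ * U = 1 := Unitary.coe_star_mul_self U
    simp [this]⟩

theorem coe_liftUN (U : UN N) :
    (liftUN U : Matrix (Fin (N + 1)) (Fin (N + 1)) ℂ) = blk 1 0 0 U := rfl

theorem liftUN_mul (U V : UN N) : liftUN (U * V) = liftUN U * liftUN V := by
  apply Subtype.ext
  rw [Submonoid.coe_mul, coe_liftUN, coe_liftUN, coe_liftUN, blk_mul]
  simp

theorem udist_liftUN (U : UN N) : udist (liftUN U) = udist U := by
  rw [udist, coe_liftUN, one_eq_blk, blk_sub, udist]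
  simp [hs_corner]

theorem continuous_liftUN : Continuous (liftUN : UN N → UN (N + 1)) :=
  (continuous_blk continuous_const continuous_const continuous_const
    continuous_subtype_val).subtype_mk _

/-- A unitary matrix fixing the first basis vector comes from `U(N)`. -/
theorem exists_eq_liftUN (W : UN (N + 1))
    (h0 : (W : Matrix (Fin (N + 1)) (Fin (N + 1)) ℂ) 0 0 = 1)
    (h1 : ∀ i : Fin N, (W : Matrix (Fin (N + 1)) (Fin (N + 1)) ℂ) i.succ 0 = 0) :
    ∃ U : UN N, W = liftUN U := by
  set A := (W : Matrix (Fin (N + 1)) (Fin (N + 1)) ℂ) with hA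
  have hAb : A = blk 1 (fun j => A 0 j.succ) 0 (A.submatrix Fin.succ Fin.succ) :=
    ext_blk h0 (fun _ => rfl) h1 fun _ _ => rfl
  have hW : Aᴴ * A = 1 := Unitary.coe_star_mul_self W
  rw [hAb, blk_conjTranspose, blk_mul, one_eq_blk] at hW
  have hr : (fun j : Fin N => A 0 j.succ) = 0 := by
    ext j
    have := congrFun (congrFun hW 0) j.succ
    simpa using this
  rw [hr] at hW hAb
  have hD : (A.submatrix Fin.succ Fin.succ)ᴴ * A.submatrix Fin.succ Fin.succ = 1 := by
    ext i j
    have := congrFun (congrFun hW i.succ) j.succ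
    simpa [vecMulVec_apply] using this
  exact ⟨⟨A.submatrix Fin.succ Fin.succ, mem_unitaryGroup_iff'.2 hD⟩, Subtype.ext hAb⟩

/-! ### An explicit section of the action on the sphere -/

/-- The real number `(1 + |u|²)^(-1/2)`. -/
def cosU (u : Fin N → ℂ) : ℝ := (Real.sqrt (1 + ∑ i, ‖u i‖ ^ 2))⁻¹

theorem cosU_pos (u : Fin N → ℂ) : 0 < cosU u := by unfold cosU; positivity

theorem cosU_sq (u : Fin N → ℂ) : cosU u ^ 2 * (1 + ∑ i, ‖u i‖ ^ 2) = 1 := by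
  have : 0 < 1 + ∑ i, ‖u i‖ ^ 2 := by positivity
  rw [cosU, inv_pow, Real.sq_sqrt this.le, inv_mul_cancel₀ this.ne']

theorem continuous_cosU : Continuous (cosU : (Fin N → ℂ) → ℝ) := by
  unfold cosU
  refine Continuous.inv₀ (by fun_prop) fun u => ?_
  positivity

/-- The underlying matrix of `rotUN`. -/
def rotMat (t : ℝ) (u : Fin N → ℂ) : Matrix (Fin (N + 1)) (Fin (N + 1)) ℂ :=
  blk (cosU u * Complex.exp (t * Complex.I)) (-(cosU u : ℂ) • star u)
    ((cosU u * Complex.exp (t * Complex.I)) • u)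
    (1 - ((cosU u) ^ 2 / (1 + cosU u) : ℂ) • vecMulVec u (star u))

/-- With s = `cosU u` and q = |u|², the relation s²(1 + q) = 1 gives s²q/(1 + s) = 1 − s. So the
lower block multiplies u by s and fixes its orthogonal complement: the matrix is a rotation in the
plane of the first basis vector and u, with a phase on the first column. -/
theorem rotMat_mem (t : ℝ) (u : Fin N → ℂ) : rotMat t u ∈ unitaryGroup (Fin (N + 1)) ℂ := by
  rw [mem_unitaryGroup_iff', star_eq_conjTranspose, rotMat]
  have hz : star (Complex.exp (t * Complex.I)) * Complex.exp (t * Complex.I) = 1 := by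
    rw [Complex.star_def, ← Complex.exp_conj, ← Complex.exp_add]
    simp
  have hs := cosU_pos u
  have hss := cosU_sq u
  set z := Complex.exp (t * Complex.I)
  set s := cosU u
  have hq : star u ⬝ᵥ u = ((∑ i, ‖u i‖ ^ 2 : ℝ) : ℂ) := by
    simp [dotProduct, ← Complex.normSq_eq_conj_mul_self, Complex.normSq_eq_norm_sq]
  have hs2 : (s : ℂ) ^ 2 * (1 + star u ⬝ᵥ u) = 1 := by rw [hq]; exact_mod_cast hss
  have h1 : (1 + s : ℂ) ≠ 0 := by
    have : (1 + s : ℝ) ≠ 0 := by positivity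
    exact_mod_cast this
  have hDH : (1 - ((s : ℂ) ^ 2 / (1 + s)) • vecMulVec u (star u))ᴴ =
      1 - ((s : ℂ) ^ 2 / (1 + s)) • vecMulVec u (star u) := by
    rw [conjTranspose_sub, conjTranspose_smul, conjTranspose_vecMulVec]
    simp
  rw [blk_conjTranspose, blk_mul, one_eq_blk, hDH]
  have hP2 : vecMulVec u (star u) * vecMulVec u (star u) =
      (star u ⬝ᵥ u) • vecMulVec u (star u) := by
    rw [vecMulVec_mul_vecMulVec]
    simp [vecMulVec_smul]
  have hPu : vecMulVec u (star u) *ᵥ u = (star u ⬝ᵥ u) • u := by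
    ext i; simp [vecMulVec_mulVec, mul_comm]
  have huP : star u ᵥ* vecMulVec u (star u) = (star u ⬝ᵥ u) • star u := by
    ext i; simp [vecMul_vecMulVec]
  set q := star u ⬝ᵥ u
  have hk : (s : ℂ) ^ 2 / (1 + s) * q * 1 = 1 - s := by
    field_simp
    linear_combination hs2
  have hsz : star (s * z : ℂ) = s * star z := by simp
  congr 1
  · rw [hsz, star_smul, smul_dotProduct, dotProduct_smul, hsz]
    change _ + _ * (_ * q) = _
    linear_combination ((s : ℂ) ^ 2 * (1 + q)) * hz + hs2
  · rw [hsz, star_smul, hsz, vecMul_sub, vecMul_smul, smul_vecMul, smul_vecMul, huP,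
      vecMul_one]
    ext i
    simp only [Pi.add_apply, Pi.sub_apply, Pi.smul_apply, smul_eq_mul, Pi.zero_apply]
    linear_combination (-(s : ℂ) * star z * star u i) * hk
  · rw [star_smul, star_star, sub_mulVec, one_mulVec, smul_mulVec, mulVec_smul, hPu]
    ext i
    simp only [Pi.add_apply, Pi.sub_apply, Pi.smul_apply, smul_eq_mul, Pi.zero_apply]
    simp
    linear_combination (-(s : ℂ) * z * u i) * hk
  · rw [star_smul, star_star]
    simp only [Matrix.sub_mul, Matrix.mul_sub, Matrix.one_mul, Matrix.mul_one, smul_mul_smul_comm,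
      hP2]
    ext i j
    simp only [Matrix.add_apply, Matrix.sub_apply, Matrix.smul_apply, vecMulVec_apply,
      Pi.smul_apply, smul_eq_mul]
    simp
    have hk2 : (s : ℂ) ^ 2 - 2 * ((s : ℂ) ^ 2 / (1 + s)) +
        ((s : ℂ) ^ 2 / (1 + s)) ^ 2 * q = 0 := by
      have : (s : ℂ) ^ 2 = (s : ℂ) ^ 2 / (1 + s) * (1 + s) := by field_simp
      linear_combination ((s : ℂ) ^ 2 / (1 + s)) * hk + this
    linear_combination (u i * (starRingEnd ℂ) (u j)) * hk2

/-- A unitary matrix whose first column is `e^{it} (1, u) / |(1, u)|`. -/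
def rotUN (t : ℝ) (u : Fin N → ℂ) : UN (N + 1) := ⟨rotMat t u, rotMat_mem t u⟩

theorem continuous_rotUN : Continuous fun p : ℝ × (Fin N → ℂ) => rotUN p.1 p.2 := by
  have hc : Continuous fun p : ℝ × (Fin N → ℂ) => (cosU p.2 : ℂ) :=
    Complex.continuous_ofReal.comp (continuous_cosU.comp continuous_snd)
  have h1 : ∀ p : ℝ × (Fin N → ℂ), (1 + cosU p.2 : ℂ) ≠ 0 := fun p => by
    have : (1 + cosU p.2 : ℝ) ≠ 0 := by have := cosU_pos p.2; positivity
    exact_mod_cast this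
  refine Continuous.subtype_mk (continuous_blk (by fun_prop) (by fun_prop) (by fun_prop) ?_) _
  have h2 : Continuous fun p : ℝ × (Fin N → ℂ) => ((cosU p.2) ^ 2 / (1 + cosU p.2) : ℂ) :=
    (hc.pow 2).div (by fun_prop) h1
  have h3 : Continuous fun p : ℝ × (Fin N → ℂ) => vecMulVec p.2 (star p.2) :=
    continuous_snd.matrix_vecMulVec continuous_snd.star
  exact continuous_const.sub (h2.smul h3)

theorem coe_rotUN (t : ℝ) (u : Fin N → ℂ) :
    (rotUN t u : Matrix (Fin (N + 1)) (Fin (N + 1)) ℂ) = rotMat t u := rfl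

attribute [irreducible] rotUN liftUN

end Blk

end LatticeGauge

end

noncomputable section

open scoped ENNReal NNReal

namespace LatticeGauge

/-! ### Disintegration of the Haar measure along the first column -/

section Disintegration

open Matrix

theorem lintegral_exp_neg_norm_sq :
    ∫⁻ z : ℂ, ENNReal.ofReal (Real.exp (-‖z‖ ^ 2)) = ENNReal.ofReal Real.pi := by
  have h := GaussianFourier.integral_rexp_neg_mul_sq_norm (V := ℂ) (b := 1) one_pos
  have hval : (∫ z : ℂ, Real.exp (-‖z‖ ^ 2)) = Real.pi := by
    simpa using h
  -- A non-integrable function would have integral 0, not π.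
  have hgint : Integrable fun z : ℂ => Real.exp (-‖z‖ ^ 2) := by
    by_contra hn
    rw [integral_undef hn] at hval
    exact Real.pi_ne_zero hval.symm
  rw [← ofReal_integral_eq_lintegral_ofReal hgint (ae_of_all _ fun _ => (Real.exp_pos _).le), hval]

/-- The standard complex Gaussian probability measure on `ℂ^n`. -/
def gaussC (n : ℕ) : Measure (Fin n → ℂ) :=
  volume.withDensity fun x => ENNReal.ofReal ((Real.pi⁻¹) ^ n * Real.exp (-∑ i, ‖x i‖ ^ 2))

theorem measurable_gaussC_density (n : ℕ) : Measurable fun x : Fin n → ℂ =>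
    ENNReal.ofReal ((Real.pi⁻¹) ^ n * Real.exp (-∑ i, ‖x i‖ ^ 2)) := by fun_prop

instance (n : ℕ) : IsProbabilityMeasure (gaussC n) := by
  refine ⟨?_⟩
  rw [gaussC, withDensity_apply _ MeasurableSet.univ, Measure.restrict_univ]
  have : ∀ x : Fin n → ℂ, ENNReal.ofReal ((Real.pi⁻¹) ^ n * Real.exp (-∑ i, ‖x i‖ ^ 2)) =
      ∏ i, ENNReal.ofReal (Real.pi⁻¹ * Real.exp (-‖x i‖ ^ 2)) := by
    intro x
    rw [← ENNReal.ofReal_prod_of_nonneg fun i _ => by positivity, Finset.prod_mul_distrib,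
      ← Real.exp_sum]
    simp
  simp only [this]
  rw [volume_pi, lintegral_fintype_prod_eq_prod (fun _ z => ENNReal.ofReal
    (Real.pi⁻¹ * Real.exp (-‖z‖ ^ 2))) fun _ => by fun_prop]
  have h1 : ∫⁻ z : ℂ, ENNReal.ofReal (Real.pi⁻¹ * Real.exp (-‖z‖ ^ 2)) = 1 := by
    simp only [ENNReal.ofReal_mul (inv_nonneg.2 Real.pi_pos.le)]
    rw [lintegral_const_mul _ (by fun_prop), lintegral_exp_neg_norm_sq,
      ← ENNReal.ofReal_mul (inv_nonneg.2 Real.pi_pos.le), inv_mul_cancel₀ Real.pi_ne_zero,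
      ENNReal.ofReal_one]
  simp [h1]

theorem sum_norm_sq_unitary_mulVec {n : ℕ} (V : UN n) (x : Fin n → ℂ) :
    ∑ i, ‖((V : Matrix (Fin n) (Fin n) ℂ) *ᵥ x) i‖ ^ 2 = ∑ i, ‖x i‖ ^ 2 := by
  have key : ∀ y : Fin n → ℂ, ((∑ i, ‖y i‖ ^ 2 : ℝ) : ℂ) = star y ⬝ᵥ y := by
    intro y
    simp [dotProduct, ← Complex.normSq_eq_conj_mul_self, Complex.normSq_eq_norm_sq]
  have hV : (V : Matrix (Fin n) (Fin n) ℂ)ᴴ * V = 1 := Unitary.coe_star_mul_self V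
  have : ((∑ i, ‖((V : Matrix (Fin n) (Fin n) ℂ) *ᵥ x) i‖ ^ 2 : ℝ) : ℂ) =
      ((∑ i, ‖x i‖ ^ 2 : ℝ) : ℂ) := by
    rw [key, key, star_mulVec, ← dotProduct_mulVec, mulVec_mulVec, hV, one_mulVec]
  exact_mod_cast this

/-- The real Jacobian of a complex linear map is the squared modulus of its complex determinant. -/
theorem lintegral_comp_complex_linear {n : ℕ} (f : (Fin n → ℂ) →ₗ[ℂ] (Fin n → ℂ))
    (hf : LinearMap.det f ≠ 0) (g : (Fin n → ℂ) → ℝ≥0∞) (hg : Measurable g) :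
    ENNReal.ofReal (‖LinearMap.det f‖ ^ 2) * ∫⁻ x, g (f x) = ∫⁻ x, g x := by
  have hdet : LinearMap.det (f.restrictScalars ℝ) = ‖LinearMap.det f‖ ^ 2 := by
    rw [LinearMap.det_restrictScalars, Algebra.norm_complex_apply, Complex.normSq_eq_norm_sq]
  have hpos : 0 < ‖LinearMap.det f‖ ^ 2 := by positivity
  have h := Measure.map_linearMap_addHaar_eq_smul_addHaar (volume : Measure (Fin n → ℂ))
    (f := f.restrictScalars ℝ) (by rw [hdet]; exact hpos.ne')
  have hm : Measurable (f.restrictScalars ℝ) :=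
    (LinearMap.continuous_of_finiteDimensional (f.restrictScalars ℝ)).measurable
  have h2 := lintegral_map (μ := volume) hg hm
  rw [h, lintegral_smul_measure, hdet, abs_of_pos (inv_pos.2 hpos), smul_eq_mul] at h2
  change _ * ∫⁻ x, g ((f.restrictScalars ℝ) x) = _
  rw [← h2, ← mul_assoc, ← ENNReal.ofReal_mul hpos.le, mul_inv_cancel₀ hpos.ne',
    ENNReal.ofReal_one, one_mul]

theorem measurePreserving_gaussC {n : ℕ} (V : UN n) :
    MeasurePreserving (fun x => (V : Matrix (Fin n) (Fin n) ℂ) *ᵥ x) (gaussC n) (gaussC n) := by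
  have hm : Measurable fun x : Fin n → ℂ => (V : Matrix (Fin n) (Fin n) ℂ) *ᵥ x :=
    (Continuous.matrix_mulVec continuous_const continuous_id).measurable
  refine ⟨hm, ?_⟩
  have hdet : ‖LinearMap.det (Matrix.toLin' (V : Matrix (Fin n) (Fin n) ℂ))‖ = 1 := by
    rw [LinearMap.det_toLin']
    exact CStarRing.norm_of_mem_unitary (Matrix.det_of_mem_unitary V.2)
  refine Measure.ext fun s hs => ?_
  rw [Measure.map_apply hm hs, gaussC, withDensity_apply _ hs, withDensity_apply _ (hm hs),
    ← lintegral_indicator hs, ← lintegral_indicator (hm hs),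
    ← lintegral_comp_complex_linear (Matrix.toLin' (V : Matrix (Fin n) (Fin n) ℂ))
      (by rw [← norm_ne_zero_iff, hdet]; exact one_ne_zero) _
      ((measurable_gaussC_density n).indicator hs), hdet]
  simp only [one_pow, ENNReal.ofReal_one, one_mul]
  refine lintegral_congr fun x => ?_
  simp only [Set.indicator, Matrix.toLin'_apply, sum_norm_sq_unitary_mulVec]
  rfl

variable {N : ℕ}

/-- A measurable choice of a unitary matrix with first column `x / |x|`. -/
def secUN (x : Fin (N + 1) → ℂ) : UN (N + 1) :=
  rotUN (Complex.arg (x 0)) fun i => x i.succ / x 0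

theorem measurable_secUN : Measurable (secUN : (Fin (N + 1) → ℂ) → UN (N + 1)) := by
  have h : Measurable fun x : Fin (N + 1) → ℂ =>
      ((Complex.arg (x 0), fun i : Fin N => x i.succ / x 0) : ℝ × (Fin N → ℂ)) := by
    refine (Complex.measurable_arg.comp (measurable_pi_apply 0)).prodMk ?_
    exact measurable_pi_lambda _ fun i => (measurable_pi_apply _).div (measurable_pi_apply 0)
  have h2 : (secUN : (Fin (N + 1) → ℂ) → UN (N + 1)) = (fun p => rotUN p.1 p.2) ∘
      fun x => ((Complex.arg (x 0), fun i : Fin N => x i.succ / x 0) : ℝ × (Fin N → ℂ)) := by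
    funext x; rw [secUN, Function.comp_apply]
  rw [h2]
  exact Measurable.comp (Continuous.measurable continuous_rotUN) h

theorem secUN_apply_zero {x : Fin (N + 1) → ℂ} (hx : x 0 ≠ 0) (i : Fin (N + 1)) :
    (secUN x : Matrix (Fin (N + 1)) (Fin (N + 1)) ℂ) i 0 =
      x i / (Real.sqrt (∑ i, ‖x i‖ ^ 2) : ℝ) := by
  have h0 : 0 < ‖x 0‖ := norm_pos_iff.2 hx
  have hc : cosU (fun i : Fin N => x i.succ / x 0) = ‖x 0‖ / Real.sqrt (∑ i, ‖x i‖ ^ 2) := by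
    have : 1 + ∑ i : Fin N, ‖x i.succ / x 0‖ ^ 2 = (∑ i, ‖x i‖ ^ 2) / ‖x 0‖ ^ 2 := by
      rw [Fin.sum_univ_succ, add_div, div_self (by positivity), Finset.sum_div]
      simp [div_pow]
    rw [cosU, this, Real.sqrt_div (by positivity), Real.sqrt_sq h0.le, inv_div]
  have he : (‖x 0‖ : ℂ) * Complex.exp (Complex.arg (x 0) * Complex.I) = x 0 :=
    Complex.norm_mul_exp_arg_mul_I _
  have h00 : (cosU (fun i : Fin N => x i.succ / x 0) : ℂ) *
      Complex.exp (Complex.arg (x 0) * Complex.I) = x 0 / (Real.sqrt (∑ i, ‖x i‖ ^ 2) : ℝ) := by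
    rw [hc]; push_cast; rw [div_mul_eq_mul_div, he]
  rw [secUN, coe_rotUN]
  refine Fin.cases ?_ (fun i => ?_) i
  · exact h00
  · change ((cosU (fun i : Fin N => x i.succ / x 0) : ℂ) *
      Complex.exp (Complex.arg (x 0) * Complex.I)) * (x i.succ / x 0) = _
    rw [h00]
    field_simp

theorem ae_gaussC_ne_zero : ∀ᵐ x ∂(gaussC (N + 1)), x 0 ≠ 0 := by
  refine (withDensity_absolutelyContinuous _ _).ae_le ?_
  rw [volume_pi]
  exact Measure.ae_eval_ne (μ := fun _ : Fin (N + 1) => (volume : Measure ℂ)) 0 0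

/-- Both `V * secUN x` and the section at Vx have first column Vx/|x|, as V preserves the norm. They
differ by an element of the stabilizer of the first basis vector, which is a copy of U(N). -/
theorem exists_mul_secUN (V : UN (N + 1)) {x : Fin (N + 1) → ℂ} (hx : x 0 ≠ 0)
    (hVx : ((V : Matrix (Fin (N + 1)) (Fin (N + 1)) ℂ) *ᵥ x) 0 ≠ 0) :
    ∃ W : UN N, V * secUN x =
      secUN ((V : Matrix (Fin (N + 1)) (Fin (N + 1)) ℂ) *ᵥ x) * liftUN W := by
  set y := (V : Matrix (Fin (N + 1)) (Fin (N + 1)) ℂ) *ᵥ x with hy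
  set R := secUN y
  have hcol : ∀ i, ((V * secUN x : UN (N + 1)) : Matrix (Fin (N + 1)) (Fin (N + 1)) ℂ) i 0 =
      (R : Matrix (Fin (N + 1)) (Fin (N + 1)) ℂ) i 0 := by
    intro i
    rw [secUN_apply_zero hVx, hy, sum_norm_sq_unitary_mulVec, Submonoid.coe_mul, Matrix.mul_apply]
    simp only [secUN_apply_zero hx, mulVec, dotProduct, Finset.sum_div, mul_div_assoc]
  have hW : ∀ i, ((R⁻¹ * (V * secUN x) : UN (N + 1)) : Matrix (Fin (N + 1)) (Fin (N + 1)) ℂ) i 0 =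
      (1 : Matrix (Fin (N + 1)) (Fin (N + 1)) ℂ) i 0 := by
    intro i
    have h1 : ((R⁻¹ : UN (N + 1)) : Matrix (Fin (N + 1)) (Fin (N + 1)) ℂ) *
        (R : Matrix (Fin (N + 1)) (Fin (N + 1)) ℂ) = 1 := by
      rw [← Submonoid.coe_mul, inv_mul_cancel]; rfl
    rw [← h1, Submonoid.coe_mul, Matrix.mul_apply, Matrix.mul_apply]
    simp only [hcol]
  obtain ⟨W, hW'⟩ := exists_eq_liftUN (R⁻¹ * (V * secUN x)) (by rw [hW]; simp)
    fun i => by rw [hW]; simp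
  exact ⟨W, by rw [← hW', mul_inv_cancel_left]⟩

/-- If `x` is Gaussian and `U` is Haar distributed in `U(N)`, then `secUN x * liftUN U` is Haar
distributed in `U(N+1)`. -/
theorem lintegral_haarUN_succ (f : UN (N + 1) → ℝ≥0∞) (hf : Measurable f) :
    ∫⁻ U, f U ∂(haarUN (N + 1)) =
      ∫⁻ x, ∫⁻ U, f (secUN x * liftUN U) ∂(haarUN N) ∂(gaussC (N + 1)) := by
  have hm : Measurable fun p : (Fin (N + 1) → ℂ) × UN N => secUN p.1 * liftUN p.2 :=
    (measurable_secUN.comp measurable_fst).mul (continuous_liftUN.measurable.comp measurable_snd)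
  set μ := ((gaussC (N + 1)).prod (haarUN N)).map fun p => secUN p.1 * liftUN p.2 with hμ
  have hprob : IsProbabilityMeasure μ := Measure.isProbabilityMeasure_map hm.aemeasurable
  have hgint : ∀ g : UN (N + 1) → ℝ≥0∞, Measurable g →
      ∫⁻ U, g U ∂μ = ∫⁻ x, ∫⁻ U, g (secUN x * liftUN U) ∂(haarUN N) ∂(gaussC (N + 1)) := by
    intro g hg
    rw [hμ, lintegral_map hg hm, lintegral_prod (fun p => g (secUN p.1 * liftUN p.2))
      (hg.comp hm).aemeasurable]
  rw [← hgint f hf, ← eq_haarUN_of_invariant μ]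
  intro V
  refine Measure.ext fun s hs => ?_
  have hVm : Measurable fun U : UN (N + 1) => V * U := measurable_const_mul V
  have hg : Measurable (s.indicator (1 : UN (N + 1) → ℝ≥0∞)) := measurable_one.indicator hs
  rw [← lintegral_indicator_one hs, ← lintegral_indicator_one hs, lintegral_map hg hVm,
    hgint (fun U => s.indicator 1 (V * U)) (hg.comp hVm), hgint _ hg]
  set h : (Fin (N + 1) → ℂ) → ℝ≥0∞ := fun x =>
    ∫⁻ U, s.indicator 1 (secUN x * liftUN U) ∂(haarUN N) with hh
  have hhm : Measurable h := (hg.comp hm).lintegral_prod_right'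
  have hpres := measurePreserving_gaussC V
  -- Translation by V replaces x by Vx, which preserves the Gaussian law, and multiplies the factor
  -- from U(N) by some W depending only on x, which Haar measure on U(N) absorbs.
  rw [← hpres.lintegral_comp hhm]
  refine lintegral_congr_ae ?_
  filter_upwards [ae_gaussC_ne_zero, hpres.quasiMeasurePreserving.ae ae_gaussC_ne_zero] with x h1 h2
  obtain ⟨W, hW⟩ := exists_mul_secUN V h1 h2
  have : ∀ U : UN N, V * (secUN x * liftUN U) =
      secUN ((V : Matrix (Fin (N + 1)) (Fin (N + 1)) ℂ) *ᵥ x) * liftUN (W * U) := by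
    intro U
    rw [← mul_assoc, hW, liftUN_mul, mul_assoc]
  simp only [this, hh]
  exact lintegral_mul_left_eq_self (μ := haarUN N) (fun U => s.indicator 1
    (secUN ((V : Matrix (Fin (N + 1)) (Fin (N + 1)) ℂ) *ᵥ x) * liftUN U)) W

end Disintegration

end LatticeGauge

end

noncomputable section

open scoped ENNReal NNReal

namespace LatticeGauge

/-! ### The law of the first column in projective coordinates -/

section Projective

/-- This is the radial integral left by polar coordinates: r^(2N) comes from substituting y = zu in
N complex coordinates, and one more r from the polar Jacobian. -/
theorem lintegral_pow_mul_exp_neg_mul_sq (N : ℕ) {b : ℝ} (hb : 0 < b) :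
    ∫⁻ r in Set.Ioi (0 : ℝ), ENNReal.ofReal (r ^ (2 * N + 1) * Real.exp (-(b * r ^ 2))) =
      ENNReal.ofReal (N ! / 2 * (b ^ (N + 1))⁻¹) := by
  have h := integral_rpow_mul_exp_neg_mul_rpow (p := 2) (q := 2 * N + 1) (b := b) two_pos
    (by have : (0 : ℝ) ≤ N := N.cast_nonneg
        linarith) hb
  have hi := integrableOn_rpow_mul_exp_neg_mul_rpow (p := 2) (s := 2 * N + 1) (b := b)
    (by have : (0 : ℝ) ≤ N := N.cast_nonneg
        linarith) two_pos hb
  have hcongr : ∀ r ∈ Set.Ioi (0 : ℝ), r ^ (2 * N + 1) * Real.exp (-(b * r ^ 2)) =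
      r ^ (2 * (N : ℝ) + 1) * Real.exp (-b * r ^ (2 : ℝ)) := by
    intro r hr
    rw [show (2 * (N : ℝ) + 1) = ((2 * N + 1 : ℕ) : ℝ) by push_cast; ring, Real.rpow_natCast,
      Real.rpow_two, neg_mul]
  rw [setLIntegral_congr_fun measurableSet_Ioi fun r hr => by rw [hcongr r hr],
    ← ofReal_integral_eq_lintegral_ofReal hi ?_, h]
  · congr 1
    rw [show (2 * (N : ℝ) + 1 + 1) / 2 = N + 1 by ring, Real.Gamma_nat_eq_factorial,
      show -(2 * (N : ℝ) + 1 + 1) / 2 = -((N + 1 : ℕ) : ℝ) by push_cast; ring,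
      Real.rpow_neg hb.le, Real.rpow_natCast]
    ring
  · refine (ae_restrict_iff' measurableSet_Ioi).2 (ae_of_all _ fun r hr => ?_)
    have : 0 < r := hr
    positivity

variable {N : ℕ}

/-- The joint law of the phase `arg x₀` and of the ratios `x_i / x₀` of a Gaussian vector. -/
theorem lintegral_gaussC_succ (H : ℝ × (Fin N → ℂ) → ℝ≥0∞) (hH : Measurable H) :
    ∫⁻ x, H (Complex.arg (x 0), fun i => x i.succ / x 0) ∂(gaussC (N + 1)) =
      ∫⁻ t in Set.Ioo (-Real.pi) Real.pi, ∫⁻ u, ENNReal.ofReal (N ! / 2 * (Real.pi⁻¹) ^ (N + 1) *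
        ((1 + ∑ i, ‖u i‖ ^ 2) ^ (N + 1))⁻¹) * H (t, u) := by
  set c : ℝ := (Real.pi⁻¹) ^ (N + 1) with hc
  have hc0 : 0 ≤ c := by positivity
  have hHm : Measurable fun x : Fin (N + 1) → ℂ =>
      H (Complex.arg (x 0), fun i : Fin N => x i.succ / x 0) := by
    refine hH.comp ((Complex.measurable_arg.comp (measurable_pi_apply 0)).prodMk ?_)
    exact measurable_pi_lambda _ fun i => (measurable_pi_apply _).div (measurable_pi_apply 0)
  -- the density in polar coordinates for `x₀`
  set G : ℝ → ℝ → (Fin N → ℂ) → ℝ≥0∞ := fun r t u =>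
    ENNReal.ofReal (c * (r ^ (2 * N + 1) * Real.exp (-((1 + ∑ i, ‖u i‖ ^ 2) * r ^ 2)))) * H (t, u)
  have hGm : Measurable fun p : (ℝ × ℝ) × (Fin N → ℂ) => G p.1.1 p.1.2 p.2 := by
    refine Measurable.mul (by fun_prop) (hH.comp (by fun_prop))
  rw [gaussC, lintegral_withDensity_eq_lintegral_mul _ (measurable_gaussC_density _) hHm]
  simp only [Pi.mul_apply]
  have h1 : ∫⁻ x : Fin (N + 1) → ℂ, ENNReal.ofReal (c * Real.exp (-∑ i, ‖x i‖ ^ 2)) *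
        H (Complex.arg (x 0), fun i : Fin N => x i.succ / x 0) =
      ∫⁻ z : ℂ, ∫⁻ y : Fin N → ℂ, ENNReal.ofReal (c * Real.exp (-(‖z‖ ^ 2 + ∑ i, ‖y i‖ ^ 2))) *
        H (Complex.arg z, fun i => y i / z) := by
    have hmp := (volume_preserving_piFinSuccAbove (fun _ : Fin (N + 1) => ℂ) 0).symm
    rw [← hmp.lintegral_comp (by fun_prop), Measure.volume_eq_prod, lintegral_prod]
    · refine lintegral_congr fun z => lintegral_congr fun y => ?_
      simp [Fin.sum_univ_succ, MeasurableEquiv.piFinSuccAbove_symm_apply, Fin.insertNthEquiv]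
    · have hFm : Measurable fun x : Fin (N + 1) → ℂ =>
          ENNReal.ofReal (c * Real.exp (-∑ i, ‖x i‖ ^ 2)) *
            H (Complex.arg (x 0), fun i : Fin N => x i.succ / x 0) :=
        Measurable.mul (by fun_prop) hHm
      exact (hFm.comp hmp.measurable).aemeasurable
  -- The substitution y = zu, of real Jacobian |z|^(2N), passes to the ratios u.
  have h2 : ∀ z : ℂ, z ≠ 0 →
      ∫⁻ y : Fin N → ℂ, ENNReal.ofReal (c * Real.exp (-(‖z‖ ^ 2 + ∑ i, ‖y i‖ ^ 2))) *
        H (Complex.arg z, fun i => y i / z) =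
      ∫⁻ u : Fin N → ℂ, ENNReal.ofReal (c * (‖z‖ ^ (2 * N) *
        Real.exp (-((1 + ∑ i, ‖u i‖ ^ 2) * ‖z‖ ^ 2)))) * H (Complex.arg z, u) := by
    intro z hz
    have hdet : LinearMap.det (z • (LinearMap.id : (Fin N → ℂ) →ₗ[ℂ] (Fin N → ℂ))) = z ^ N := by
      simp
    rw [← lintegral_comp_complex_linear (z • LinearMap.id)
      (by rw [hdet]; exact pow_ne_zero _ hz) _ ?_, hdet, ← lintegral_const_mul']
    · refine lintegral_congr fun u => ?_
      rw [← mul_assoc, ← ENNReal.ofReal_mul (by positivity)]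
      congr 2
      · simp only [LinearMap.smul_apply, LinearMap.id_apply, Pi.smul_apply, smul_eq_mul, norm_mul,
          norm_pow, mul_pow, ← Finset.mul_sum, ← pow_mul]
        rw [show (1 + ∑ i, ‖u i‖ ^ 2) * ‖z‖ ^ 2 = ‖z‖ ^ 2 + ‖z‖ ^ 2 * ∑ i, ‖u i‖ ^ 2 by ring]
        ring
      · congr 1
        simp [hz]
    · exact ENNReal.ofReal_ne_top
    · refine Measurable.mul (by fun_prop) (hH.comp ?_)
      exact measurable_const.prodMk (measurable_pi_lambda _ fun i =>
        Measurable.div_const (f := fun y : Fin N → ℂ => y i) (measurable_pi_apply i) z)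
  rw [h1, lintegral_congr_ae (g := fun z : ℂ => ∫⁻ u : Fin N → ℂ,
    ENNReal.ofReal (c * (‖z‖ ^ (2 * N) * Real.exp (-((1 + ∑ i, ‖u i‖ ^ 2) * ‖z‖ ^ 2)))) *
      H (Complex.arg z, u))
    ((Measure.ae_ne volume (0 : ℂ)).mono fun z hz => h2 z hz),
    ← Complex.lintegral_comp_polarCoord_symm]
  have h3 : ∀ p ∈ polarCoord.target, ENNReal.ofReal p.1 • (∫⁻ u : Fin N → ℂ,
      ENNReal.ofReal (c * (‖Complex.polarCoord.symm p‖ ^ (2 * N) *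
        Real.exp (-((1 + ∑ i, ‖u i‖ ^ 2) * ‖Complex.polarCoord.symm p‖ ^ 2)))) *
      H (Complex.arg (Complex.polarCoord.symm p), u)) = ∫⁻ u, G p.1 p.2 u := by
    intro p hp
    have hp' : 0 < p.1 ∧ -Real.pi < p.2 ∧ p.2 < Real.pi := by
      simpa [polarCoord_target] using hp
    have harg : Complex.arg (Complex.polarCoord.symm p) = p.2 := by
      rw [Complex.polarCoord_symm_apply, Complex.ofReal_cos, Complex.ofReal_sin,
        Complex.arg_mul_cos_add_sin_mul_I hp'.1 ⟨hp'.2.1, hp'.2.2.le⟩]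
    rw [harg, Complex.norm_polarCoord_symm, abs_of_pos hp'.1, smul_eq_mul,
      ← lintegral_const_mul' _ _ ENNReal.ofReal_ne_top]
    refine lintegral_congr fun u => ?_
    rw [← mul_assoc, ← ENNReal.ofReal_mul hp'.1.le]
    congr 2
    ring
  rw [setLIntegral_congr_fun polarCoord.open_target.measurableSet h3, polarCoord_target,
    Measure.volume_eq_prod, ← Measure.prod_restrict, lintegral_prod_symm]
  · refine lintegral_congr fun t => ?_
    -- With the phase t and the ratios u fixed, only the radius remains to be integrated out.
    rw [lintegral_lintegral_swap]
    · refine lintegral_congr fun u => ?_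
      have hb : 0 < 1 + ∑ i, ‖u i‖ ^ 2 := by positivity
      simp only [G]
      rw [lintegral_mul_const _ (by fun_prop)]
      congr 1
      simp only [ENNReal.ofReal_mul hc0]
      rw [lintegral_const_mul _ (by fun_prop), lintegral_pow_mul_exp_neg_mul_sq N hb,
        ← ENNReal.ofReal_mul hc0]
      congr 1
      ring
    · refine Measurable.aemeasurable ?_
      exact hGm.comp (f := fun q : ℝ × (Fin N → ℂ) => ((q.1, t), q.2)) (by fun_prop)
  · exact (hGm.lintegral_prod_right' (f := fun p : (ℝ × ℝ) × (Fin N → ℂ) =>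
      G p.1.1 p.1.2 p.2)).aemeasurable

end Projective

end LatticeGauge

end

noncomputable section

open scoped ENNReal NNReal

namespace LatticeGauge

/-! ### A chart of `U(N)` near the identity -/

section RealCoordinates

variable {N : ℕ}

theorem lintegral_sum_pi {α β : Type*} [Fintype α] [Fintype β] (F : (α ⊕ β → ℝ) → ℝ≥0∞)
    (hF : Measurable F) : ∫⁻ z, F z = ∫⁻ y : β → ℝ, ∫⁻ x : α → ℝ, F (Sum.elim x y) := by
  have h := (volume_measurePreserving_sumPiEquivProdPi_symm (fun _ : α ⊕ β => ℝ))
  rw [← h.lintegral_comp hF, Measure.volume_eq_prod,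
    lintegral_prod_symm (fun p => F ((MeasurableEquiv.sumPiEquivProdPi fun _ : α ⊕ β => ℝ).symm p))
      (hF.comp h.measurable).aemeasurable]
  refine lintegral_congr fun y => lintegral_congr fun x => ?_
  congr 1

theorem lintegral_unit_pi (F : (Unit → ℝ) → ℝ≥0∞) (hF : Measurable F) :
    ∫⁻ z, F z = ∫⁻ t : ℝ, F fun _ => t := by
  have h := (volume_preserving_funUnique Unit ℝ).symm
  rw [← h.lintegral_comp hF]
  rfl

/-- The √2 appears because each off-diagonal entry of a skew-Hermitian matrix occurs twice, in the
first row and in the first column. It makes the coordinates orthonormal for the Hilbert–Schmidt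
norm, at the price of a Jacobian 1/2 per complex coordinate. -/
theorem lintegral_pi_complex (F : (Fin N → ℂ) → ℝ≥0∞) (hF : Measurable F) :
    ∫⁻ u, F u = ENNReal.ofReal ((1 / 2) ^ N) * ∫⁻ z : Fin N ⊕ Fin N → ℝ,
      F fun i => (z (.inl i) + z (.inr i) * Complex.I) / (Real.sqrt 2 : ℝ) := by
  have h1 := volume_measurePreserving_sumPiEquivProdPi (fun _ : Fin N ⊕ Fin N => ℝ)
  have h2 := (volume_measurePreserving_arrowProdEquivProdArrow ℝ ℝ (Fin N)).symm
  have h3 := volume_preserving_pi (ι := Fin N) fun _ => Complex.volume_preserving_equiv_real_prod.symm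
  have h4 := (h3.comp h2).comp h1
  have hz : ((Real.sqrt 2 : ℝ) : ℂ)⁻¹ ≠ 0 := by simp
  have hdet : LinearMap.det (((Real.sqrt 2 : ℝ) : ℂ)⁻¹ •
      (LinearMap.id : (Fin N → ℂ) →ₗ[ℂ] (Fin N → ℂ))) = (((Real.sqrt 2 : ℝ) : ℂ)⁻¹) ^ N := by
    simp
  rw [← lintegral_comp_complex_linear (((Real.sqrt 2 : ℝ) : ℂ)⁻¹ • LinearMap.id)
    (by rw [hdet]; exact pow_ne_zero _ hz) F hF, hdet, ← h4.lintegral_comp]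
  · congr 1
    · rw [norm_pow, norm_inv, Complex.norm_real, Real.norm_of_nonneg (Real.sqrt_nonneg _), ← pow_mul,
        mul_comm N, pow_mul, inv_pow, Real.sq_sqrt zero_le_two, one_div]
    · refine lintegral_congr fun z => ?_
      congr 1
      ext i
      change ((Real.sqrt 2 : ℝ) : ℂ)⁻¹ * (⟨z (.inl i), z (.inr i)⟩ : ℂ) = _
      rw [Complex.mk_eq_add_mul_I, div_eq_inv_mul]
  · exact hF.comp (LinearMap.continuous_of_finiteDimensional _).measurable

/-- The coordinates added when passing from `U(N)` to `U(N+1)`. -/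
abbrev ColIndex (N : ℕ) : Type := Unit ⊕ (Fin N ⊕ Fin N)

/-- The complex vector with coordinates `(y, y') / √2`. -/
def colVec (y : ColIndex N → ℝ) : Fin N → ℂ := fun i =>
  (y (.inr (.inl i)) + y (.inr (.inr i)) * Complex.I) / (Real.sqrt 2 : ℝ)

theorem norm_colVec_sq (y : ColIndex N → ℝ) (i : Fin N) :
    ‖colVec y i‖ ^ 2 = (y (.inr (.inl i)) ^ 2 + y (.inr (.inr i)) ^ 2) / 2 := by
  rw [colVec, norm_div, div_pow, Complex.norm_real, Real.norm_of_nonneg (Real.sqrt_nonneg _),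
    Real.sq_sqrt zero_le_two, ← Complex.normSq_eq_norm_sq, Complex.normSq_add_mul_I]

/-- `rotUN` in real coordinates. -/
def colUN (y : ColIndex N → ℝ) : UN (N + 1) := rotUN (y (.inl ())) (colVec y)

theorem continuous_colVec : Continuous (colVec : (ColIndex N → ℝ) → Fin N → ℂ) := by
  unfold colVec
  fun_prop

theorem continuous_colUN : Continuous (colUN : (ColIndex N → ℝ) → UN (N + 1)) := by
  have h : Continuous fun y : ColIndex N → ℝ => ((y (.inl ()), colVec y) : ℝ × (Fin N → ℂ)) :=
    (continuous_apply _).prodMk continuous_colVec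
  have h2 : (colUN : (ColIndex N → ℝ) → UN (N + 1)) = (fun p => rotUN p.1 p.2) ∘
      fun y => ((y (.inl ()), colVec y) : ℝ × (Fin N → ℂ)) := rfl
  rw [h2]
  exact continuous_rotUN.comp h

/-- The Haar measure of `U(N+1)` in terms of that of `U(N)` and `2N+1` real coordinates. -/
theorem lintegral_haarUN_succ_real (f : UN (N + 1) → ℝ≥0∞) (hf : Measurable f) :
    ∫⁻ U, f U ∂(haarUN (N + 1)) = ENNReal.ofReal (N ! / (2 * Real.pi) ^ (N + 1)) *
      ∫⁻ y : ColIndex N → ℝ, {y : ColIndex N → ℝ | |y (.inl ())| < Real.pi}.indicator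
        (fun y => ENNReal.ofReal (((1 + ∑ i, ‖colVec y i‖ ^ 2) ^ (N + 1))⁻¹) *
          ∫⁻ U, f (colUN y * liftUN U) ∂(haarUN N)) y := by
  have hm : Measurable fun p : (ℝ × (Fin N → ℂ)) × UN N => rotUN p.1.1 p.1.2 * liftUN p.2 := by
    refine Measurable.mul ?_ (continuous_liftUN.measurable.comp measurable_snd)
    exact (Continuous.measurable continuous_rotUN).comp measurable_fst
  have hHm : Measurable fun p : ℝ × (Fin N → ℂ) =>
      ∫⁻ U, f (rotUN p.1 p.2 * liftUN U) ∂(haarUN N) := (hf.comp hm).lintegral_prod_right'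
  rw [lintegral_haarUN_succ f hf]
  have h1 := lintegral_gaussC_succ (fun p : ℝ × (Fin N → ℂ) =>
      ∫⁻ U, f (rotUN p.1 p.2 * liftUN U) ∂(haarUN N)) hHm
  rw [show (fun x : Fin (N + 1) → ℂ => ∫⁻ U, f (secUN x * liftUN U) ∂(haarUN N)) = fun x =>
    ∫⁻ U, f (rotUN (Complex.arg (x 0)) (fun i => x i.succ / x 0) * liftUN U) ∂(haarUN N) from rfl,
    h1]
  have hF2 : Measurable fun y : ColIndex N → ℝ =>
      {y : ColIndex N → ℝ | |y (.inl ())| < Real.pi}.indicator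
        (fun y => ENNReal.ofReal (((1 + ∑ i, ‖colVec y i‖ ^ 2) ^ (N + 1))⁻¹) *
          ∫⁻ U, f (colUN y * liftUN U) ∂(haarUN N)) y := by
    refine Measurable.indicator ?_ (measurableSet_lt (by fun_prop) measurable_const)
    refine Measurable.mul ?_ ?_
    · have := (continuous_colVec (N := N)).measurable
      fun_prop
    · have hy : Measurable fun y : ColIndex N → ℝ =>
          ((y (.inl ()), colVec y) : ℝ × (Fin N → ℂ)) :=
        (measurable_pi_apply _).prodMk continuous_colVec.measurable
      exact hHm.comp hy
  rw [lintegral_sum_pi _ hF2]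
  -- The constant of the projective law and the Jacobian 2^(−N) combine to the factor that U(N+1)
  -- adds to the Haar density.
  have hconst : N ! / (2 * Real.pi) ^ (N + 1) =
      (N ! / 2 * (Real.pi⁻¹) ^ (N + 1)) * (1 / 2) ^ N := by
    rw [mul_pow, inv_pow, one_div, inv_pow]
    field_simp
    ring
  have hc1 : (0 : ℝ) ≤ N ! / 2 * (Real.pi⁻¹) ^ (N + 1) := by positivity
  rw [← lintegral_indicator measurableSet_Ioo]
  have hstep : ∀ t : ℝ, (Set.Ioo (-Real.pi) Real.pi).indicator (fun t => ∫⁻ u : Fin N → ℂ,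
      ENNReal.ofReal (N ! / 2 * (Real.pi⁻¹) ^ (N + 1) * ((1 + ∑ i, ‖u i‖ ^ 2) ^ (N + 1))⁻¹) *
        ∫⁻ U, f (rotUN t u * liftUN U) ∂(haarUN N)) t =
      ENNReal.ofReal (N ! / (2 * Real.pi) ^ (N + 1)) * ∫⁻ z : Fin N ⊕ Fin N → ℝ,
        {y : ColIndex N → ℝ | |y (.inl ())| < Real.pi}.indicator
          (fun y => ENNReal.ofReal (((1 + ∑ i, ‖colVec y i‖ ^ 2) ^ (N + 1))⁻¹) *
            ∫⁻ U, f (colUN y * liftUN U) ∂(haarUN N)) (Sum.elim (fun _ => t) z) := by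
    intro t
    by_cases ht : t ∈ Set.Ioo (-Real.pi) Real.pi
    · rw [Set.indicator_of_mem ht]
      have hmem : ∀ z : Fin N ⊕ Fin N → ℝ, (Sum.elim (fun _ => t) z : ColIndex N → ℝ) ∈
          {y : ColIndex N → ℝ | |y (.inl ())| < Real.pi} := fun z => abs_lt.2 ht
      simp only [Set.indicator_of_mem (hmem _)]
      simp only [ENNReal.ofReal_mul hc1]
      simp_rw [mul_assoc (ENNReal.ofReal (N ! / 2 * (Real.pi⁻¹) ^ (N + 1)))]
      rw [lintegral_const_mul' _ _ ENNReal.ofReal_ne_top, lintegral_pi_complex, hconst,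
        ENNReal.ofReal_mul hc1, mul_assoc]
      · rfl
      · refine Measurable.mul (by fun_prop) ?_
        exact hHm.comp (measurable_const.prodMk measurable_id)
    · rw [Set.indicator_of_notMem ht]
      have hmem : ∀ z : Fin N ⊕ Fin N → ℝ, (Sum.elim (fun _ => t) z : ColIndex N → ℝ) ∉
          {y : ColIndex N → ℝ | |y (.inl ())| < Real.pi} := fun z h => ht (abs_lt.1 h)
      simp [Set.indicator_of_notMem (hmem _)]
  simp only [hstep]
  rw [lintegral_const_mul' _ _ ENNReal.ofReal_ne_top]
  congr 1
  have hF3 : Measurable fun p : (Fin N ⊕ Fin N → ℝ) × (Unit → ℝ) =>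
      {y : ColIndex N → ℝ | |y (.inl ())| < Real.pi}.indicator
        (fun y => ENNReal.ofReal (((1 + ∑ i, ‖colVec y i‖ ^ 2) ^ (N + 1))⁻¹) *
          ∫⁻ U, f (colUN y * liftUN U) ∂(haarUN N)) (Sum.elim p.2 p.1) :=
    hF2.comp (measurable_pi_iff.2 fun i => by rcases i with i | i <;> simp <;> fun_prop)
  symm
  rw [lintegral_lintegral_swap hF3.aemeasurable, lintegral_unit_pi]
  exact (hF3.comp measurable_swap).lintegral_prod_right'

end RealCoordinates

end LatticeGauge

end

noncomputable section

open scoped ENNReal NNReal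

namespace LatticeGauge

/-! ### Second-order estimates for the column coordinates -/

section ColumnEstimates

variable {N : ℕ}

/-- The cube of side `2r` centred at the origin. -/
def cube (ι : Type*) (r : ℝ) : Set (ι → ℝ) := {θ | ∀ i, |θ i| ≤ r}

theorem mem_cube {ι : Type*} {r : ℝ} {θ : ι → ℝ} : θ ∈ cube ι r ↔ ∀ i, |θ i| ≤ r := Iff.rfl

theorem cube_mono {ι : Type*} {r s : ℝ} (h : r ≤ s) : cube ι r ⊆ cube ι s :=
  fun _ hθ i => (hθ i).trans h

theorem measurableSet_cube {ι : Type*} [Finite ι] (r : ℝ) : MeasurableSet (cube ι r) := by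
  have : cube ι r = ⋂ i, {θ | |θ i| ≤ r} := by ext; simp [mem_cube]
  rw [this]
  exact MeasurableSet.iInter fun i => measurableSet_le (by fun_prop) measurable_const

/-- The linearization of `colUN`. -/
def colLin (y : ColIndex N → ℝ) : Matrix (Fin (N + 1)) (Fin (N + 1)) ℂ :=
  blk (y (.inl ()) * Complex.I) (-star (colVec y)) (colVec y) 0

theorem norm_colVec_le {y : ColIndex N → ℝ} {r : ℝ} (hr : 0 ≤ r) (hy : y ∈ cube _ r) (i : Fin N) :
    ‖colVec y i‖ ≤ r := by
  refine (sq_le_sq₀ (norm_nonneg _) hr).1 ?_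
  rw [norm_colVec_sq]
  have h1 := sq_le_sq₀ (abs_nonneg _) hr |>.2 (hy (.inr (.inl i)))
  have h2 := sq_le_sq₀ (abs_nonneg _) hr |>.2 (hy (.inr (.inr i)))
  rw [sq_abs] at h1 h2
  linarith

theorem one_sub_cosU_le (u : Fin N → ℂ) : 1 - cosU u ≤ ∑ i, ‖u i‖ ^ 2 := by
  have h1 := cosU_sq u
  have h2 := cosU_pos u
  set q := ∑ i, ‖u i‖ ^ 2
  have hq : 0 ≤ q := by positivity
  by_contra h
  push Not at h
  have h3 : cosU u < 1 := by linarith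
  have h4 : cosU u ^ 2 * (1 + q) < 1 := by
    have : cosU u ^ 2 ≤ cosU u := by nlinarith
    have : cosU u ^ 2 * (1 + q) ≤ cosU u * (1 + q) := by gcongr
    nlinarith
  linarith

theorem cosU_le_one (u : Fin N → ℂ) : cosU u ≤ 1 := by
  have h1 := cosU_sq u
  have h2 := cosU_pos u
  have hq : 0 ≤ ∑ i, ‖u i‖ ^ 2 := by positivity
  nlinarith

theorem norm_blk_le {a : ℂ} {r c : Fin N → ℂ} {D : Matrix (Fin N) (Fin N) ℂ} {b : ℝ}
    (ha : ‖a‖ ≤ b) (hr : ∀ j, ‖r j‖ ≤ b) (hc : ∀ i, ‖c i‖ ≤ b) (hD : ∀ i j, ‖D i j‖ ≤ b) :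
    hs (blk a r c D) ≤ (N + 1) * b := by
  have := hs_le_of_forall_le (blk a r c D) (c := b) fun i j => by
    refine Fin.cases ?_ (fun i => ?_) i <;> refine Fin.cases ?_ (fun j => ?_) j
    exacts [ha, hr j, hc i, hD i j]
  exact_mod_cast this

theorem hs_colLin_le {y : ColIndex N → ℝ} {r : ℝ} (hr : 0 ≤ r) (hy : y ∈ cube _ r) :
    hs (colLin y) ≤ (N + 1) * r := by
  refine norm_blk_le ?_ (fun j => ?_) (fun i => norm_colVec_le hr hy i) fun i j => ?_
  · simpa using hy (.inl ())
  · simpa using norm_colVec_le hr hy j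
  · simpa using hr

/-- Entry by entry: 1 − s is at most |u|² ≤ Nr², the exponential differs from its linear part by at
most r², and the correction in the lower block is quadratic in u. The factor N + 1 passes from the
largest entry to the norm. -/
theorem hs_colUN_sub_le {y : ColIndex N → ℝ} {r : ℝ} (hr : 0 ≤ r) (hr1 : r ≤ 1)
    (hy : y ∈ cube _ r) :
    hs ((colUN y : Matrix (Fin (N + 1)) (Fin (N + 1)) ℂ) - 1 - colLin y) ≤
      (N + 1) * ((N + 2) * r ^ 2) := by
  rw [colUN, coe_rotUN, rotMat, colLin, one_eq_blk, blk_sub, blk_sub]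
  have hu := norm_colVec_le hr hy
  have hq : ∑ i, ‖colVec y i‖ ^ 2 ≤ N * r ^ 2 := by
    calc ∑ i, ‖colVec y i‖ ^ 2 ≤ ∑ _i : Fin N, r ^ 2 := by gcongr; exact hu _
      _ = N * r ^ 2 := by simp
  have hs1 : ‖1 - (cosU (colVec y) : ℂ)‖ ≤ N * r ^ 2 := by
    rw [← Complex.ofReal_one, ← Complex.ofReal_sub, Complex.norm_real,
      Real.norm_of_nonneg (by linarith [cosU_le_one (colVec y)])]
    exact (one_sub_cosU_le _).trans hq
  have ht : |y (.inl ())| ≤ r := hy _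
  have htI : ‖(y (.inl ()) : ℂ) * Complex.I‖ = |y (.inl ())| := by simp
  have hz1 := Complex.norm_exp_sub_one_le (x := (y (.inl ()) : ℂ) * Complex.I)
    (by rw [htI]; linarith)
  have hz2 := Complex.norm_exp_sub_one_sub_id_le (x := (y (.inl ()) : ℂ) * Complex.I)
    (by rw [htI]; linarith)
  have hz : ‖Complex.exp ((y (.inl ()) : ℂ) * Complex.I)‖ = 1 := Complex.norm_exp_ofReal_mul_I _
  have hcpos := cosU_pos (colVec y)
  have hcle := cosU_le_one (colVec y)
  rw [htI] at hz1 hz2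
  set z := Complex.exp ((y (.inl ()) : ℂ) * Complex.I)
  set s := cosU (colVec y)
  set u := colVec y
  have hNr : (N : ℝ) * r ^ 2 * r ≤ N * r ^ 2 := mul_le_of_le_one_right (by positivity) hr1
  have htt : |y (.inl ())| ^ 2 ≤ r ^ 2 := by gcongr
  refine norm_blk_le ?_ (fun j => ?_) (fun i => ?_) fun i j => ?_
  · have : (s : ℂ) * z - 1 - y (.inl ()) * Complex.I =
        -((1 - s) * z) + (z - 1 - y (.inl ()) * Complex.I) := by ring
    rw [this]
    refine (norm_add_le _ _).trans ?_
    rw [norm_neg, norm_mul, hz, mul_one]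
    nlinarith [sq_nonneg r]
  · have : (-(s : ℂ) • star u - 0 - -star u) j = (1 - s) * star (u j) := by
      simp; ring
    rw [this, norm_mul, norm_star]
    calc _ ≤ (N * r ^ 2) * r := mul_le_mul hs1 (hu j) (norm_nonneg _) (by positivity)
      _ ≤ _ := by nlinarith [sq_nonneg r]
  · have : (((s : ℂ) * z) • u - 0 - u) i = -((1 - s) * z * u i) + (z - 1) * u i := by
      simp; ring
    rw [this]
    refine (norm_add_le _ _).trans ?_
    rw [norm_neg, norm_mul, norm_mul, norm_mul, hz, mul_one]
    have h1 : ‖1 - (s : ℂ)‖ * ‖u i‖ ≤ (N * r ^ 2) * r :=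
      mul_le_mul hs1 (hu i) (norm_nonneg _) (by positivity)
    have h2 : ‖z - 1‖ * ‖u i‖ ≤ (2 * r) * r :=
      mul_le_mul (hz1.trans (by linarith)) (hu i) (norm_nonneg _) (by positivity)
    nlinarith
  · have : ((1 : Matrix (Fin N) (Fin N) ℂ) - (((s : ℂ) ^ 2 / (1 + s)) •
        Matrix.vecMulVec u (star u) : Matrix (Fin N) (Fin N) ℂ) - 1 - 0 : Matrix (Fin N) (Fin N) ℂ)
          i j = -((s ^ 2 / (1 + s) : ℝ) * (u i * star (u j))) := by
      simp [Matrix.vecMulVec_apply]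
    rw [this, norm_neg, norm_mul, norm_mul, norm_star, Complex.norm_real,
      Real.norm_of_nonneg (by positivity)]
    have h1 : s ^ 2 / (1 + s) ≤ 1 := by
      rw [div_le_one (by positivity)]; nlinarith
    have h2 : ‖u i‖ * ‖u j‖ ≤ r * r := mul_le_mul (hu i) (hu j) (norm_nonneg _) hr
    have h3 : s ^ 2 / (1 + s) * (‖u i‖ * ‖u j‖) ≤ 1 * (r * r) :=
      mul_le_mul h1 h2 (by positivity) zero_le_one
    have : (0 : ℝ) ≤ N := N.cast_nonneg
    nlinarith [sq_nonneg r, mul_nonneg this (sq_nonneg r)]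

theorem udist_colUN_le {y : ColIndex N → ℝ} {r : ℝ} (hr : 0 ≤ r) (hr1 : r ≤ 1)
    (hy : y ∈ cube _ r) : udist (colUN y) ≤ (N + 1) * (N + 3) * r := by
  have h := hs_add_le ((colUN y : Matrix (Fin (N + 1)) (Fin (N + 1)) ℂ) - 1 - colLin y) (colLin y)
  rw [sub_add_cancel] at h
  refine h.trans ?_
  have h1 := hs_colLin_le hr hy
  have h2 := hs_colUN_sub_le hr hr1 hy
  have h3 : ((N : ℝ) + 1) * ((N + 2) * r ^ 2) ≤ (N + 1) * ((N + 2) * r) := by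
    gcongr; nlinarith
  nlinarith

/-- A right factor from U(N) leaves the first column unchanged, so that column already determines y.
From 1 − s ≤ δ follow |u| ≤ 2δ and |e^(it) − 1| ≤ 2δ, and Jordan's inequality, valid as |t| < π,
yields |t| ≤ πδ ≤ 4δ. -/
theorem mem_cube_of_udist_colUN_mul_le {y : ColIndex N → ℝ} {δ : ℝ} (hδ : δ ≤ 1 / 2)
    (hy : |y (.inl ())| < Real.pi) (U : UN N) (h : udist (colUN y * liftUN U) ≤ δ) :
    y ∈ cube _ (4 * δ) := by
  have hδ0 : 0 ≤ δ := (udist_nonneg _).trans h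
  have hcol : ∀ i, ((colUN y * liftUN U : UN (N + 1)) : Matrix (Fin (N + 1)) (Fin (N + 1)) ℂ) i 0 =
      rotMat (y (.inl ())) (colVec y) i 0 := by
    intro i
    rw [Submonoid.coe_mul, colUN, coe_rotUN, coe_liftUN, rotMat, blk_mul]
    refine Fin.cases ?_ (fun i => ?_) i <;> simp
  have hent : ∀ i, ‖rotMat (y (.inl ())) (colVec y) i 0 -
      (1 : Matrix (Fin (N + 1)) (Fin (N + 1)) ℂ) i 0‖ ≤ δ := by
    intro i
    rw [← hcol]
    exact (norm_apply_le_hs _ i 0).trans h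
  have hcpos := cosU_pos (colVec y)
  have hz : ‖Complex.exp ((y (.inl ()) : ℂ) * Complex.I)‖ = 1 := Complex.norm_exp_ofReal_mul_I _
  have h0 := hent 0
  have hi := fun i : Fin N => hent i.succ
  simp only [rotMat, blk_zero_zero, Matrix.one_apply_eq] at h0
  simp only [rotMat, blk_succ_zero, Matrix.one_apply_ne (Fin.succ_ne_zero _), sub_zero,
    Pi.smul_apply, smul_eq_mul, norm_mul, hz, mul_one, Complex.norm_real,
    Real.norm_of_nonneg hcpos.le] at hi
  have hs1 : 1 - cosU (colVec y) ≤ δ := by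
    refine le_trans ?_ h0
    have := norm_sub_norm_le (1 : ℂ) (cosU (colVec y) * Complex.exp ((y (.inl ()) : ℂ) * Complex.I))
    rw [norm_mul, hz, norm_one, Complex.norm_real, Real.norm_of_nonneg hcpos.le, mul_one,
      norm_sub_rev] at this
    exact this
  have hu : ∀ i, ‖colVec y i‖ ≤ 2 * δ := by
    intro i
    have : 1 / 2 * ‖colVec y i‖ ≤ cosU (colVec y) * ‖colVec y i‖ := by gcongr; linarith
    linarith [hi i]
  have hu2 : ∀ i, (y (.inr (.inl i)) ^ 2 + y (.inr (.inr i)) ^ 2) / 2 ≤ (2 * δ) ^ 2 := by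
    intro i
    rw [← norm_colVec_sq]
    gcongr
    exact hu i
  rintro (k | i | i)
  · have hz2 : ‖Complex.exp ((y (.inl ()) : ℂ) * Complex.I) - 1‖ ≤ 2 * δ := by
      have : Complex.exp ((y (.inl ()) : ℂ) * Complex.I) - 1 =
          (cosU (colVec y) * Complex.exp ((y (.inl ()) : ℂ) * Complex.I) - 1) +
            (1 - cosU (colVec y) : ℝ) * Complex.exp ((y (.inl ()) : ℂ) * Complex.I) := by
        push_cast; ring
      rw [this]
      refine (norm_add_le _ _).trans ?_
      rw [norm_mul, hz, mul_one, Complex.norm_real,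
        Real.norm_of_nonneg (by linarith [cosU_le_one (colVec y)])]
      linarith
    rw [mul_comm, Complex.norm_exp_I_mul_ofReal_sub_one, Real.norm_eq_abs, abs_mul,
      abs_of_pos two_pos] at hz2
    have h3 := Real.mul_abs_le_abs_sin (x := y (.inl ()) / 2) (by
      rw [abs_div, abs_of_pos (two_pos : (0 : ℝ) < 2)]; linarith)
    rw [abs_div, abs_of_pos (two_pos : (0 : ℝ) < 2)] at h3
    have hpi := Real.pi_le_four
    have hpi0 := Real.pi_pos
    have h4 : 2 / Real.pi * (|y (.inl ())| / 2) ≤ δ := by linarith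
    rw [show 2 / Real.pi * (|y (.inl ())| / 2) = |y (.inl ())| / Real.pi by ring,
      div_le_iff₀ hpi0] at h4
    calc |y (.inl k)| ≤ δ * Real.pi := h4
      _ ≤ δ * 4 := by gcongr
      _ = _ := mul_comm _ _
  · refine abs_le_of_sq_le_sq ?_ (by positivity)
    nlinarith [hu2 i, sq_nonneg (y (.inr (.inr i))), sq_nonneg δ]
  · refine abs_le_of_sq_le_sq ?_ (by positivity)
    nlinarith [hu2 i, sq_nonneg (y (.inr (.inl i))), sq_nonneg δ]

/-- The column factor is O(δ) from the identity by the previous estimate, hence so is the other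
factor, by the triangle inequality. -/
theorem udist_le_of_udist_colUN_mul_le {y : ColIndex N → ℝ} {δ : ℝ} (hδ : δ ≤ 1 / 4)
    (hy : |y (.inl ())| < Real.pi) (U : UN N) (h : udist (colUN y * liftUN U) ≤ δ) :
    udist U ≤ ((N + 1) * (N + 3) * 4 + 1) * δ := by
  have hδ0 : 0 ≤ δ := (udist_nonneg _).trans h
  have hc := mem_cube_of_udist_colUN_mul_le (by linarith) hy U h
  have h1 := udist_colUN_le (by linarith) (by linarith) hc
  have h2 := udist_mul_le (colUN y)⁻¹ (colUN y * liftUN U)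
  rw [inv_mul_cancel_left, udist_inv, udist_liftUN] at h2
  linarith

end ColumnEstimates

end LatticeGauge

end

/-! ### Charts of U(N), by induction on N -/

noncomputable section

open scoped ENNReal NNReal

namespace LatticeGauge

/-- The density at the identity of the Haar probability measure of `U(N)`. -/
def haarDensity (N : ℕ) : ℝ := ∏ k ∈ Finset.range N, ((k ! : ℝ) / (2 * Real.pi) ^ (k + 1))

theorem haarDensity_pos (N : ℕ) : 0 < haarDensity N := by
  unfold haarDensity; positivity

/-- A parametrization of a neighbourhood of the identity in `U(N)`, isometric to first order for
the Hilbert–Schmidt norm, in which the Haar measure has a density close to `haarDensity N`. -/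
structure HaarChart (N : ℕ) where
  /-- The index set of the coordinates. -/
  ι : Type
  [fintype : Fintype ι]
  card_eq : Fintype.card ι = N ^ 2
  /-- The linear part of the parametrization. -/
  lin : (ι → ℝ) →ₗ[ℝ] Matrix (Fin N) (Fin N) ℂ
  /-- The parametrization. -/
  toUN : (ι → ℝ) → UN N
  continuous_toUN : Continuous toUN
  toUN_zero : toUN 0 = 1
  hs_lin_sq : ∀ θ, hs (lin θ) ^ 2 = ∑ i, θ i ^ 2
  approx : ∃ C r₀ : ℝ, 0 < C ∧ 0 < r₀ ∧ ∀ r, 0 ≤ r → r ≤ r₀ → ∀ θ ∈ cube ι r,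
    hs ((toUN θ : Matrix (Fin N) (Fin N) ℂ) - 1 - lin θ) ≤ C * r ^ 2
  -- In the charts built below the density never exceeds its value at the identity, so no factor is
  -- lost here. The bound also encodes that a small ball is covered by a cube of comparable side.
  -- The lower bound loses a factor κ < 1.
  upper : ∃ C s₀ : ℝ, 0 < C ∧ 0 < s₀ ∧ ∀ s, 0 ≤ s → s ≤ s₀ → ∀ f : UN N → ℝ≥0∞, Measurable f →
    ∫⁻ U in {U | udist U ≤ s}, f U ∂(haarUN N) ≤
      ENNReal.ofReal (haarDensity N) * ∫⁻ θ in cube ι (C * s), f (toUN θ)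
  lower : ∀ κ : ℝ, 0 < κ → κ < 1 → ∃ r₀ : ℝ, 0 < r₀ ∧ ∀ f : UN N → ℝ≥0∞, Measurable f →
    ENNReal.ofReal (κ * haarDensity N) * ∫⁻ θ in cube ι r₀, f (toUN θ) ≤ ∫⁻ U, f U ∂(haarUN N)

attribute [instance] HaarChart.fintype

namespace HaarChart

/-- The chart of the trivial group. -/
def zero : HaarChart 0 where
  ι := Empty
  card_eq := rfl
  lin := 0
  toUN _ := 1
  continuous_toUN := continuous_const
  toUN_zero := rfl
  hs_lin_sq θ := by simp
  approx := ⟨1, 1, one_pos, one_pos, fun r hr _ θ _ => by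
    have : hs ((((1 : UN 0) : Matrix (Fin 0) (Fin 0) ℂ) - 1 - (0 : (Empty → ℝ) →ₗ[ℝ] _) θ)) = 0 := by
      simp [hs]
    rw [this]; positivity⟩
  upper := ⟨1, 1, one_pos, one_pos, fun s hs _ f _ => by
    have hU : ∀ U : UN 0, U = 1 := fun U => Subtype.ext (Subsingleton.elim _ _)
    have hc : cube Empty (1 * s) = Set.univ := by ext; simp [mem_cube]
    have hf : f = fun _ => f 1 := funext fun U => by rw [hU U]
    rw [hf, hc]
    simp only [lintegral_const, haarDensity, Finset.range_zero, Finset.prod_empty,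
      ENNReal.ofReal_one, one_mul, Measure.restrict_univ, volume_pi, Measure.pi_empty_univ]
    gcongr
    simpa using prob_le_one⟩
  lower κ h0 h1 := ⟨1, one_pos, fun f _ => by
    have hU : ∀ U : UN 0, U = 1 := fun U => Subtype.ext (Subsingleton.elim _ _)
    have hc : cube Empty 1 = Set.univ := by ext; simp [mem_cube]
    have hf : f = fun _ => f 1 := funext fun U => by rw [hU U]
    rw [hf, hc]
    simp only [lintegral_const, haarDensity, Finset.range_zero, Finset.prod_empty, mul_one,
      Measure.restrict_univ, volume_pi, Measure.pi_empty_univ, measure_univ]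
    exact mul_le_of_le_one_left zero_le (ENNReal.ofReal_le_one.2 h1.le)⟩

variable {N : ℕ} (c : HaarChart N)

/-- The linear part of the chart of `U(N+1)` built from a chart of `U(N)`. -/
def succLin : (c.ι ⊕ ColIndex N → ℝ) →ₗ[ℝ] Matrix (Fin (N + 1)) (Fin (N + 1)) ℂ where
  toFun θ := colLin (θ ∘ Sum.inr) + blk 0 0 0 (c.lin (θ ∘ Sum.inl))
  map_add' θ η := by
    have h : c.lin ((θ + η) ∘ Sum.inl) = c.lin (θ ∘ Sum.inl) + c.lin (η ∘ Sum.inl) := by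
      rw [← map_add]; rfl
    rw [h]
    refine ext_blk ?_ (fun j => ?_) (fun i => ?_) fun i j => ?_ <;>
      simp [colLin, colVec] <;> ring
  map_smul' a θ := by
    have h : c.lin ((a • θ) ∘ Sum.inl) = a • c.lin (θ ∘ Sum.inl) := by
      rw [← map_smul]; rfl
    rw [h]
    refine ext_blk ?_ (fun j => ?_) (fun i => ?_) fun i j => ?_ <;>
      simp [colLin, colVec] <;> ring

theorem succLin_apply (θ : c.ι ⊕ ColIndex N → ℝ) :
    c.succLin θ = colLin (θ ∘ Sum.inr) + blk 0 0 0 (c.lin (θ ∘ Sum.inl)) := rfl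

theorem hs_succLin_sq (θ : c.ι ⊕ ColIndex N → ℝ) : hs (c.succLin θ) ^ 2 = ∑ i, θ i ^ 2 := by
  rw [succLin_apply, colLin, blk_add, hs_blk_sq]
  simp only [add_zero, zero_add, c.hs_lin_sq, Pi.neg_apply, Pi.star_apply, norm_neg, norm_star,
    norm_colVec_sq, norm_mul, Complex.norm_real, Complex.norm_I, mul_one, Function.comp_apply,
    Real.norm_eq_abs, sq_abs, Fintype.sum_sum_type, Finset.univ_unique, Finset.sum_singleton,
    ← Finset.sum_div, Finset.sum_add_distrib]
  have : (default : Unit) = () := rfl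
  rw [this]
  ring

/-- The parametrization of `U(N+1)` built from a chart of `U(N)`. -/
def succUN (θ : c.ι ⊕ ColIndex N → ℝ) : UN (N + 1) :=
  colUN (θ ∘ Sum.inr) * liftUN (c.toUN (θ ∘ Sum.inl))

theorem continuous_succUN : Continuous c.succUN := by
  have h1 : Continuous fun θ : c.ι ⊕ ColIndex N → ℝ => θ ∘ Sum.inr := by fun_prop
  have h2 : Continuous fun θ : c.ι ⊕ ColIndex N → ℝ => θ ∘ Sum.inl := by fun_prop
  exact (continuous_colUN.comp h1).mul (continuous_liftUN.comp (c.continuous_toUN.comp h2))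

theorem hs_lin_le {r : ℝ} (hr : 0 ≤ r) {θ : c.ι → ℝ} (hθ : θ ∈ cube c.ι r) :
    hs (c.lin θ) ≤ N * r := by
  refine abs_le_of_sq_le_sq' ?_ (by positivity) |>.2
  rw [c.hs_lin_sq]
  calc ∑ i, θ i ^ 2 ≤ ∑ _i : c.ι, r ^ 2 := by
        refine Finset.sum_le_sum fun i _ => ?_
        rw [← sq_abs]
        gcongr
        exact hθ i
    _ = (N * r) ^ 2 := by simp [c.card_eq]; ring

/-- AB − 1 = (A − 1) + (B − 1) + (A − 1)(B − 1), and the last term is quadratic. -/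
theorem succ_approx : ∃ C r₀ : ℝ, 0 < C ∧ 0 < r₀ ∧ ∀ r, 0 ≤ r → r ≤ r₀ →
    ∀ θ ∈ cube (c.ι ⊕ ColIndex N) r,
      hs ((c.succUN θ : Matrix (Fin (N + 1)) (Fin (N + 1)) ℂ) - 1 - c.succLin θ) ≤ C * r ^ 2 := by
  obtain ⟨C, r₀, hC, hr₀, h⟩ := c.approx
  refine ⟨(N + 1) * (N + 2) + C + (N + 1) * (N + 3) * (N + C), min r₀ 1, by positivity,
    lt_min hr₀ one_pos, fun r hr hrr θ hθ => ?_⟩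
  have hr1 : r ≤ 1 := hrr.trans (min_le_right _ _)
  have hy : θ ∘ Sum.inr ∈ cube _ r := fun i => hθ _
  have hx : θ ∘ Sum.inl ∈ cube _ r := fun i => hθ _
  have h1 := hs_colUN_sub_le hr hr1 hy
  have h2 := h r hr (hrr.trans (min_le_left _ _)) _ hx
  have h3 := udist_colUN_le hr hr1 hy
  have h4 : udist (c.toUN (θ ∘ Sum.inl)) ≤ (N + C) * r := by
    have := hs_add_le ((c.toUN (θ ∘ Sum.inl) : Matrix (Fin N) (Fin N) ℂ) - 1 -
      c.lin (θ ∘ Sum.inl)) (c.lin (θ ∘ Sum.inl))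
    rw [sub_add_cancel] at this
    have h5 := c.hs_lin_le hr hx
    have h6 : C * r ^ 2 ≤ C * r := by gcongr; nlinarith
    change hs _ ≤ _
    linarith
  set A := (colUN (θ ∘ Sum.inr) : Matrix (Fin (N + 1)) (Fin (N + 1)) ℂ)
  set V := c.toUN (θ ∘ Sum.inl)
  have hdec : (c.succUN θ : Matrix (Fin (N + 1)) (Fin (N + 1)) ℂ) - 1 - c.succLin θ =
      (A - 1 - colLin (θ ∘ Sum.inr)) +
        blk 0 0 0 ((V : Matrix (Fin N) (Fin N) ℂ) - 1 - c.lin (θ ∘ Sum.inl)) +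
        (A - 1) * ((liftUN V : Matrix (Fin (N + 1)) (Fin (N + 1)) ℂ) - 1) := by
    have : blk 0 0 0 ((V : Matrix (Fin N) (Fin N) ℂ) - 1 - c.lin (θ ∘ Sum.inl)) =
        (liftUN V : Matrix (Fin (N + 1)) (Fin (N + 1)) ℂ) - 1 -
          blk 0 0 0 (c.lin (θ ∘ Sum.inl)) := by
      rw [coe_liftUN, one_eq_blk, blk_sub, blk_sub]; simp
    rw [this, succLin_apply, succUN, Submonoid.coe_mul]
    noncomm_ring
  rw [hdec]
  refine (hs_add_le _ _).trans ?_
  refine (add_le_add (hs_add_le _ _) (hs_mul_le _ _)).trans ?_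
  rw [hs_corner]
  have h7 : hs (A - 1) * hs ((liftUN V : Matrix (Fin (N + 1)) (Fin (N + 1)) ℂ) - 1) ≤
      ((N + 1) * (N + 3) * r) * ((N + C) * r) := by
    refine mul_le_mul h3 ?_ (hs_nonneg _) (by positivity)
    exact (udist_liftUN V).le.trans h4
  nlinarith

theorem haarDensity_succ (N : ℕ) :
    haarDensity (N + 1) = N ! / (2 * Real.pi) ^ (N + 1) * haarDensity N := by
  rw [haarDensity, Finset.prod_range_succ, mul_comm]; rfl

/-- If the product of a column factor and a factor from U(N) is within s of the identity, then each
factor is within O(s) of it, so the integral localizes in both sets of coordinates. The density (1 +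
|u|²)^(−(N+1)) is at most 1. -/
theorem succ_upper : ∃ C s₀ : ℝ, 0 < C ∧ 0 < s₀ ∧ ∀ s, 0 ≤ s → s ≤ s₀ →
    ∀ f : UN (N + 1) → ℝ≥0∞, Measurable f →
      ∫⁻ U in {U | udist U ≤ s}, f U ∂(haarUN (N + 1)) ≤
        ENNReal.ofReal (haarDensity (N + 1)) *
          ∫⁻ θ in cube (c.ι ⊕ ColIndex N) (C * s), f (c.succUN θ) := by
  obtain ⟨C, s₀, hC, hs₀, h⟩ := c.upper
  set K : ℝ := (N + 1) * (N + 3) * 4 + 1 with hK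
  have hK0 : 0 < K := by positivity
  refine ⟨max 4 (C * K), min (1 / 4) (s₀ / K), by positivity, by positivity,
    fun s hs hss f hf => ?_⟩
  have hs1 : s ≤ 1 / 4 := hss.trans (min_le_left _ _)
  have hs2 : K * s ≤ s₀ := by
    rw [← le_div_iff₀' hK0]; exact hss.trans (min_le_right _ _)
  have hset : MeasurableSet {U : UN (N + 1) | udist U ≤ s} :=
    measurableSet_le continuous_udist.measurable measurable_const
  have hset' : MeasurableSet {U : UN N | udist U ≤ K * s} :=
    measurableSet_le continuous_udist.measurable measurable_const
  have hd : (0 : ℝ) ≤ N ! / (2 * Real.pi) ^ (N + 1) := by positivity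
  rw [← lintegral_indicator hset, lintegral_haarUN_succ_real _ (hf.indicator hset),
    haarDensity_succ, ENNReal.ofReal_mul hd, mul_assoc]
  gcongr
  have hmeas : Measurable fun θ => (cube (c.ι ⊕ ColIndex N) (max 4 (C * K) * s)).indicator
      (fun θ => f (c.succUN θ)) θ :=
    (hf.comp c.continuous_succUN.measurable).indicator (measurableSet_cube _)
  rw [← lintegral_indicator (measurableSet_cube _), lintegral_sum_pi _ hmeas,
    ← lintegral_const_mul' _ _ ENNReal.ofReal_ne_top]
  refine lintegral_mono fun y => ?_
  refine Set.indicator_apply_le' (fun hy => ?_) fun _ => zero_le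
  have hle1 : ENNReal.ofReal (((1 + ∑ i, ‖colVec y i‖ ^ 2) ^ (N + 1))⁻¹) ≤ 1 := by
    rw [ENNReal.ofReal_le_one]
    refine inv_le_one_of_one_le₀ (one_le_pow₀ ?_)
    have : 0 ≤ ∑ i, ‖colVec y i‖ ^ 2 := by positivity
    linarith
  refine (mul_le_of_le_one_left zero_le hle1).trans ?_
  by_cases hyc : y ∈ cube (ColIndex N) (4 * s)
  · calc ∫⁻ U, {U | udist U ≤ s}.indicator f (colUN y * liftUN U) ∂(haarUN N)
        ≤ ∫⁻ U in {U | udist U ≤ K * s}, f (colUN y * liftUN U) ∂(haarUN N) := by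
          rw [← lintegral_indicator hset']
          refine lintegral_mono fun U => ?_
          refine Set.indicator_apply_le' (fun hU => ?_) fun _ => zero_le
          have : U ∈ {U : UN N | udist U ≤ K * s} := udist_le_of_udist_colUN_mul_le hs1 hy U hU
          rw [Set.indicator_of_mem this]
      _ ≤ ENNReal.ofReal (haarDensity N) * ∫⁻ θ in cube c.ι (C * (K * s)),
            f (colUN y * liftUN (c.toUN θ)) :=
          h (K * s) (by positivity) hs2 (fun U => f (colUN y * liftUN U))
            (hf.comp ((measurable_const_mul _).comp continuous_liftUN.measurable))
      _ ≤ _ := by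
          refine mul_le_mul_right ?_ _
          rw [← lintegral_indicator (measurableSet_cube _)]
          refine lintegral_mono fun θ => ?_
          refine Set.indicator_apply_le' (fun hθ => ?_) fun _ => zero_le
          have : Sum.elim θ y ∈ cube (c.ι ⊕ ColIndex N) (max 4 (C * K) * s) := by
            rintro (i | i)
            · refine (hθ i).trans ?_
              rw [← mul_assoc]
              gcongr
              exact le_max_right _ _
            · refine (hyc i).trans ?_
              gcongr
              exact le_max_left _ _
          rw [Set.indicator_of_mem this]
          rfl
  · have : ∀ U, {U | udist U ≤ s}.indicator f (colUN y * liftUN U) = 0 := fun U => by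
      refine Set.indicator_of_notMem ?_ f
      exact fun hU => hyc (mem_cube_of_udist_colUN_mul_le (by linarith) hy U hU)
    simp [this]

theorem succ_lower (κ : ℝ) (hκ0 : 0 < κ) (hκ1 : κ < 1) : ∃ r₀ : ℝ, 0 < r₀ ∧
    ∀ f : UN (N + 1) → ℝ≥0∞, Measurable f →
      ENNReal.ofReal (κ * haarDensity (N + 1)) *
        ∫⁻ θ in cube (c.ι ⊕ ColIndex N) r₀, f (c.succUN θ) ≤ ∫⁻ U, f U ∂(haarUN (N + 1)) := by
  -- The loss κ is shared equally: √κ for the chart of U(N), and √κ for the density of the column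
  -- coordinates, which tends to 1 at the origin.
  have hsq0 : 0 < Real.sqrt κ := Real.sqrt_pos.2 hκ0
  have hsq1 : Real.sqrt κ < 1 := by rw [Real.sqrt_lt' one_pos]; simpa
  obtain ⟨r₁, hr₁, h⟩ := c.lower (Real.sqrt κ) hsq0 hsq1
  have hcont : Continuous fun r : ℝ => ((1 + N * r ^ 2) ^ (N + 1) : ℝ)⁻¹ :=
    Continuous.inv₀ (by fun_prop) fun r => by positivity
  have hev : ∀ᶠ r in 𝓝 (0 : ℝ), Real.sqrt κ < ((1 + N * r ^ 2) ^ (N + 1) : ℝ)⁻¹ := by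
    refine hcont.continuousAt.eventually_const_lt ?_
    simpa using hsq1
  obtain ⟨r₂, hr₂, hr₂'⟩ := Metric.eventually_nhds_iff.1 hev
  set r := min (min r₁ 1) (r₂ / 2) with hr
  have hr0 : 0 < r := by positivity
  have hrr : Real.sqrt κ < ((1 + N * r ^ 2) ^ (N + 1) : ℝ)⁻¹ := by
    refine hr₂' ?_
    rw [dist_zero_right, Real.norm_of_nonneg hr0.le]
    exact lt_of_le_of_lt (min_le_right _ _) (by linarith)
  refine ⟨r, hr0, fun f hf => ?_⟩
  have hd : (0 : ℝ) ≤ N ! / (2 * Real.pi) ^ (N + 1) := by positivity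
  have hmeas : Measurable fun θ => (cube (c.ι ⊕ ColIndex N) r).indicator
      (fun θ => f (c.succUN θ)) θ :=
    (hf.comp c.continuous_succUN.measurable).indicator (measurableSet_cube _)
  rw [lintegral_haarUN_succ_real _ hf, haarDensity_succ,
    show κ * (N ! / (2 * Real.pi) ^ (N + 1) * haarDensity N) =
      N ! / (2 * Real.pi) ^ (N + 1) * (Real.sqrt κ * (Real.sqrt κ * haarDensity N)) by
        rw [← mul_assoc (Real.sqrt κ), Real.mul_self_sqrt hκ0.le]; ring,
    ENNReal.ofReal_mul hd, mul_assoc]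
  gcongr
  rw [← lintegral_indicator (measurableSet_cube _), lintegral_sum_pi _ hmeas,
    ← lintegral_const_mul' _ _ ENNReal.ofReal_ne_top]
  refine lintegral_mono fun y => ?_
  by_cases hyc : y ∈ cube (ColIndex N) r
  · have hy : y ∈ {y : ColIndex N → ℝ | |y (.inl ())| < Real.pi} := by
      have h1 : r ≤ 1 := (min_le_left _ _).trans (min_le_right _ _)
      have := hyc (.inl ())
      change |y (.inl ())| < Real.pi
      linarith [Real.pi_gt_three]
    rw [Set.indicator_of_mem hy, ENNReal.ofReal_mul hsq0.le, mul_assoc]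
    have hdens : Real.sqrt κ ≤ ((1 + ∑ i, ‖colVec y i‖ ^ 2) ^ (N + 1))⁻¹ := by
      refine hrr.le.trans ?_
      gcongr
      calc ∑ i, ‖colVec y i‖ ^ 2 ≤ ∑ _i : Fin N, r ^ 2 := by
            gcongr; exact norm_colVec_le hr0.le hyc _
        _ = N * r ^ 2 := by simp
    gcongr
    refine le_trans ?_ (h (fun U => f (colUN y * liftUN U))
      (hf.comp ((measurable_const_mul _).comp continuous_liftUN.measurable)))
    refine mul_le_mul_right ?_ _
    rw [← lintegral_indicator (measurableSet_cube _)]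
    refine lintegral_mono fun θ => ?_
    refine Set.indicator_apply_le' (fun hθ => ?_) fun _ => zero_le
    have : θ ∈ cube c.ι r₁ := fun i =>
      (hθ (.inl i)).trans ((min_le_left _ _).trans (min_le_left _ _))
    rw [Set.indicator_of_mem this]
    exact le_of_eq rfl
  · have : ∀ θ : c.ι → ℝ, (cube (c.ι ⊕ ColIndex N) r).indicator
        (fun θ => f (c.succUN θ)) (Sum.elim θ y) = 0 := fun θ => by
      refine Set.indicator_of_notMem ?_ _
      exact fun hm => hyc fun i => hm (.inr i)
    simp [this]

/-- The chart of `U(N+1)` built from a chart of `U(N)`. -/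
def succ : HaarChart (N + 1) where
  ι := c.ι ⊕ ColIndex N
  card_eq := by simp [c.card_eq]; ring
  lin := c.succLin
  toUN := c.succUN
  continuous_toUN := c.continuous_succUN
  toUN_zero := by
    have h1 : colUN (0 : ColIndex N → ℝ) = 1 := by
      have hv : colVec (0 : ColIndex N → ℝ) = 0 := by ext; simp [colVec]
      have hc : cosU (0 : Fin N → ℂ) = 1 := by simp [cosU]
      apply Subtype.ext
      rw [colUN, coe_rotUN, rotMat, hv, hc, Submonoid.coe_one, one_eq_blk]
      simp
    have h2 : liftUN (1 : UN N) = 1 := by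
      apply Subtype.ext
      rw [coe_liftUN, Submonoid.coe_one, Submonoid.coe_one, one_eq_blk]
    change colUN (0 : ColIndex N → ℝ) * liftUN (c.toUN 0) = 1
    rw [h1, c.toUN_zero, h2, mul_one]
  hs_lin_sq := c.hs_succLin_sq
  approx := c.succ_approx
  upper := c.succ_upper
  lower := c.succ_lower

/-- A chart of `U(N)`. -/
def std : (N : ℕ) → HaarChart N
  | 0 => zero
  | N + 1 => (std N).succ

end HaarChart

end LatticeGauge

end

noncomputable section

open scoped ENNReal NNReal

namespace LatticeGauge

/-! ### Counting edges, and the tree of axial edges -/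

section Lattice

variable {d n m : ℕ}

theorem mem_box {x : Site d} : x ∈ box d n ↔ ∀ i, 0 ≤ x i ∧ x i < n := by
  simp [box, Fintype.mem_piFinset]

theorem card_box : (box d n).card = n ^ d := by
  simp [box]

theorem mem_edges {Λ : Finset (Site d)} {e : Site d × Fin d} :
    e ∈ edges Λ ↔ e.1 ∈ Λ ∧ e.1 + unitVec e.2 ∈ Λ := by
  simp [edges]

theorem mem_plaquettes {Λ : Finset (Site d)} {p : Site d × Fin d × Fin d} :
    p ∈ plaquettes Λ ↔ p.1 ∈ Λ ∧ p.2.1 < p.2.2 ∧ p.1 + unitVec p.2.1 ∈ Λ ∧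
      p.1 + unitVec p.2.2 ∈ Λ ∧ p.1 + unitVec p.2.1 + unitVec p.2.2 ∈ Λ := by
  simp [plaquettes]

theorem unitVec_apply (j i : Fin d) : unitVec j i = if i = j then 1 else 0 := by
  simp [unitVec, Pi.single_apply]

theorem unitVec_nonneg (j i : Fin d) : 0 ≤ unitVec j i := by
  rw [unitVec_apply]; split_ifs <;> simp

theorem unitVec_le_one (j i : Fin d) : unitVec j i ≤ 1 := by
  rw [unitVec_apply]; split_ifs <;> simp

theorem card_edges_le : Fintype.card (edges (box d n)) ≤ n ^ d * d := by
  rw [Fintype.card_coe]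
  refine (Finset.card_filter_le _ _).trans ?_
  simp [card_box]

theorem card_plaquettes_le : Fintype.card (plaquettes (box d n)) ≤ n ^ d * (d * d) := by
  rw [Fintype.card_coe]
  refine (Finset.card_filter_le _ _).trans ?_
  simp [card_box]

/-- Edges in the last direction are all axial, so a free edge has one of d − 1 directions. This is
the factor d − 1 of the theorem. -/
theorem card_filter_exists_lt : (Finset.univ.filter fun j : Fin d => ∃ i, j < i).card = d - 1 := by
  cases d with
  | zero => rfl
  | succ D =>
    have : (Finset.univ.filter fun j : Fin (D + 1) => ∃ i, j < i) =
        Finset.univ.erase (Fin.last D) := by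
      ext j
      simp only [Finset.mem_filter, Finset.mem_univ, true_and, Finset.mem_erase, and_true]
      constructor
      · rintro ⟨i, hi⟩ rfl
        exact absurd hi (not_lt.2 (Fin.le_last i))
      · exact fun h => ⟨Fin.last D, Fin.lt_last_iff_ne_last.2 h⟩
    rw [this, Finset.card_erase_of_mem (Finset.mem_univ _)]
    simp

theorem exists_lt_of_not_isAxial {e : Site d × Fin d} (h : ¬ IsAxial e) : ∃ i, e.2 < i := by
  simp only [IsAxial, not_forall] at h
  obtain ⟨i, hi, _⟩ := h
  exact ⟨i, hi⟩

theorem card_freeEdge_le : Fintype.card (FreeEdge d n) ≤ n ^ d * (d - 1) := by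
  rw [← card_filter_exists_lt, ← card_box (d := d), ← Finset.card_product, ← Fintype.card_coe]
  refine Fintype.card_le_of_injective (fun e => ⟨e.1.1, ?_⟩) ?_
  · have := exists_lt_of_not_isAxial e.2
    simp only [Finset.mem_product, Finset.mem_filter, Finset.mem_univ, true_and]
    exact ⟨(mem_edges.1 e.1.2).1, this⟩
  · intro e f h
    exact Subtype.ext (Subtype.ext (congrArg (fun z => z.1) h))

/-- The non-axial edges of `B_m` at distance at least one from the lower faces of the box and at
least two from its upper faces. -/
def IsInterior {d m : ℕ} (e : edges (box d m)) : Prop :=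
  (∃ i, e.1.2 < i) ∧ ∀ i, 1 ≤ e.1.1 i ∧ e.1.1 i + 3 ≤ m

instance : DecidablePred (IsInterior (d := d) (m := m)) := fun _ =>
  inferInstanceAs (Decidable (_ ∧ _))

theorem IsInterior.not_isAxial {e : edges (box d m)} (h : IsInterior e) : ¬ IsAxial e.1 := by
  obtain ⟨⟨i, hi⟩, h⟩ := h
  intro hax
  have := (h i).1
  rw [hax i hi] at this
  norm_num at this

theorem card_isInterior :
    Fintype.card {e : edges (box d m) // IsInterior e} = (m - 3) ^ d * (d - 1) := by
  have hb : (Fintype.piFinset fun _ : Fin d => Finset.Icc (1 : ℤ) (m - 3)).card = (m - 3) ^ d := by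
    simp
    congr 1
    omega
  rw [← card_filter_exists_lt, ← hb, ← Finset.card_product, ← Fintype.card_coe]
  have key : ∀ z : Site d × Fin d, z ∈ (Fintype.piFinset fun _ : Fin d => Finset.Icc (1 : ℤ) (m - 3)) ×ˢ
      (Finset.univ.filter fun j : Fin d => ∃ i, j < i) ↔
        (∃ i, z.2 < i) ∧ ∀ i, 1 ≤ z.1 i ∧ z.1 i + 3 ≤ m := by
    intro z
    simp only [Finset.mem_product, Fintype.mem_piFinset, Finset.mem_Icc, Finset.mem_filter,
      Finset.mem_univ, true_and]
    rw [and_comm]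
    refine and_congr_right fun _ => forall_congr' fun i => ?_
    constructor <;> rintro ⟨h1, h2⟩ <;> constructor <;> linarith
  refine Fintype.card_congr ⟨fun e => ⟨e.1.1, (key _).2 e.2⟩,
    fun z => ⟨⟨z.1, ?_⟩, (key _).1 z.2⟩, fun _ => rfl, fun _ => rfl⟩
  have h := ((key _).1 z.2).2
  rw [mem_edges, mem_box, mem_box]
  refine ⟨fun i => ⟨by linarith [(h i).1], by linarith [(h i).2]⟩, fun i => ?_⟩
  have h1 := unitVec_nonneg z.1.2 i
  have h2 := unitVec_le_one z.1.2 i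
  simp only [Pi.add_apply]
  exact ⟨by linarith [(h i).1], by linarith [(h i).2]⟩

/-- Let k be the last nonzero coordinate of the base point x; it comes after the direction j because
the edge is not axial. The plaquette at x − e_k in the directions j, k has the given edge as third
edge, its two edges in direction k are axial, and its first edge is one step closer to the origin.
-/
theorem not_isAxial_exists_parent {e : edges (box d n)} (h : ¬ IsAxial e.1) :
    ∃ p : plaquettes (box d n), Plaquette.edge₃ p = e ∧ IsAxial (Plaquette.edge₂ p).1 ∧
      IsAxial (Plaquette.edge₄ p).1 ∧
      ∑ i, (Plaquette.edge₁ p).1.1 i + 1 = ∑ i, e.1.1 i := by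
  obtain ⟨⟨x, j⟩, he⟩ := e
  simp only [IsAxial, not_forall] at h
  obtain ⟨i, hji, hi⟩ := h
  set s := Finset.univ.filter fun k => x k ≠ 0 with hs
  have his : i ∈ s := by simpa [hs] using hi
  have hne : s.Nonempty := ⟨i, his⟩
  set k := s.max' hne
  have hk : x k ≠ 0 := by
    have := s.max'_mem hne
    simpa [hs] using this
  have hmax : ∀ l, k < l → x l = 0 := by
    intro l hl
    by_contra hne'
    exact absurd (s.le_max' l (by simpa [hs] using hne')) (not_le.2 hl)
  have hjk : j < k := lt_of_lt_of_le hji (s.le_max' i his)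
  have hx := mem_edges.1 he
  simp only [mem_box, Pi.add_apply] at hx
  obtain ⟨hx1, hx2⟩ := hx
  have hk1 : 1 ≤ x k := by
    have := (hx1 k).1
    omega
  have hu : ∀ a : Fin d, unitVec k a ≤ x a := by
    intro a
    rw [unitVec_apply]
    split_ifs with hak
    · rw [hak]; exact hk1
    · exact (hx1 a).1
  refine ⟨⟨(x - unitVec k, j, k), ?_⟩, ?_, ?_, ?_, ?_⟩
  · rw [mem_plaquettes]
    simp only [mem_box, Pi.add_apply, Pi.sub_apply, sub_add_cancel]
    refine ⟨fun a => ?_, hjk, fun a => ?_, fun a => ?_, fun a => ?_⟩ <;>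
    · have h1 := hu a
      have h2 := unitVec_nonneg k a
      have h3 := unitVec_nonneg j a
      have h4 := hx1 a
      have h5 := hx2 a
      constructor <;> linarith
  · apply Subtype.ext
    simp [Plaquette.edge₃]
  · intro l hl
    have hl' : k < l := hl
    simp [Plaquette.edge₂, unitVec_apply, hmax l hl', hl'.ne', (hjk.trans hl').ne']
  · intro l hl
    have hl' : k < l := hl
    simp [Plaquette.edge₄, unitVec_apply, hmax l hl', hl'.ne']
  · simp [Plaquette.edge₁, unitVec_apply]

/-- A function on the edges of a box which vanishes on the axial edges and whose increment across
each plaquette is at most `s` is at most `d n s`. -/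
theorem le_of_axial_increments (f : edges (box d n) → ℝ) {s : ℝ} (hs : 0 ≤ s)
    (h0 : ∀ e, IsAxial e.1 → f e ≤ 0)
    (h1 : ∀ p : plaquettes (box d n), IsAxial (Plaquette.edge₂ p).1 → IsAxial (Plaquette.edge₄ p).1 →
      f (Plaquette.edge₃ p) ≤ f (Plaquette.edge₁ p) + s) (e : edges (box d n)) :
    f e ≤ d * n * s := by
  -- Induction on the coordinate sum of the base point, which is at most d·n in the box.
  have key : ∀ (k : ℕ) (e : edges (box d n)), ∑ i, e.1.1 i = k → f e ≤ k * s := by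
    intro k
    induction k with
    | zero =>
      intro e he
      by_cases hax : IsAxial e.1
      · simpa using h0 e hax
      · obtain ⟨p, rfl, _, _, hp⟩ := not_isAxial_exists_parent hax
        have h3 : 0 ≤ ∑ i, (Plaquette.edge₁ p).1.1 i := Finset.sum_nonneg fun i _ =>
          (mem_box.1 (mem_edges.1 (Plaquette.edge₁ p).2).1 i).1
        rw [he] at hp
        norm_num at hp
        linarith
    | succ k ih =>
      intro e he
      by_cases hax : IsAxial e.1
      · exact (h0 e hax).trans (by positivity)
      · obtain ⟨p, rfl, hp2, hp4, hp⟩ := not_isAxial_exists_parent hax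
        have := ih (Plaquette.edge₁ p) (by rw [he] at hp; push_cast at hp; linarith)
        have h2 := h1 p hp2 hp4
        push_cast
        linarith
  have hx := mem_box.1 (mem_edges.1 e.2).1
  have h3 : 0 ≤ ∑ i, e.1.1 i := Finset.sum_nonneg fun i _ => (hx i).1
  obtain ⟨k, hk⟩ := Int.eq_ofNat_of_zero_le h3
  refine (key k e hk).trans ?_
  gcongr
  have : ∑ i, e.1.1 i ≤ ∑ _i : Fin d, (n : ℤ) := Finset.sum_le_sum fun i _ => (hx i).2.le
  rw [hk] at this
  simp at this
  exact_mod_cast this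

end Lattice

/-! ### Subdivision of a box into smaller boxes -/

section Shift

variable {d m n q : ℕ}

/-- Translation of sites from the box `B_m` to the block of `B_n` with index `b`. -/
def shiftSite (m : ℕ) (b : Fin d → Fin q) (x : Site d) : Site d := fun i => x i + m * (b i : ℕ)

theorem shiftSite_apply (b : Fin d → Fin q) (x : Site d) (i : Fin d) :
    shiftSite m b x i = x i + m * (b i : ℕ) := rfl

theorem shiftSite_add (b : Fin d → Fin q) (x y : Site d) :
    shiftSite m b (x + y) = shiftSite m b x + y := by
  ext i; simp only [shiftSite_apply, Pi.add_apply]; ring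

theorem shiftSite_mem (h : m * q ≤ n) (b : Fin d → Fin q) {x : Site d} (hx : x ∈ box d m) :
    shiftSite m b x ∈ box d n := by
  rw [mem_box] at hx ⊢
  intro i
  rw [shiftSite_apply]
  have h1 := hx i
  have h2 : m * ((b i : ℕ) + 1) ≤ m * q := Nat.mul_le_mul_left _ (b i).2
  have h3 : ((m * ((b i : ℕ) + 1) : ℕ) : ℤ) ≤ n := by exact_mod_cast h2.trans h
  push_cast at h3
  constructor
  · have : 0 ≤ (m : ℤ) * (b i : ℕ) := by positivity
    linarith
  · linarith

theorem shiftSite_injective {b b' : Fin d → Fin q} {x x' : Site d} (hx : x ∈ box d m)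
    (hx' : x' ∈ box d m) (h : shiftSite m b x = shiftSite m b' x') : b = b' ∧ x = x' := by
  rw [mem_box] at hx hx'
  have key : ∀ i, b i = b' i ∧ x i = x' i := by
    intro i
    have h1 := congrFun h i
    simp only [shiftSite_apply] at h1
    have hdiv : ∀ (y : ℤ) (c : ℕ), 0 ≤ y → y < m → (y + m * c) / m = c := by
      intro y c hy hy'
      rw [Int.add_mul_ediv_left _ _ (by linarith), Int.ediv_eq_zero_of_lt hy hy', zero_add]
    have h2 := hdiv (x i) (b i) (hx i).1 (hx i).2
    have h3 := hdiv (x' i) (b' i) (hx' i).1 (hx' i).2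
    rw [h1, h3] at h2
    have h4 : (b' i : ℕ) = b i := by exact_mod_cast h2
    refine ⟨Fin.ext h4.symm, ?_⟩
    rw [h4] at h1
    linarith
  exact ⟨funext fun i => (key i).1, funext fun i => (key i).2⟩

/-- Translation of edges from `B_m` to the block of `B_n` with index `b`. -/
def shiftEdge (h : m * q ≤ n) (b : Fin d → Fin q) (e : edges (box d m)) : edges (box d n) :=
  ⟨(shiftSite m b e.1.1, e.1.2), by
    have he := mem_edges.1 e.2
    refine mem_edges.2 ⟨shiftSite_mem h b he.1, ?_⟩
    rw [← shiftSite_add]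
    exact shiftSite_mem h b he.2⟩

/-- Translation of plaquettes from `B_m` to the block of `B_n` with index `b`. -/
def shiftPlaq (h : m * q ≤ n) (b : Fin d → Fin q) (p : plaquettes (box d m)) :
    plaquettes (box d n) :=
  ⟨(shiftSite m b p.1.1, p.1.2), by
    have hp := mem_plaquettes.1 p.2
    refine mem_plaquettes.2 ⟨shiftSite_mem h b hp.1, hp.2.1, ?_, ?_, ?_⟩ <;>
      simp only [← shiftSite_add]
    exacts [shiftSite_mem h b hp.2.2.1, shiftSite_mem h b hp.2.2.2.1, shiftSite_mem h b hp.2.2.2.2]⟩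

variable (h : m * q ≤ n) (b : Fin d → Fin q)

theorem edge₁_shiftPlaq (p : plaquettes (box d m)) :
    Plaquette.edge₁ (shiftPlaq h b p) = shiftEdge h b (Plaquette.edge₁ p) := rfl

theorem edge₂_shiftPlaq (p : plaquettes (box d m)) :
    Plaquette.edge₂ (shiftPlaq h b p) = shiftEdge h b (Plaquette.edge₂ p) := by
  apply Subtype.ext
  simp [Plaquette.edge₂, shiftPlaq, shiftEdge, shiftSite_add]

theorem edge₃_shiftPlaq (p : plaquettes (box d m)) :
    Plaquette.edge₃ (shiftPlaq h b p) = shiftEdge h b (Plaquette.edge₃ p) := by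
  apply Subtype.ext
  simp [Plaquette.edge₃, shiftPlaq, shiftEdge, shiftSite_add]

theorem edge₄_shiftPlaq (p : plaquettes (box d m)) :
    Plaquette.edge₄ (shiftPlaq h b p) = shiftEdge h b (Plaquette.edge₄ p) := rfl

theorem shiftEdge_injective :
    Function.Injective fun z : (Fin d → Fin q) × edges (box d m) => shiftEdge h z.1 z.2 := by
  rintro ⟨b, e⟩ ⟨b', e'⟩ hz
  have h1 := congrArg (fun z => z.1.1) hz
  have h2 := congrArg (fun z => z.1.2) hz
  obtain ⟨hb, hx⟩ := shiftSite_injective (mem_edges.1 e.2).1 (mem_edges.1 e'.2).1 h1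
  exact Prod.ext hb (Subtype.ext (Prod.ext hx h2))

theorem shiftPlaq_injective :
    Function.Injective fun z : (Fin d → Fin q) × plaquettes (box d m) => shiftPlaq h z.1 z.2 := by
  rintro ⟨b, e⟩ ⟨b', e'⟩ hz
  have h1 := congrArg (fun z => z.1.1) hz
  have h2 := congrArg (fun z => z.1.2) hz
  obtain ⟨hb, hx⟩ := shiftSite_injective (mem_plaquettes.1 e.2).1 (mem_plaquettes.1 e'.2).1 h1
  exact Prod.ext hb (Subtype.ext (Prod.ext hx h2))

theorem IsInterior.not_isAxial_shiftEdge {e : edges (box d m)} (he : IsInterior e) :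
    ¬ IsAxial (shiftEdge h b e).1 := by
  obtain ⟨⟨i, hi⟩, he⟩ := he
  intro hax
  have h1 := (he i).1
  have h2 : e.1.1 i + m * (b i : ℕ) = 0 := hax i hi
  have : 0 ≤ (m : ℤ) * (b i : ℕ) := by positivity
  linarith

/-- The edges of `B_n` which come from interior edges of the blocks. -/
def IsBlockInterior (h : m * q ≤ n) (e : edges (box d n)) : Prop :=
  ∃ (b : Fin d → Fin q) (e' : edges (box d m)), IsInterior e' ∧ shiftEdge h b e' = e

/-- The plaquette `p` has an edge satisfying `A`. -/
def Touches {Λ : Finset (Site d)} (A : edges Λ → Prop) (p : plaquettes Λ) : Prop :=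
  A (Plaquette.edge₁ p) ∨ A (Plaquette.edge₂ p) ∨ A (Plaquette.edge₃ p) ∨ A (Plaquette.edge₄ p)

/-- The margins of `IsInterior` are chosen for this. The base of an edge of p exceeds the base of p
by 0 or 1 in each coordinate, and the corners of p exceed its base by at most 2, so coordinates from
1 to m − 3 keep the whole plaquette in the block. -/
theorem exists_shiftPlaq_eq {p : plaquettes (box d n)} (hp : Touches (IsBlockInterior h) p) :
    ∃ (b : Fin d → Fin q) (p' : plaquettes (box d m)), shiftPlaq h b p' = p := by
  have key : ∀ (b : Fin d → Fin q) (y v : Site d), (∀ i, 1 ≤ y i ∧ y i + 3 ≤ m) →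
      (∀ i, 0 ≤ v i ∧ v i ≤ 1) → shiftSite m b y = p.1.1 + v →
      ∃ (b : Fin d → Fin q) (p' : plaquettes (box d m)), shiftPlaq h b p' = p := by
    intro b y v hy hv hyv
    refine ⟨b, ⟨(y - v, p.1.2), ?_⟩, ?_⟩
    · rw [mem_plaquettes]
      simp only [mem_box, Pi.add_apply, Pi.sub_apply]
      refine ⟨fun a => ?_, (mem_plaquettes.1 p.2).2.1, fun a => ?_, fun a => ?_, fun a => ?_⟩ <;>
      · have h1 := hy a
        have h2 := hv a
        have h3 := unitVec_nonneg p.1.2.1 a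
        have h4 := unitVec_le_one p.1.2.1 a
        have h5 := unitVec_nonneg p.1.2.2 a
        have h6 := unitVec_le_one p.1.2.2 a
        constructor <;> linarith
    · apply Subtype.ext
      refine Prod.ext ?_ rfl
      have : shiftSite m b (y - v) + v = p.1.1 + v := by rw [← shiftSite_add, sub_add_cancel, hyv]
      exact add_right_cancel this
  have hu : ∀ j i : Fin d, 0 ≤ unitVec j i ∧ unitVec j i ≤ 1 :=
    fun j i => ⟨unitVec_nonneg j i, unitVec_le_one j i⟩
  rcases hp with ⟨b, e, he, hpe⟩ | ⟨b, e, he, hpe⟩ | ⟨b, e, he, hpe⟩ | ⟨b, e, he, hpe⟩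
  · refine key b e.1.1 0 he.2 (by simp) ?_
    rw [add_zero]; exact congrArg (fun z => z.1.1) hpe
  · exact key b e.1.1 _ he.2 (hu p.1.2.1) (congrArg (fun z => z.1.1) hpe)
  · exact key b e.1.1 _ he.2 (hu p.1.2.2) (congrArg (fun z => z.1.1) hpe)
  · refine key b e.1.1 0 he.2 (by simp) ?_
    rw [add_zero]; exact congrArg (fun z => z.1.1) hpe

/-- A sum over the plaquettes touching block-interior edges is bounded by the sum over all
plaquettes of the blocks. -/
theorem sum_plaquettes_le_sum_blocks (ψ : plaquettes (box d n) → ℝ)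
    (h1 : ∀ p, ¬ Touches (IsBlockInterior h) p → ψ p = 0) :
    ∑ p, ψ p ≤ ∑ b : Fin d → Fin q, ∑ p' : plaquettes (box d m), ψ (shiftPlaq h b p') := by
  classical
  rw [← Fintype.sum_prod_type' fun b p' => ψ (shiftPlaq h b p'),
    ← Finset.sum_image (f := ψ) (g := fun z : (Fin d → Fin q) × plaquettes (box d m) =>
      shiftPlaq h z.1 z.2) (fun _ _ _ _ hz => shiftPlaq_injective h hz)]
  rw [← Finset.sum_subset (Finset.subset_univ _)]
  intro p _ hp
  refine h1 p fun ht => hp ?_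
  obtain ⟨b, p', rfl⟩ := exists_shiftPlaq_eq h ht
  exact Finset.mem_image.2 ⟨(b, p'), Finset.mem_univ _, rfl⟩

/-- Dropping the plaquettes which lie in no block. -/
theorem sum_blocks_le_sum_plaquettes (ψ : plaquettes (box d n) → ℝ) (h0 : ∀ p, 0 ≤ ψ p) :
    ∑ b : Fin d → Fin q, ∑ p' : plaquettes (box d m), ψ (shiftPlaq h b p') ≤ ∑ p, ψ p := by
  classical
  rw [← Fintype.sum_prod_type' fun b p' => ψ (shiftPlaq h b p'),
    ← Finset.sum_image (f := ψ) (g := fun z : (Fin d → Fin q) × plaquettes (box d m) =>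
      shiftPlaq h z.1 z.2) (fun _ _ _ _ hz => shiftPlaq_injective h hz)]
  exact Finset.sum_le_sum_of_subset_of_nonneg (Finset.subset_univ _) fun p _ _ => h0 p

theorem isBlockInterior_shiftEdge_iff (e : edges (box d m)) :
    IsBlockInterior h (shiftEdge h b e) ↔ IsInterior e := by
  constructor
  · rintro ⟨b', e', he', heq⟩
    have := shiftEdge_injective h (a₁ := (b', e')) (a₂ := (b, e)) heq
    rw [Prod.mk.injEq] at this
    rw [← this.2]; exact he'
  · exact fun he => ⟨b, e, he, rfl⟩

end Shift

end LatticeGauge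

end

noncomputable section

open scoped ENNReal NNReal

namespace LatticeGauge

/-! ### Gauge fixing -/

section GaugeFixing

variable {d n N : ℕ} {Λ : Finset (Site d)}

/-- Extension of a configuration on some of the edges by the identity. -/
def extOne (A : edges Λ → Prop) [DecidablePred A] (U : {e // A e} → UN N) : Config N Λ :=
  fun e => if h : A e then U ⟨e, h⟩ else 1

theorem continuous_extOne (A : edges Λ → Prop) [DecidablePred A] :
    Continuous (extOne A : ({e // A e} → UN N) → Config N Λ) := by
  refine continuous_pi fun e => ?_
  unfold extOne
  split_ifs
  · exact continuous_apply _
  · exact continuous_const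

theorem extOne_of_pos {A : edges Λ → Prop} [DecidablePred A] (U : {e // A e} → UN N) {e : edges Λ}
    (h : A e) : extOne A U e = U ⟨e, h⟩ := dif_pos h

theorem extOne_of_neg {A : edges Λ → Prop} [DecidablePred A] (U : {e // A e} → UN N) {e : edges Λ}
    (h : ¬ A e) : extOne A U e = 1 := dif_neg h

theorem continuous_holonomy (p : plaquettes Λ) : Continuous fun U : Config N Λ => holonomy U p := by
  unfold holonomy
  fun_prop

theorem continuous_wilsonAction : Continuous fun U : Config N Λ => wilsonAction U := by
  unfold wilsonAction
  exact continuous_finsetSum _ fun p _ => continuous_phi.comp (continuous_holonomy p)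

theorem wilsonAction_nonneg (U : Config N Λ) : 0 ≤ wilsonAction U :=
  Finset.sum_nonneg fun _ _ => phi_nonneg _

/-- The Boltzmann weight at inverse coupling `β`. -/
def weight (β : ℝ) (U : Config N Λ) : ℝ≥0∞ := ENNReal.ofReal (Real.exp (-(β * wilsonAction U)))

theorem measurable_weight (β : ℝ) : Measurable fun U : Config N Λ => weight β U := by
  unfold weight
  exact (ENNReal.continuous_ofReal.comp (Real.continuous_exp.comp
    (continuous_const.mul continuous_wilsonAction).neg)).measurable

/-- The integral of the Boltzmann weight over the configurations which are trivial outside `A`. -/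
def fixedZ (N : ℕ) (A : edges Λ → Prop) [DecidablePred A] (β : ℝ) : ℝ≥0∞ :=
  ∫⁻ U : {e // A e} → UN N, weight β (extOne A U) ∂Measure.pi fun _ => haarUN N

/-- The action of a gauge transformation. -/
def gauge (h : Site d → UN N) (U : Config N Λ) : Config N Λ :=
  fun e => h e.1.1 * U e * (h (e.1.1 + unitVec e.1.2))⁻¹

theorem holonomy_gauge (h : Site d → UN N) (U : Config N Λ) (p : plaquettes Λ) :
    holonomy (gauge h U) p = h p.1.1 * holonomy U p * (h p.1.1)⁻¹ := by
  have : p.1.1 + unitVec p.1.2.2 + unitVec p.1.2.1 = p.1.1 + unitVec p.1.2.1 + unitVec p.1.2.2 :=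
    add_right_comm _ _ _
  simp only [holonomy, gauge, Plaquette.edge₁, Plaquette.edge₂, Plaquette.edge₃, Plaquette.edge₄,
    this]
  group

theorem phi_conj (a b : UN N) : phi (a * b * a⁻¹) = phi b := by
  have h1 : ((a * b * a⁻¹ : UN N) : Matrix (Fin N) (Fin N) ℂ) =
      (a : Matrix (Fin N) (Fin N) ℂ) * b * ((a⁻¹ : UN N) : Matrix (Fin N) (Fin N) ℂ) := rfl
  have h2 : ((a⁻¹ : UN N) : Matrix (Fin N) (Fin N) ℂ) * (a : Matrix (Fin N) (Fin N) ℂ) = 1 := by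
    rw [← Submonoid.coe_mul, inv_mul_cancel]; rfl
  unfold phi
  rw [h1, Matrix.trace_sub, Matrix.trace_sub, Matrix.trace_mul_comm, ← Matrix.mul_assoc, h2,
    Matrix.one_mul]

theorem weight_gauge (β : ℝ) (h : Site d → UN N) (U : Config N Λ) :
    weight β (gauge h U) = weight β U := by
  unfold weight wilsonAction
  simp only [holonomy_gauge, phi_conj]

/-- The axial edges form a tree rooted at the origin, so that any configuration on them is a pure
gauge. -/
theorem exists_gauge_axial {G : Type*} [Group G] (u : Site d × Fin d → G) (n : ℕ) :
    ∃ h : Site d → G, ∀ (x : Site d) (j : Fin d), (∀ i, 0 ≤ x i) → IsAxial (x, j) →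
      ∑ i, x i < n → h (x + unitVec j) = h x * u (x, j) := by
  classical
  induction n with
  | zero =>
    refine ⟨fun _ => 1, fun x j hx _ hlt => ?_⟩
    have := Finset.sum_nonneg fun i (_ : i ∈ Finset.univ) => hx i
    simp at hlt
    linarith
  | succ n ih =>
    obtain ⟨h, hh⟩ := ih
    -- A site is the endpoint of at most one axial edge, since the direction must be the last
    -- nonzero coordinate of the site.
    have huniq : ∀ (x x' : Site d) (j j' : Fin d), (∀ i, 0 ≤ x i) → (∀ i, 0 ≤ x' i) →
        IsAxial (x, j) → IsAxial (x', j') → x + unitVec j = x' + unitVec j' → j ≤ j' := by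
      intro x x' j j' hx hx' hax hax' heq
      by_contra hlt
      push Not at hlt
      have h1 := congrFun heq j
      have h2 : x' j = 0 := hax' j hlt
      have h3 := hx j
      simp only [Pi.add_apply, unitVec_apply, if_true, h2, if_neg hlt.ne'] at h1
      linarith
    -- Only the endpoints of axial edges starting at coordinate sum n receive a new value, namely
    -- the one the recursion forces.
    refine ⟨fun y => if hy : ∃ z : Site d × Fin d, (∀ i, 0 ≤ z.1 i) ∧ IsAxial z ∧
      ∑ i, z.1 i = n ∧ z.1 + unitVec z.2 = y then h hy.choose.1 * u hy.choose else h y,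
      fun x j hx hax hlt => ?_⟩
    have hsum : ∀ (z : Site d) (k : Fin d), ∑ i, (z + unitVec k) i = ∑ i, z i + 1 := by
      intro z k
      simp [Finset.sum_add_distrib, unitVec_apply]
    have hxn : ¬ ∃ z : Site d × Fin d, (∀ i, 0 ≤ z.1 i) ∧ IsAxial z ∧
        ∑ i, z.1 i = n ∧ z.1 + unitVec z.2 = x := by
      rintro ⟨z, _, _, hz, hzx⟩
      rw [← hzx, hsum, hz] at hlt
      push_cast at hlt
      linarith
    beta_reduce
    rw [dif_neg hxn]
    by_cases heq : ∑ i, x i = n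
    · have hy : ∃ z : Site d × Fin d, (∀ i, 0 ≤ z.1 i) ∧ IsAxial z ∧
        ∑ i, z.1 i = n ∧ z.1 + unitVec z.2 = x + unitVec j := ⟨(x, j), hx, hax, heq, rfl⟩
      rw [dif_pos hy]
      obtain ⟨h1, h2, h3, h4⟩ := hy.choose_spec
      have hj : hy.choose.2 = j := le_antisymm (huniq _ _ _ _ h1 hx h2 hax h4)
        (huniq _ _ _ _ hx h1 hax h2 h4.symm)
      have hx' : hy.choose.1 = x := by
        rw [hj] at h4
        exact add_right_cancel h4
      have : hy.choose = (x, j) := Prod.ext hx' hj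
      rw [this]
    · rw [dif_neg]
      · refine hh x j hx hax ?_
        push_cast at hlt
        omega
      · rintro ⟨z, _, _, hz, hzx⟩
        have := hsum z.1 z.2
        rw [hzx, hsum, hz] at this
        exact heq (by linarith)

/-- For given values on the axial tree, a gauge transformation makes them the identity. On the other
edges it acts by left and right translations, which preserve Haar measure, so the inner integral
does not depend on the tree values. -/
theorem lintegral_gauge_fix (F : Config N (box d n) → ℝ≥0∞) (hF : Measurable F)
    (hinv : ∀ h U, F (gauge h U) = F U) :
    ∫⁻ U, F U ∂(Measure.pi fun _ => haarUN N) =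
      ∫⁻ V : FreeEdge d n → UN N, F (extOne (fun e => ¬ IsAxial e.1) V)
        ∂(Measure.pi fun _ => haarUN N) := by
  have hmp := measurePreserving_piEquivPiSubtypeProd (fun _ : edges (box d n) => haarUN N)
    (fun e => IsAxial e.1)
  set Φ := MeasurableEquiv.piEquivPiSubtypeProd (fun _ : edges (box d n) => UN N)
    (fun e => IsAxial e.1) with hΦ
  rw [← (hmp.symm Φ).lintegral_comp hF]
  have hmeas : Measurable fun z => F (Φ.symm z) := hF.comp Φ.symm.measurable
  rw [lintegral_prod _ hmeas.aemeasurable]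
  have key : ∀ u, ∫⁻ v, F (Φ.symm (u, v)) ∂(Measure.pi fun _ => haarUN N) =
      ∫⁻ V : FreeEdge d n → UN N, F (extOne (fun e => ¬ IsAxial e.1) V)
        ∂(Measure.pi fun _ => haarUN N) := by
    intro u
    obtain ⟨h, hh⟩ := exists_gauge_axial (fun z : Site d × Fin d =>
      if hz : z ∈ edges (box d n) then (if hz' : IsAxial z then u ⟨⟨z, hz⟩, hz'⟩ else 1) else 1)
      -- Coordinate sums in the box are at most d·n, so this bound reaches every axial edge.
      (d * n + 1)
    have hmp2 : MeasurePreserving (fun (v : FreeEdge d n → UN N) (e : FreeEdge d n) =>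
        h e.1.1.1 * v e * (h (e.1.1.1 + unitVec e.1.1.2))⁻¹)
        (Measure.pi fun _ => haarUN N) (Measure.pi fun _ => haarUN N) :=
      measurePreserving_pi _ _ fun e =>
        (measurePreserving_mul_right (haarUN N) _).comp (measurePreserving_mul_left (haarUN N) _)
    have hm3 : Measurable fun V : FreeEdge d n → UN N =>
        F (extOne (fun e => ¬ IsAxial e.1) V) :=
      hF.comp (continuous_extOne _).measurable
    rw [← hmp2.lintegral_comp hm3]
    refine lintegral_congr fun v => ?_
    rw [← hinv h]
    congr 1
    funext e
    by_cases he : IsAxial e.1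
    · rw [extOne_of_neg _ (not_not.2 he)]
      have h1 : Φ.symm (u, v) e = u ⟨e, he⟩ := by
        simp [hΦ, MeasurableEquiv.piEquivPiSubtypeProd, Equiv.piEquivPiSubtypeProd, he]
      have hx := mem_box.1 (mem_edges.1 e.2).1
      have h2 := hh e.1.1 e.1.2 (fun i => (hx i).1) he (by
        have : ∑ i, e.1.1 i ≤ ∑ _i : Fin d, (n : ℤ) := Finset.sum_le_sum fun i _ => (hx i).2.le
        simp at this
        push_cast
        linarith)
      simp only [Prod.mk.eta, e.2, he, dif_pos] at h2
      simp only [gauge, h1, h2]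
      group
    · rw [extOne_of_pos _ he]
      have h1 : Φ.symm (u, v) e = v ⟨e, he⟩ := by
        simp [hΦ, MeasurableEquiv.piEquivPiSubtypeProd, Equiv.piEquivPiSubtypeProd, he]
      simp only [gauge, h1]
  simp only [key, lintegral_const, measure_univ, mul_one]

theorem lintegral_weight_eq_fixedZ (d n N : ℕ) (β : ℝ) :
    ∫⁻ U : Config N (box d n), weight β U ∂(Measure.pi fun _ => haarUN N) =
      fixedZ N (fun e : edges (box d n) => ¬ IsAxial e.1) β :=
  lintegral_gauge_fix _ (measurable_weight β) (weight_gauge β)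

theorem partitionFunction_eq_toReal (N : ℕ) (g : ℝ) :
    partitionFunction N Λ g =
      (∫⁻ U : Config N Λ, weight (1 / g) U ∂(Measure.pi fun _ => haarUN N)).toReal := by
  unfold partitionFunction
  rw [integral_eq_lintegral_of_nonneg_ae (Eventually.of_forall fun U => (Real.exp_pos _).le)]
  · simp only [weight, neg_mul]
  · refine Continuous.aestronglyMeasurable ?_
    exact Real.continuous_exp.comp (continuous_const.mul continuous_wilsonAction)

end GaugeFixing

end LatticeGauge

end

noncomputable section

open scoped ENNReal NNReal

namespace LatticeGauge

/-! ### The lattice Maxwell form restricted to functions supported on a set of edges -/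

section Curl

variable {d n : ℕ} {Λ : Finset (Site d)}

theorem circulation_apply (p : plaquettes Λ) (t : edges Λ → ℝ) :
    circulation p t = t (Plaquette.edge₁ p) + t (Plaquette.edge₂ p) - t (Plaquette.edge₃ p) -
      t (Plaquette.edge₄ p) := rfl

variable (A : edges Λ → Prop)

/-- The incidence matrix between plaquettes and edges. -/
def incidence : Matrix (plaquettes Λ) {e // A e} ℤ := fun p e =>
  (if Plaquette.edge₁ p = e then 1 else 0) + (if Plaquette.edge₂ p = e then 1 else 0) -
    (if Plaquette.edge₃ p = e then 1 else 0) - (if Plaquette.edge₄ p = e then 1 else 0)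

/-- The matrix of the Maxwell form on functions supported in `A`. -/
def curlMat : Matrix {e // A e} {e // A e} ℝ :=
  ((incidence A).transpose * incidence A).map (Int.castRingHom ℝ)

theorem curlMat_eq : curlMat A = ((incidence A).map (Int.castRingHom ℝ)).transpose *
    (incidence A).map (Int.castRingHom ℝ) := by
  rw [curlMat, Matrix.map_mul, Matrix.transpose_map]

theorem isHermitian_curlMat : (curlMat A).IsHermitian := by
  rw [curlMat_eq]
  exact Matrix.isHermitian_conjTranspose_mul_self _

variable [DecidablePred A]

/-- Extension by zero of a function on some of the edges. -/
def extZero (t : {e // A e} → ℝ) : edges Λ → ℝ := fun e => if h : A e then t ⟨e, h⟩ else 0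

variable {A} in
theorem extZero_of_pos (t : {e // A e} → ℝ) {e : edges Λ} (h : A e) :
    extZero A t e = t ⟨e, h⟩ := dif_pos h

variable {A} in
theorem extZero_of_neg (t : {e // A e} → ℝ) {e : edges Λ} (h : ¬ A e) :
    extZero A t e = 0 := dif_neg h

/-- The Maxwell form on functions supported in `A`. -/
def curlForm (t : {e // A e} → ℝ) : ℝ := ∑ p : plaquettes Λ, circulation p (extZero A t) ^ 2

theorem curlForm_nonneg (t : {e // A e} → ℝ) : 0 ≤ curlForm A t := by
  unfold curlForm; positivity

theorem sum_ite_mul_eq_extZero (t : {e // A e} → ℝ) (a : edges Λ) :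
    ∑ e : {e // A e}, (if a = e then (1 : ℝ) else 0) * t e = extZero A t a := by
  by_cases h : A a
  · rw [extZero_of_pos _ h, Finset.sum_eq_single ⟨a, h⟩]
    · simp
    · rintro ⟨b, hb⟩ _ hne
      rw [if_neg, zero_mul]
      rintro rfl
      exact hne rfl
    · simp
  · rw [extZero_of_neg _ h]
    refine Finset.sum_eq_zero fun e _ => ?_
    rw [if_neg, zero_mul]
    rintro rfl
    exact h e.2

theorem incidence_mulVec (t : {e // A e} → ℝ) (p : plaquettes Λ) :
    ((incidence A).map (Int.castRingHom ℝ)).mulVec t p = circulation p (extZero A t) := by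
  rw [circulation_apply]
  simp only [← sum_ite_mul_eq_extZero, ← Finset.sum_add_distrib, ← Finset.sum_sub_distrib,
    Matrix.mulVec, dotProduct, ← add_mul, ← sub_mul]
  refine Finset.sum_congr rfl fun e _ => ?_
  simp [incidence]

theorem dotProduct_curlMat_mulVec (t : {e // A e} → ℝ) :
    t ⬝ᵥ (curlMat A).mulVec t = curlForm A t := by
  rw [curlMat_eq, ← Matrix.mulVec_mulVec, Matrix.dotProduct_mulVec, Matrix.vecMul_transpose]
  simp only [dotProduct, incidence_mulVec, curlForm, sq]

/-- Two symmetric matrices with the same quadratic form agree, by polarization. -/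
theorem toMatrix'_maxwellForm₀ (d n : ℕ) :
    (maxwellForm₀ d n).toMatrix' = curlMat fun e : edges (box d n) => ¬ IsAxial e.1 := by
  have hval : ∀ t, maxwellForm₀ d n t =
      curlForm (fun e : edges (box d n) => ¬ IsAxial e.1) t := by
    intro t
    have hext : Function.ExtendByZero.linearMap ℝ
        (Subtype.val : FreeEdge d n → edges (box d n)) t = extZero _ t := by
      funext e
      by_cases h : ¬ IsAxial e.1
      · rw [extZero_of_pos _ h]
        exact Subtype.val_injective.extend_apply t 0 ⟨e, h⟩
      · rw [extZero_of_neg _ h]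
        refine Function.extend_apply' _ _ _ ?_
        rintro ⟨a, rfl⟩
        exact h a.2
    rw [maxwellForm₀, QuadraticMap.comp_apply, hext, maxwellForm, sum_apply, curlForm]
    refine Finset.sum_congr rfl fun p _ => ?_
    rw [QuadraticMap.comp_apply, QuadraticMap.sq_apply, sq]
  ext i j
  have hsymm : curlMat (fun e : edges (box d n) => ¬ IsAxial e.1) j i = curlMat _ i j := by
    have := (isHermitian_curlMat fun e : edges (box d n) => ¬ IsAxial e.1).apply i j
    simpa using this
  rw [QuadraticForm.toMatrix', LinearMap.toMatrix₂'_apply, QuadraticMap.associated_apply]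
  simp only [hval, ← dotProduct_curlMat_mulVec, Matrix.mulVec_add, add_dotProduct, dotProduct_add,
    Matrix.mulVec_single_one, single_one_dotProduct, Matrix.col_apply, hsymm]
  rw [show (⅟(2 : Module.End ℝ ℝ)) = (⅟(2 : ℝ)) • (1 : Module.End ℝ ℝ) by
    apply invOf_eq_right_inv
    ext
    simp]
  simp
  ring

/-- Here `f` is one of the four edge positions and `g` the other direction of the plaquette.
Together they determine the plaquette, so no edge is counted more than d times. -/
theorem sum_edge_le {f : plaquettes Λ → edges Λ} {g : plaquettes Λ → Fin d}
    (hfg : Function.Injective fun p => (f p, g p)) (u : edges Λ → ℝ) (hu : ∀ e, 0 ≤ u e) :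
    ∑ p, u (f p) ≤ d * ∑ e, u e := by
  classical
  calc ∑ p, u (f p) = ∑ z ∈ Finset.univ.image fun p => (f p, g p), u z.1 := by
        rw [Finset.sum_image fun _ _ _ _ h => hfg h]
    _ ≤ ∑ z : edges Λ × Fin d, u z.1 :=
        Finset.sum_le_sum_of_subset_of_nonneg (Finset.subset_univ _) fun z _ _ => hu z.1
    _ = d * ∑ e, u e := by
        rw [Fintype.sum_prod_type]
        simp [Finset.mul_sum]

theorem sum_extZero_sq (t : {e // A e} → ℝ) : ∑ e, extZero A t e ^ 2 = t ⬝ᵥ t := by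
  rw [← Fintype.sum_subtype_add_sum_subtype A]
  have h1 : ∀ e : {e // A e}, extZero A t e ^ 2 = t e * t e := fun e => by
    rw [extZero_of_pos _ e.2, sq]
  have h2 : ∀ e : {e // ¬ A e}, extZero A t e ^ 2 = 0 := fun e => by
    rw [extZero_of_neg _ e.2]; simp
  simp [h1, h2, dotProduct]

/-- Squaring a sum of four terms costs a factor 4, and each of the four positions counts an edge at
most d times. -/
theorem curlForm_le (t : {e // A e} → ℝ) : curlForm A t ≤ 16 * d * (t ⬝ᵥ t) := by
  rw [← sum_extZero_sq]
  set u := fun e => extZero A t e ^ 2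
  have hu : ∀ e, 0 ≤ u e := fun e => sq_nonneg _
  have h1 := sum_edge_le (f := Plaquette.edge₁ (Λ := Λ)) (g := fun p => p.1.2.2) (by
    intro p p' h
    simp only [Plaquette.edge₁, Prod.mk.injEq, Subtype.mk.injEq] at h
    exact Subtype.ext (Prod.ext h.1.1 (Prod.ext h.1.2 h.2))) u hu
  have h2 := sum_edge_le (f := Plaquette.edge₂ (Λ := Λ)) (g := fun p => p.1.2.1) (by
    intro p p' h
    simp only [Plaquette.edge₂, Prod.mk.injEq, Subtype.mk.injEq] at h
    have h2 := h.2
    rw [h2] at h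
    exact Subtype.ext (Prod.ext (add_right_cancel h.1.1) (Prod.ext h2 h.1.2))) u hu
  have h3 := sum_edge_le (f := Plaquette.edge₃ (Λ := Λ)) (g := fun p => p.1.2.2) (by
    intro p p' h
    simp only [Plaquette.edge₃, Prod.mk.injEq, Subtype.mk.injEq] at h
    have h2 := h.2
    rw [h2] at h
    exact Subtype.ext (Prod.ext (add_right_cancel h.1.1) (Prod.ext h.1.2 h2))) u hu
  have h4 := sum_edge_le (f := Plaquette.edge₄ (Λ := Λ)) (g := fun p => p.1.2.1) (by
    intro p p' h
    simp only [Plaquette.edge₄, Prod.mk.injEq, Subtype.mk.injEq] at h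
    exact Subtype.ext (Prod.ext h.1.1 (Prod.ext h.2 h.1.2))) u hu
  calc curlForm A t ≤ ∑ p, 4 * (u (Plaquette.edge₁ p) + u (Plaquette.edge₂ p) +
        u (Plaquette.edge₃ p) + u (Plaquette.edge₄ p)) := by
        refine Finset.sum_le_sum fun p _ => ?_
        rw [circulation_apply]
        simp only [u]
        set a := extZero A t (Plaquette.edge₁ p)
        set b := extZero A t (Plaquette.edge₂ p)
        set c := extZero A t (Plaquette.edge₃ p)
        set e := extZero A t (Plaquette.edge₄ p)
        nlinarith [sq_nonneg (a - b), sq_nonneg (a + c), sq_nonneg (a + e), sq_nonneg (b + c),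
          sq_nonneg (b + e), sq_nonneg (c - e)]
    _ = 4 * (∑ p, u (Plaquette.edge₁ p) + ∑ p, u (Plaquette.edge₂ p) +
        ∑ p, u (Plaquette.edge₃ p) + ∑ p, u (Plaquette.edge₄ p)) := by
        rw [← Finset.mul_sum]; simp only [Finset.sum_add_distrib]
    _ ≤ _ := by linarith

end Curl

/-! ### Spectral bounds and integrality of the Maxwell form in axial gauge -/

section Box

variable {d n : ℕ} (A : edges (box d n) → Prop) [DecidablePred A]

/-- A lower bound for the bottom of the spectrum of the Maxwell form in axial gauge. -/
def gap (d n : ℕ) : ℝ := 1 / ((n : ℝ) ^ d * d * (d * n) ^ 2)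

theorem gap_pos (hd : 0 < d) (hn : 0 < n) : 0 < gap d n := by
  unfold gap; positivity

variable {A} in
theorem abs_extZero_le (hA : ∀ e, A e → ¬ IsAxial e.1) (t : {e // A e} → ℝ) (e : edges (box d n)) :
    |extZero A t e| ≤ d * n * Real.sqrt (curlForm A t) := by
  refine le_of_axial_increments (fun e => |extZero A t e|) (Real.sqrt_nonneg _) (fun e he => ?_)
    (fun p h2 h4 => ?_) e
  · rw [extZero_of_neg _ fun h => hA e h he, abs_zero]
  · have hc : |circulation p (extZero A t)| ≤ Real.sqrt (curlForm A t) := by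
      refine Real.abs_le_sqrt ?_
      exact Finset.single_le_sum (f := fun p => circulation p (extZero A t) ^ 2)
        (fun _ _ => sq_nonneg _) (Finset.mem_univ p)
    rw [circulation_apply, extZero_of_neg t fun h => hA _ h h2,
      extZero_of_neg t fun h => hA _ h h4, add_zero, sub_zero] at hc
    have := abs_sub_abs_le_abs_sub (extZero A t (Plaquette.edge₃ p))
      (extZero A t (Plaquette.edge₁ p))
    rw [abs_sub_comm] at this
    linarith

variable {A} in
-- A discrete Poincaré inequality: each value is at most d·n times the square root of the form, by
-- `abs_extZero_le`, and there are at most d·n^d edges.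
theorem gap_mul_le_curlForm (hd : 0 < d) (hn : 0 < n) (hA : ∀ e, A e → ¬ IsAxial e.1)
    (t : {e // A e} → ℝ) : gap d n * (t ⬝ᵥ t) ≤ curlForm A t := by
  rw [gap, one_div, inv_mul_le_iff₀ (by positivity), ← sum_extZero_sq]
  calc ∑ e, extZero A t e ^ 2 ≤ ∑ _e : edges (box d n), (d * n) ^ 2 * curlForm A t := by
        refine Finset.sum_le_sum fun e _ => ?_
        rw [← sq_abs]
        have := abs_extZero_le hA t e
        calc _ ≤ (d * n * Real.sqrt (curlForm A t)) ^ 2 := by gcongr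
          _ = _ := by rw [mul_pow, Real.sq_sqrt (curlForm_nonneg A t)]
    _ = Fintype.card (edges (box d n)) * ((d * n) ^ 2 * curlForm A t) := by simp
    _ ≤ ((n ^ d * d : ℕ) : ℝ) * ((d * n) ^ 2 * curlForm A t) := by
        have := curlForm_nonneg A t
        gcongr
        exact card_edges_le
    _ = _ := by push_cast; ring

variable {A} in
theorem posDef_curlMat (hd : 0 < d) (hn : 0 < n) (hA : ∀ e, A e → ¬ IsAxial e.1) :
    (curlMat A).PosDef := by
  refine Matrix.PosDef.of_dotProduct_mulVec_pos (isHermitian_curlMat A) fun t ht => ?_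
  rw [star_trivial, dotProduct_curlMat_mulVec]
  refine lt_of_lt_of_le (mul_pos (gap_pos hd hn) ?_) (gap_mul_le_curlForm hd hn hA t)
  have : 0 ≤ t ⬝ᵥ t := by
    unfold dotProduct; exact Finset.sum_nonneg fun i _ => mul_self_nonneg _
  exact lt_of_le_of_ne this fun h => ht (dotProduct_self_eq_zero.1 h.symm)

variable {A} in
-- The matrix is BᵀB with B an integer incidence matrix, so its determinant is an integer, and it is
-- positive by definiteness.
theorem one_le_det_curlMat (hd : 0 < d) (hn : 0 < n) (hA : ∀ e, A e → ¬ IsAxial e.1) :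
    1 ≤ (curlMat A).det := by
  have h := (posDef_curlMat hd hn hA).det_pos
  have h2 : (curlMat A).det = (((incidence A).transpose * incidence A).det : ℤ) := by
    rw [curlMat, ← RingHom.mapMatrix_apply, ← RingHom.map_det]; rfl
  rw [h2] at h ⊢
  have : 0 < ((incidence A).transpose * incidence A).det := by exact_mod_cast h
  exact_mod_cast this

variable {A} in
theorem log_det_curlMat_nonneg (hd : 0 < d) (hn : 0 < n) (hA : ∀ e, A e → ¬ IsAxial e.1) :
    0 ≤ Real.log (curlMat A).det := Real.log_nonneg (one_le_det_curlMat hd hn hA)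

variable {A} in
theorem log_det_curlMat_le (hd : 0 < d) (hn : 0 < n) (hA : ∀ e, A e → ¬ IsAxial e.1) :
    Real.log (curlMat A).det ≤ Fintype.card {e // A e} * Real.log (16 * d) := by
  rw [← Real.log_pow]
  refine Real.log_le_log (posDef_curlMat hd hn hA).det_pos ?_
  refine (posDef_curlMat hd hn hA).posSemidef.det_le_pow fun t => ?_
  rw [dotProduct_curlMat_mulVec]
  exact curlForm_le A t

variable {A} in
-- The spectrum lies between `gap d n` and 16d, so deleting an edge raises the log determinant by at
-- most −log gap and lowers it by at most log(16d). The first cost is of order log n, affordable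
-- only when few edges are deleted.
theorem log_det_curlMat_compare (hd : 0 < d) (hn : 0 < n) (hA : ∀ e, A e → ¬ IsAxial e.1)
    (B : edges (box d n) → Prop) [DecidablePred B] (hB : ∀ e, B e → A e) :
    Real.log (curlMat B).det ≤ Real.log (curlMat A).det +
        ((Fintype.card {e // A e} : ℝ) - Fintype.card {e // B e}) * -Real.log (gap d n) ∧
      Real.log (curlMat A).det ≤ Real.log (curlMat B).det +
        ((Fintype.card {e // A e} : ℝ) - Fintype.card {e // B e}) * Real.log (16 * d) := by
  let ε : {k : {e // A e} // B k.1} ≃ {e // B e} := Equiv.subtypeSubtypeEquivSubtype (hB _)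
  have hdet : ((curlMat A).submatrix (Subtype.val : {k : {e // A e} // B k.1} → _)
      Subtype.val).det = (curlMat B).det := by
    rw [← Matrix.det_submatrix_equiv_self ε (curlMat B)]
    rfl
  have hcard : (Fintype.card {k : {e // A e} // ¬ B k.1} : ℝ) =
      (Fintype.card {e // A e} : ℝ) - Fintype.card {e // B e} := by
    have := Fintype.card_subtype_compl (fun k : {e // A e} => B k.1)
    rw [this, Nat.cast_sub (Fintype.card_subtype_le _), Fintype.card_congr ε]
  have h := Matrix.det_principal_submatrix_bounds (isHermitian_curlMat A) (b := 16 * d)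
    (gap_pos hd hn)
    (fun t => by rw [dotProduct_curlMat_mulVec]; exact gap_mul_le_curlForm hd hn hA t)
    (fun t => by rw [dotProduct_curlMat_mulVec]; exact curlForm_le A t) (fun k => B k.1)
  rw [hdet] at h
  have hBpos := (posDef_curlMat hd hn fun e he => hA e (hB e he)).det_pos
  have hApos := (posDef_curlMat hd hn hA).det_pos
  have hg := gap_pos hd hn
  constructor
  · have h1 := Real.log_le_log (mul_pos (pow_pos hg _) hBpos) h.1
    rw [Real.log_mul (pow_pos hg _).ne' hBpos.ne', Real.log_pow, hcard] at h1
    rw [mul_neg]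
    exact le_add_neg_iff_add_le.2 (by rw [add_comm]; exact h1)
  · have h16 : (0 : ℝ) < 16 * d := by positivity
    have h1 := Real.log_le_log hApos h.2
    rw [Real.log_mul (pow_pos h16 _).ne' hBpos.ne', Real.log_pow, hcard, add_comm] at h1
    exact h1

end Box

end LatticeGauge

end

noncomputable section

open scoped ENNReal NNReal

namespace LatticeGauge

/-! ### Gaussian integrals and the limit of the normalized determinants -/

section Gaussian

variable {d n : ℕ} {A : edges (box d n) → Prop} [DecidablePred A]

theorem lintegral_exp_neg_curlForm (hd : 0 < d) (hn : 0 < n) (hA : ∀ e, A e → ¬ IsAxial e.1)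
    {β : ℝ} (hβ : 0 < β) :
    ∫⁻ t : {e // A e} → ℝ, ENNReal.ofReal (Real.exp (-(β * (curlForm A t / 2)))) =
      ENNReal.ofReal (Real.sqrt
        ((2 * Real.pi / β) ^ Fintype.card {e // A e} / (curlMat A).det)) := by
  have hpd := (posDef_curlMat hd hn hA).smul hβ
  have h := lintegral_exp_neg_half_posDef hpd
  rw [Matrix.det_smul] at h
  rw [div_pow, div_div, ← h]
  refine lintegral_congr fun t => ?_
  rw [Matrix.smul_mulVec, dotProduct_smul, dotProduct_curlMat_mulVec, smul_eq_mul]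
  congr 2
  ring

end Gaussian

/-! ### Decoupling of the Maxwell form over blocks -/

section Blocks

variable {d m n q : ℕ} (h : m * q ≤ n)

instance : DecidablePred (IsBlockInterior (d := d) h) := Classical.decPred _

theorem IsBlockInterior.not_isAxial {e : edges (box d n)} (he : IsBlockInterior h e) :
    ¬ IsAxial e.1 := by
  obtain ⟨b, e', he', rfl⟩ := he
  exact he'.not_isAxial_shiftEdge h b

/-- The block-interior edges, indexed by the blocks and the interior edges of a block. -/
def blockEquiv : (Fin d → Fin q) × {e : edges (box d m) // IsInterior e} ≃
    {e : edges (box d n) // IsBlockInterior h e} :=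
  Equiv.ofBijective (fun z => ⟨shiftEdge h z.1 z.2.1, z.1, z.2.1, z.2.2, rfl⟩) <| by
    constructor
    · rintro ⟨b, e⟩ ⟨b', e'⟩ hz
      have := shiftEdge_injective h (a₁ := (b, e.1)) (a₂ := (b', e'.1)) (congrArg Subtype.val hz)
      rw [Prod.mk.injEq] at this
      exact Prod.ext this.1 (Subtype.ext this.2)
    · rintro ⟨e, b, e', he', rfl⟩
      exact ⟨(b, ⟨e', he'⟩), rfl⟩

theorem card_isBlockInterior : Fintype.card {e : edges (box d n) // IsBlockInterior h e} =
    q ^ d * Fintype.card {e : edges (box d m) // IsInterior e} := by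
  rw [← Fintype.card_congr (blockEquiv h), Fintype.card_prod]
  simp

theorem extZero_shiftEdge (t : {e : edges (box d n) // IsBlockInterior h e} → ℝ)
    (b : Fin d → Fin q) (e : edges (box d m)) :
    extZero _ t (shiftEdge h b e) = extZero IsInterior (fun k => t (blockEquiv h (b, k))) e := by
  by_cases he : IsInterior e
  · rw [extZero_of_pos _ he, extZero_of_pos _ ((isBlockInterior_shiftEdge_iff h b e).2 he)]
    rfl
  · rw [extZero_of_neg _ he, extZero_of_neg]
    rwa [isBlockInterior_shiftEdge_iff]

/-- Every plaquette touching a block-interior edge lies in a block, so nothing couples different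
blocks. -/
theorem curlForm_blockInterior_le (t : {e : edges (box d n) // IsBlockInterior h e} → ℝ) :
    curlForm (IsBlockInterior h) t ≤
      ∑ b : Fin d → Fin q, curlForm (IsInterior (m := m)) fun k => t (blockEquiv h (b, k)) := by
  refine (sum_plaquettes_le_sum_blocks h
    (fun p => circulation p (extZero (IsBlockInterior h) t) ^ 2) fun p hp => ?_).trans_eq ?_
  · simp only [Touches, not_or] at hp
    rw [circulation_apply, extZero_of_neg _ hp.1, extZero_of_neg _ hp.2.1,
      extZero_of_neg _ hp.2.2.1, extZero_of_neg _ hp.2.2.2]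
    simp
  · refine Finset.sum_congr rfl fun b _ => Finset.sum_congr rfl fun p _ => ?_
    simp only [circulation_apply, edge₁_shiftPlaq, edge₂_shiftPlaq, edge₃_shiftPlaq,
      edge₄_shiftPlaq, extZero_shiftEdge]

theorem log_le_of_sqrt_pow_le {D D' : ℝ} {k Q : ℕ} (hD : 0 < D) (hD' : 0 < D')
    (h : Real.sqrt ((2 * Real.pi / 1) ^ k / D) ^ Q ≤
      Real.sqrt ((2 * Real.pi / 1) ^ (Q * k) / D')) : Real.log D' ≤ Q * Real.log D := by
  have h6 := Real.log_le_log (by positivity) h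
  rw [Real.log_pow, Real.log_sqrt (by positivity), Real.log_sqrt (by positivity),
    Real.log_div (by positivity) hD.ne', Real.log_div (by positivity) hD'.ne', Real.log_pow,
    Real.log_pow] at h6
  push_cast at h6
  nlinarith

/-- Determinants are compared through Gaussian integrals: the sum of the block forms has an integral
that factors by Fubini, and the powers of 2π on the two sides agree. -/
theorem log_det_blockInterior_le (hd : 0 < d) (hm : 0 < m) (hn : 0 < n) :
    Real.log (curlMat (IsBlockInterior (d := d) h)).det ≤
      q ^ d * Real.log (curlMat (IsInterior (d := d) (m := m))).det := by
  have hA : ∀ e : edges (box d n), IsBlockInterior h e → ¬ IsAxial e.1 :=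
    fun e he => he.not_isAxial
  have hW : ∀ e : edges (box d m), IsInterior e → ¬ IsAxial e.1 := fun e he => he.not_isAxial
  have hUpos := (posDef_curlMat hd hn hA).det_pos
  have hWpos := (posDef_curlMat hd hm hW).det_pos
  have h1 := lintegral_exp_neg_curlForm hd hn hA one_pos
  have h2 := lintegral_exp_neg_curlForm hd hm hW one_pos
  have hmeas : Measurable fun t : {e : edges (box d m) // IsInterior e} → ℝ =>
      ENNReal.ofReal (Real.exp (-(1 * (curlForm IsInterior t / 2)))) := by
    have : Continuous fun t : {e : edges (box d m) // IsInterior e} → ℝ =>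
        curlForm IsInterior t := by
      simp only [← dotProduct_curlMat_mulVec]
      fun_prop
    fun_prop
  have h3 := lintegral_pi_blocks (volume : Measure ℝ)
    (fun _ : {e : edges (box d n) // IsBlockInterior h e} => True)
    ((blockEquiv h).trans (Equiv.subtypeUnivEquiv fun _ => trivial).symm) _ hmeas (fun _ => 1)
    measurable_const
  have h4 : ∫⁻ x : {e : edges (box d n) // IsBlockInterior h e} → ℝ,
      (∏ b : Fin d → Fin q, ENNReal.ofReal (Real.exp (-(1 * (curlForm IsInterior
        (fun k => x (blockEquiv h (b, k))) / 2))))) ≤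
      ∫⁻ t : {e : edges (box d n) // IsBlockInterior h e} → ℝ,
        ENNReal.ofReal (Real.exp (-(1 * (curlForm (IsBlockInterior h) t / 2)))) := by
    refine lintegral_mono fun x => ?_
    rw [← ENNReal.ofReal_prod_of_nonneg fun _ _ => (Real.exp_pos _).le, ← Real.exp_sum]
    refine ENNReal.ofReal_le_ofReal (Real.exp_le_exp.2 ?_)
    have := curlForm_blockInterior_le h x
    simp only [one_mul, Finset.sum_neg_distrib, ← Finset.sum_div]
    linarith
  have hc0 : Fintype.card {e : edges (box d n) // IsBlockInterior h e} -
      Fintype.card (Fin d → Fin q) * Fintype.card {e : edges (box d m) // IsInterior e} = 0 := by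
    rw [card_isBlockInterior]; simp
  rw [hc0, pow_zero, mul_one] at h3
  have h5 : (ENNReal.ofReal (Real.sqrt ((2 * Real.pi / 1) ^
      Fintype.card {e : edges (box d m) // IsInterior e} /
        (curlMat (IsInterior (d := d) (m := m))).det))) ^ (q ^ d) ≤
      ENNReal.ofReal (Real.sqrt ((2 * Real.pi / 1) ^
        Fintype.card {e : edges (box d n) // IsBlockInterior h e} /
          (curlMat (IsBlockInterior (d := d) h)).det)) := by
    rw [← h1, ← h2]
    refine le_trans (le_of_eq ?_) h4
    have hcard : Fintype.card (Fin d → Fin q) = q ^ d := by simp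
    rw [← hcard]
    refine h3.symm.trans ?_
    refine lintegral_congr fun x => ?_
    rw [Finset.prod_const_one, mul_one]
    rfl
  rw [← ENNReal.ofReal_pow (Real.sqrt_nonneg _), ENNReal.ofReal_le_ofReal_iff (Real.sqrt_nonneg _)]
    at h5
  rw [card_isBlockInterior] at h5
  exact_mod_cast log_le_of_sqrt_pow_le hWpos hUpos h5

/-- The blocks cover most of the box. -/
theorem block_volume_ge (hd : 1 ≤ d) (hm : 4 ≤ m) (hmn : m ≤ n) :
    (n : ℝ) ^ d * (1 - d * ((m : ℝ) / n + 3 / m)) ≤ ((n / m : ℕ) * ((m - 3 : ℕ) : ℝ)) ^ d := by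
  have hm0 : (4 : ℝ) ≤ m := by exact_mod_cast hm
  have hn0 : (m : ℝ) ≤ n := by exact_mod_cast hmn
  have hnpos : (0 : ℝ) < n := by linarith
  have hmpos : (0 : ℝ) < m := by linarith
  set y : ℝ := (m : ℝ) / n + 3 / m with hy
  have hy0 : 0 ≤ y := by positivity
  have hd1 : (1 : ℝ) ≤ d := by exact_mod_cast hd
  -- In each direction the covered proportion is at least (1 − m/n)(1 − 3/m) ≥ 1 − y, and
  -- Bernoulli's inequality handles the d-th power. If y > 1 the left side is not positive.
  by_cases h1 : y ≤ 1
  · have hq : (n : ℝ) - m ≤ m * (n / m : ℕ) := by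
      have h2 : n < m * (n / m) + m := by
        have := Nat.div_add_mod n m
        have := Nat.mod_lt n (show 0 < m by omega)
        omega
      have h3 : (n : ℝ) < m * (n / m : ℕ) + m := by exact_mod_cast h2
      linarith
    have hbase : (n : ℝ) * (1 - y) ≤ (n / m : ℕ) * ((m - 3 : ℕ) : ℝ) := by
      rw [Nat.cast_sub (by omega : 3 ≤ m)]
      push_cast
      have h4 : (n : ℝ) * (1 - y) = n - m - 3 * n / m := by
        rw [hy]; field_simp; ring
      have h5 : ((n : ℝ) - m) * ((m - 3) / m) ≤ m * (n / m : ℕ) * ((m - 3) / m) := by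
        refine mul_le_mul_of_nonneg_right hq ?_
        exact div_nonneg (by linarith) hmpos.le
      have h6 : (m : ℝ) * (n / m : ℕ) * ((m - 3) / m) = (n / m : ℕ) * (m - 3) := by
        field_simp
      have h7 : ((n : ℝ) - m) * ((m - 3) / m) = n - m - 3 * n / m + 3 := by
        field_simp; ring
      rw [h4]
      linarith
    calc (n : ℝ) ^ d * (1 - d * y) ≤ n ^ d * (1 - y) ^ d := by
          gcongr
          have := one_add_mul_le_pow (a := -y) (by linarith) d
          rw [← sub_eq_add_neg] at this
          linarith
      _ = (n * (1 - y)) ^ d := (mul_pow _ _ _).symm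
      _ ≤ _ := by
          refine pow_le_pow_left₀ ?_ hbase d
          exact mul_nonneg hnpos.le (by linarith)
  · push Not at h1
    have : (n : ℝ) ^ d * (1 - d * y) ≤ 0 := by
      refine mul_nonpos_of_nonneg_of_nonpos (by positivity) ?_
      nlinarith
    exact this.trans (by positivity)

/-- The number of free edges which are not block-interior. -/
theorem card_frozen_le (hd : 1 ≤ d) (hm : 4 ≤ m) (hmn : m ≤ n) :
    (Fintype.card (FreeEdge d n) : ℝ) - (n / m : ℕ) ^ d *
      Fintype.card {e : edges (box d m) // IsInterior e} ≤
      n ^ d * ((d - 1 : ℕ) * (d * ((m : ℝ) / n + 3 / m))) := by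
  have h1 : (Fintype.card (FreeEdge d n) : ℝ) ≤ n ^ d * (d - 1 : ℕ) := by
    exact_mod_cast card_freeEdge_le (d := d) (n := n)
  have h2 := block_volume_ge hd hm hmn
  rw [mul_pow] at h2
  rw [card_isInterior]
  push_cast
  have h3 := mul_le_mul_of_nonneg_right h2 (Nat.cast_nonneg (α := ℝ) (d - 1))
  nlinarith

theorem card_free_sub_interior_le (hm : 4 ≤ m) :
    (Fintype.card (FreeEdge d m) : ℝ) - Fintype.card {e : edges (box d m) // IsInterior e} ≤
      m ^ d * ((d - 1 : ℕ) * (d * (3 / m))) := by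
  have hm0 : (4 : ℝ) ≤ m := by exact_mod_cast hm
  have h1 : (Fintype.card (FreeEdge d m) : ℝ) ≤ m ^ d * (d - 1 : ℕ) := by
    exact_mod_cast card_freeEdge_le (d := d) (n := m)
  have h2 : (m : ℝ) ^ d * (1 - d * (3 / m)) ≤ ((m - 3 : ℕ) : ℝ) ^ d := by
    have h3 : ((m - 3 : ℕ) : ℝ) = m * (1 - 3 / m) := by
      rw [Nat.cast_sub (by omega : 3 ≤ m)]; push_cast; field_simp
    rw [h3, mul_pow]
    gcongr
    have h4 : 3 / (m : ℝ) ≤ 1 := by rw [div_le_one (by linarith)]; linarith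
    have := one_add_mul_le_pow (a := -(3 / (m : ℝ))) (by linarith) d
    rw [← sub_eq_add_neg] at this
    linarith
  rw [card_isInterior]
  push_cast
  have h3 := mul_le_mul_of_nonneg_right h2 (Nat.cast_nonneg (α := ℝ) (d - 1))
  nlinarith

end Blocks

/-! ### Existence of the limit of the normalized log determinants -/

section Limit

/-- The logarithm of the determinant of the Maxwell form in axial gauge, per site. -/
def logDet (d n : ℕ) : ℝ :=
  Real.log (curlMat fun e : edges (box d n) => ¬ IsAxial e.1).det / (n : ℝ) ^ d

theorem Knd_eq (d n : ℕ) : Knd n d = -(logDet d n) / 2 := by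
  rw [Knd, logDet, toMatrix'_maxwellForm₀]
  ring

variable {d m n : ℕ}

theorem logDet_nonneg (hd : 0 < d) (hn : 0 < n) : 0 ≤ logDet d n :=
  div_nonneg (log_det_curlMat_nonneg hd hn fun _ h => h) (by positivity)

theorem neg_log_gap (hd : 0 < d) (hn : 0 < n) :
    -Real.log (gap d n) = 3 * Real.log d + (d + 2) * Real.log n := by
  have hn' : (n : ℝ) ≠ 0 := by positivity
  have hd' : (d : ℝ) ≠ 0 := by positivity
  rw [gap, one_div, Real.log_inv, neg_neg, Real.log_mul (by positivity) (by positivity),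
    Real.log_mul (by positivity) hd', Real.log_pow, Real.log_pow, Real.log_mul hd' hn']
  push_cast
  ring

theorem log_det_interior_le (hd : 1 ≤ d) (hm : 4 ≤ m) :
    Real.log (curlMat (IsInterior (d := d) (m := m))).det ≤
      m ^ d * (logDet d m + (d - 1 : ℕ) * (d * (3 / m)) * (3 * Real.log d + (d + 2) * Real.log m)) := by
  have hm0 : 0 < m := by omega
  have h1 := (log_det_curlMat_compare (A := fun e : edges (box d m) => ¬ IsAxial e.1) hd hm0
    (fun _ h => h) IsInterior fun e he => he.not_isAxial).1
  have h2 := card_free_sub_interior_le (d := d) hm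
  have h3 : Real.log (curlMat fun e : edges (box d m) => ¬ IsAxial e.1).det = m ^ d * logDet d m := by
    rw [logDet]; field_simp
  rw [neg_log_gap hd hm0, h3] at h1
  have hl : 0 ≤ 3 * Real.log d + (d + 2) * Real.log m := by
    have := Real.log_nonneg (show (1 : ℝ) ≤ d by exact_mod_cast hd)
    have := Real.log_nonneg (show (1 : ℝ) ≤ m by exact_mod_cast hm0)
    positivity
  have h4 := mul_le_mul_of_nonneg_right h2 hl
  refine h1.trans ?_
  refine (add_le_add_right h4 _).trans (le_of_eq ?_)
  ring

/-- The free edges of the large box are reduced to block-interior ones, at cost log(16d) each. The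
blocks then decouple, and inside a block the interior edges are completed to all free edges, at cost
O(log m) each for a proportion O(1/m) of them. -/
theorem logDet_le (hd : 1 ≤ d) (hm : 4 ≤ m) (hmn : m ≤ n) :
    logDet d n ≤ logDet d m +
      (d - 1 : ℕ) * (d * (3 / m)) * (3 * Real.log d + (d + 2) * Real.log m) +
      (d - 1 : ℕ) * (d * ((m : ℝ) / n + 3 / m)) * Real.log (16 * d) := by
  have hm0 : 0 < m := by omega
  have hn0 : 0 < n := by omega
  have hq : m * (n / m) ≤ n := Nat.mul_div_le n m
  have h1 := (log_det_curlMat_compare (A := fun e : edges (box d n) => ¬ IsAxial e.1) hd hn0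
    (fun _ h => h) (IsBlockInterior hq) fun e he => he.not_isAxial).2
  have h2 := log_det_blockInterior_le hq hd hm0 hn0
  have h3 := log_det_interior_le hd hm
  have h4 := card_frozen_le hd hm hmn
  rw [card_isBlockInterior] at h1
  push_cast at h1
  have hW := log_det_curlMat_nonneg (A := IsInterior (d := d) (m := m)) hd hm0
    fun e he => he.not_isAxial
  have h16 : 0 ≤ Real.log (16 * d) := Real.log_nonneg (by
    have : (1 : ℝ) ≤ d := by exact_mod_cast hd
    linarith)
  set X := logDet d m + (d - 1 : ℕ) * (d * (3 / m)) * (3 * Real.log d + (d + 2) * Real.log m)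
    with hX
  have hX0 : 0 ≤ X := by
    have : 0 < (m : ℝ) ^ d := by positivity
    exact nonneg_of_mul_nonneg_right (hW.trans h3) this
  have hqm : ((n / m : ℕ) : ℝ) ^ d * m ^ d ≤ n ^ d := by
    rw [← mul_pow]
    gcongr
    rw [mul_comm]
    exact_mod_cast hq
  have h5 : ((n / m : ℕ) : ℝ) ^ d * Real.log (curlMat (IsInterior (d := d) (m := m))).det ≤
      n ^ d * X := by
    calc _ ≤ ((n / m : ℕ) : ℝ) ^ d * (m ^ d * X) := by gcongr
      _ = ((n / m : ℕ) : ℝ) ^ d * m ^ d * X := by ring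
      _ ≤ _ := by gcongr
  have h6 := mul_le_mul_of_nonneg_right h4 h16
  rw [logDet, div_le_iff₀ (by positivity)]
  calc _ ≤ _ := h1
    _ ≤ _ := add_le_add (h2.trans h5) h6
    _ = _ := by ring

/-- A variant of Fekete's lemma: letting n → ∞ with m fixed bounds the limsup by a m + f m, and
letting m → ∞ then bounds it by the liminf. -/
theorem tendsto_of_almost_subadditive {a f : ℕ → ℝ} {c : ℝ} {m₀ : ℕ} (ha : ∀ n, 0 < n → 0 ≤ a n)
    (hf : Tendsto f atTop (𝓝 0))
    (h : ∀ m n, m₀ ≤ m → m ≤ n → a n ≤ a m + f m + c * ((m : ℝ) / n)) :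
    ∃ l, Tendsto a atTop (𝓝 l) := by
  have hev : ∀ m, m₀ ≤ m → ∀ ε > 0, ∀ᶠ n in atTop, a n ≤ a m + f m + ε := by
    intro m hm ε hε
    have h1 : Tendsto (fun n : ℕ => c * ((m : ℝ) / n)) atTop (𝓝 0) := by
      have := (tendsto_const_div_atTop_nhds_zero_nat (m : ℝ)).const_mul c
      simpa using this
    filter_upwards [h1.eventually_le_const hε, eventually_ge_atTop m] with n hn hmn
    linarith [h m n hm hmn]
  have hba : IsBoundedUnder (· ≤ ·) atTop a :=
    ⟨a m₀ + f m₀ + 1, by simpa using hev m₀ le_rfl 1 one_pos⟩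
  have hbb : IsBoundedUnder (· ≥ ·) atTop a :=
    ⟨0, by simpa using (eventually_gt_atTop 0).mono ha⟩
  have hle : limsup a atTop ≤ liminf a atTop := by
    refine le_of_forall_pos_le_add fun ε hε => ?_
    have h2 : ∀ᶠ m in atTop, limsup a atTop - ε ≤ a m := by
      filter_upwards [hf.eventually_le_const (half_pos hε), eventually_ge_atTop m₀] with m hm hm'
      have := limsup_le_of_le hbb.isCoboundedUnder_le (hev m hm' (ε / 2) (half_pos hε))
      linarith
    have := le_liminf_of_le hba.isCoboundedUnder_ge h2
    linarith
  exact ⟨limsup a atTop, tendsto_of_le_liminf_of_limsup_le hle le_rfl hba hbb⟩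

theorem tendsto_logDet (hd : 1 ≤ d) : ∃ l, Tendsto (logDet d) atTop (𝓝 l) := by
  have h1 : Tendsto (fun m : ℕ => 3 / (m : ℝ)) atTop (𝓝 0) :=
    tendsto_const_div_atTop_nhds_zero_nat 3
  have h2 : Tendsto (fun m : ℕ => Real.log m / (m : ℝ)) atTop (𝓝 0) := by
    have := (Real.isLittleO_log_id_atTop.comp_tendsto tendsto_natCast_atTop_atTop).tendsto_div_nhds_zero
    simpa using this
  refine tendsto_of_almost_subadditive (m₀ := 4) (c := (d - 1 : ℕ) * d * Real.log (16 * d))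
    (f := fun m => (d - 1 : ℕ) * (d * (3 / m)) * (3 * Real.log d + (d + 2) * Real.log m) +
      (d - 1 : ℕ) * d * Real.log (16 * d) * (3 / m)) (fun n hn => logDet_nonneg hd hn) ?_ ?_
  · have h3 : (fun m : ℕ => (d - 1 : ℕ) * (d * (3 / (m : ℝ))) *
        (3 * Real.log d + (d + 2) * Real.log m) +
          (d - 1 : ℕ) * d * Real.log (16 * d) * (3 / m)) =
        fun m : ℕ => ((d - 1 : ℕ) * d * 3 * Real.log d + (d - 1 : ℕ) * d * Real.log (16 * d)) *
          (3 / (m : ℝ)) + (d - 1 : ℕ) * d * 3 * (d + 2) * (Real.log m / m) := by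
      funext m; ring
    rw [h3]
    simpa using (h1.const_mul _).add (h2.const_mul _)
  · intro m n hm hmn
    refine (logDet_le hd hm hmn).trans (le_of_eq ?_)
    ring

end Limit

end LatticeGauge

end

noncomputable section

open scoped ENNReal NNReal

namespace LatticeGauge

/-! ### Expansion of the Wilson action near the identity -/

section Expansion

variable {N : ℕ} (c : HaarChart N)

/-- The linear part of the holonomy in a chart. -/
theorem HaarChart.holonomy_approx : ∃ C r₀ : ℝ, 0 < C ∧ 0 < r₀ ∧ ∀ r, 0 ≤ r → r ≤ r₀ →
    ∀ θ₁ ∈ cube c.ι r, ∀ θ₂ ∈ cube c.ι r, ∀ θ₃ ∈ cube c.ι r, ∀ θ₄ ∈ cube c.ι r,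
      |udist (c.toUN θ₁ * c.toUN θ₂ * (c.toUN θ₃)⁻¹ * (c.toUN θ₄)⁻¹) ^ 2 -
        ∑ a, (θ₁ a + θ₂ a - θ₃ a - θ₄ a) ^ 2| ≤ C * r ^ 3 := by
  obtain ⟨C, r₀, hC, hr₀, h⟩ := c.approx
  set K : ℝ := 4 * C + 2 * (N + C) ^ 2 with hK
  have hK0 : 0 < K := by positivity
  refine ⟨K * (8 * N + K), min r₀ 1, by positivity, lt_min hr₀ one_pos, ?_⟩
  intro r hr hrr θ₁ h₁ θ₂ h₂ θ₃ h₃ θ₄ h₄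
  have hr1 : r ≤ 1 := hrr.trans (min_le_right _ _)
  have hR : ∀ θ ∈ cube c.ι r, hs ((c.toUN θ : Matrix (Fin N) (Fin N) ℂ) - 1 - c.lin θ) ≤ C * r ^ 2 :=
    h r hr (hrr.trans (min_le_left _ _))
  have hL : ∀ θ ∈ cube c.ι r, hs (c.lin θ) ≤ N * r := fun θ hθ => c.hs_lin_le hr hθ
  have hD : ∀ θ ∈ cube c.ι r, hs ((c.toUN θ : Matrix (Fin N) (Fin N) ℂ) - 1) ≤ (N + C) * r := by
    intro θ hθ
    have := hs_add_le ((c.toUN θ : Matrix (Fin N) (Fin N) ℂ) - 1 - c.lin θ) (c.lin θ)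
    rw [sub_add_cancel] at this
    have h5 := hL θ hθ
    have h7 := hR θ hθ
    have h6 : C * r ^ 2 ≤ C * r := by gcongr; nlinarith
    linarith
  have hP : ∀ θ ∈ cube c.ι r, ∀ θ' ∈ cube c.ι r,
      hs (((c.toUN θ : Matrix (Fin N) (Fin N) ℂ) - 1) * ((c.toUN θ' : Matrix (Fin N) (Fin N) ℂ) - 1)) ≤
        (N + C) ^ 2 * r ^ 2 := by
    intro θ hθ θ' hθ'
    refine (hs_mul_le _ _).trans ?_
    have := mul_le_mul (hD θ hθ) (hD θ' hθ') (hs_nonneg _) (by positivity)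
    linarith
  set Y := c.lin θ₁ + c.lin θ₂ - c.lin θ₃ - c.lin θ₄ with hY
  have hYsq : ∑ a, (θ₁ a + θ₂ a - θ₃ a - θ₄ a) ^ 2 = hs Y ^ 2 := by
    rw [hY, ← map_add, ← map_sub, ← map_sub, c.hs_lin_sq]
    rfl
  have hYle : hs Y ≤ 4 * N * r := by
    have e1 := hs_sub_le (c.lin θ₁ + c.lin θ₂ - c.lin θ₃) (c.lin θ₄)
    have e2 := hs_sub_le (c.lin θ₁ + c.lin θ₂) (c.lin θ₃)
    have e3 := hs_add_le (c.lin θ₁) (c.lin θ₂)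
    linarith [hL _ h₁, hL _ h₂, hL _ h₃, hL _ h₄]
  rw [hYsq, udist_plaquette]
  set a := (c.toUN θ₁ : Matrix (Fin N) (Fin N) ℂ)
  set b := (c.toUN θ₂ : Matrix (Fin N) (Fin N) ℂ)
  set e := (c.toUN θ₃ : Matrix (Fin N) (Fin N) ℂ)
  set f := (c.toUN θ₄ : Matrix (Fin N) (Fin N) ℂ)
  set H := a * b - f * e with hH
  -- An exact splitting into the four remainders of the chart and two products of small factors, all
  -- of order r².
  have hdec : H - Y = (a - 1 - c.lin θ₁) + (b - 1 - c.lin θ₂) - (e - 1 - c.lin θ₃) -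
      (f - 1 - c.lin θ₄) + (a - 1) * (b - 1) - (f - 1) * (e - 1) := by
    rw [hH, hY]; noncomm_ring
  have hHY : hs (H - Y) ≤ K * r ^ 2 := by
    rw [hdec]
    have e1 := hs_sub_le ((a - 1 - c.lin θ₁) + (b - 1 - c.lin θ₂) - (e - 1 - c.lin θ₃) -
      (f - 1 - c.lin θ₄) + (a - 1) * (b - 1)) ((f - 1) * (e - 1))
    have e2 := hs_add_le ((a - 1 - c.lin θ₁) + (b - 1 - c.lin θ₂) - (e - 1 - c.lin θ₃) -
      (f - 1 - c.lin θ₄)) ((a - 1) * (b - 1))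
    have e3 := hs_sub_le ((a - 1 - c.lin θ₁) + (b - 1 - c.lin θ₂) - (e - 1 - c.lin θ₃))
      (f - 1 - c.lin θ₄)
    have e4 := hs_sub_le ((a - 1 - c.lin θ₁) + (b - 1 - c.lin θ₂)) (e - 1 - c.lin θ₃)
    have e5 := hs_add_le (a - 1 - c.lin θ₁) (b - 1 - c.lin θ₂)
    have f1 : hs ((a - 1) * (b - 1)) ≤ _ := hP _ h₁ _ h₂
    have f2 : hs ((f - 1) * (e - 1)) ≤ _ := hP _ h₄ _ h₃
    have g1 : hs (a - 1 - c.lin θ₁) ≤ _ := hR _ h₁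
    have g2 : hs (b - 1 - c.lin θ₂) ≤ _ := hR _ h₂
    have g3 : hs (e - 1 - c.lin θ₃) ≤ _ := hR _ h₃
    have g4 : hs (f - 1 - c.lin θ₄) ≤ _ := hR _ h₄
    rw [hK]
    linarith
  have hH1 : hs H ≤ hs Y + K * r ^ 2 := by
    have := hs_add_le (H - Y) Y
    rw [sub_add_cancel] at this
    linarith
  have hH2 : hs Y ≤ hs H + K * r ^ 2 := by
    have := hs_sub_le H (H - Y)
    rw [sub_sub_cancel] at this
    linarith
  have hr2 : r ^ 2 ≤ r := by nlinarith
  have hsum : hs H + hs Y ≤ (8 * N + K) * r := by nlinarith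
  have h0 := hs_nonneg H
  have h0' := hs_nonneg Y
  -- In the difference of squares the sum is O(r) and the difference O(r²), whence the cubic error.
  rw [sq_sub_sq, abs_mul, abs_of_nonneg (add_nonneg h0 h0')]
  calc (hs H + hs Y) * |hs H - hs Y| ≤ ((8 * N + K) * r) * (K * r ^ 2) := by
        refine mul_le_mul hsum ?_ (abs_nonneg _) (by positivity)
        rw [abs_le]
        constructor <;> linarith
    _ = _ := by ring

/-- The chart sends 0 to the identity, so frozen edges are simply edges with coordinates 0. To
second order the coordinates of U(N) decouple, and each carries its own Maxwell form. -/
theorem HaarChart.wilsonAction_approx : ∃ C r₀ : ℝ, 0 < C ∧ 0 < r₀ ∧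
    ∀ {d : ℕ} {Λ : Finset (Site d)} (A : edges Λ → Prop) [DecidablePred A] (r : ℝ), 0 ≤ r → r ≤ r₀ →
    ∀ θ : {e // A e} → c.ι → ℝ, (∀ e, θ e ∈ cube c.ι r) →
      |wilsonAction (extOne A fun e => c.toUN (θ e)) - ∑ a, curlForm A (fun e => θ e a) / 2| ≤
        Fintype.card (plaquettes Λ) * (C * r ^ 3) := by
  obtain ⟨C, r₀, hC, hr₀, h⟩ := c.holonomy_approx
  refine ⟨C, r₀, hC, hr₀, fun {d Λ} A _ r hr hrr θ hθ => ?_⟩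
  set η : edges Λ → c.ι → ℝ := fun e a => extZero A (fun e => θ e a) e with hη
  have hηc : ∀ e, η e ∈ cube c.ι r := by
    intro e a
    by_cases he : A e
    · simp only [hη, extZero_of_pos _ he]; exact hθ _ a
    · simp only [hη, extZero_of_neg _ he, abs_zero]; exact hr
  have hU : ∀ e, extOne A (fun e => c.toUN (θ e)) e = c.toUN (η e) := by
    intro e
    by_cases he : A e
    · rw [extOne_of_pos _ he]
      congr 1
      funext a
      simp only [hη, extZero_of_pos _ he]
    · rw [extOne_of_neg _ he, ← c.toUN_zero]
      congr 1
      funext a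
      simp only [hη, extZero_of_neg _ he, Pi.zero_apply]
  have hsum : ∑ a, curlForm A (fun e => θ e a) / 2 =
      ∑ p : plaquettes Λ, (∑ a, (η (Plaquette.edge₁ p) a + η (Plaquette.edge₂ p) a -
        η (Plaquette.edge₃ p) a - η (Plaquette.edge₄ p) a) ^ 2) / 2 := by
    simp only [← Finset.sum_div, curlForm, circulation_apply]
    rw [Finset.sum_comm]
  rw [hsum, wilsonAction, ← Finset.sum_sub_distrib]
  refine (Finset.abs_sum_le_sum_abs _ _).trans ?_
  rw [← nsmul_eq_mul, ← Finset.card_univ]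
  refine Finset.sum_le_card_nsmul _ _ _ fun p _ => ?_
  rw [phi_eq, holonomy, hU, hU, hU, hU, ← sub_div, abs_div, abs_two]
  have := h r hr hrr _ (hηc (Plaquette.edge₁ p)) _ (hηc (Plaquette.edge₂ p)) _
    (hηc (Plaquette.edge₃ p)) _ (hηc (Plaquette.edge₄ p))
  have h0 : 0 ≤ C * r ^ 3 := by positivity
  linarith

end Expansion

/-! ### Small action forces all edges near the identity; the Gaussian integral in all coordinates -/

section Coercivity

variable {d n N : ℕ} {A : edges (box d n) → Prop} [DecidablePred A]

/-- When the second and fourth edges of a plaquette are the identity, its holonomy is ab⁻¹ with a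
and b on the two parallel edges, so it controls the change of `udist` between them. The axial
induction then runs as in the linear case. -/
theorem udist_le_of_holonomy (hA : ∀ e, A e → ¬ IsAxial e.1) {s : ℝ} (hs : 0 ≤ s)
    (U : {e // A e} → UN N) (h : ∀ p, udist (holonomy (extOne A U) p) ≤ s) (e : {e // A e}) :
    udist (U e) ≤ d * n * s := by
  have key := le_of_axial_increments (fun e => udist (extOne A U e)) hs (fun e he => ?_)
    (fun p h2 h4 => ?_) e.1
  · simpa only [extOne_of_pos _ e.2] using key
  · rw [extOne_of_neg _ fun hAe => hA e hAe he, udist_one]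
  · have hp := h p
    rw [holonomy, extOne_of_neg U fun hAe => hA _ hAe h2, extOne_of_neg U fun hAe => hA _ hAe h4,
      mul_one, inv_one, mul_one] at hp
    set a := extOne A U (Plaquette.edge₁ p)
    set b := extOne A U (Plaquette.edge₃ p)
    have h3 := udist_mul_le (a * b⁻¹)⁻¹ a
    rw [mul_inv_rev, inv_inv, inv_mul_cancel_right, ← udist_inv (b * a⁻¹), mul_inv_rev, inv_inv]
      at h3
    linarith

theorem udist_le_of_wilsonAction_le (hA : ∀ e, A e → ¬ IsAxial e.1) {s : ℝ} (hs : 0 ≤ s)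
    (U : {e // A e} → UN N) (h : wilsonAction (extOne A U) ≤ s ^ 2 / 2) (e : {e // A e}) :
    udist (U e) ≤ d * n * s := by
  refine udist_le_of_holonomy hA hs U (fun p => ?_) e
  have h1 : phi (holonomy (extOne A U) p) ≤ wilsonAction (extOne A U) :=
    Finset.single_le_sum (f := fun p => phi (holonomy (extOne A U) p)) (fun _ _ => phi_nonneg _)
      (Finset.mem_univ p)
  rw [phi_eq] at h1
  exact abs_le_of_sq_le_sq' (by linarith) hs |>.2

/-- The measure is a product over edges while the integrand is a product over group coordinates;
exchanging the two makes the integral a power. -/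
theorem lintegral_prod_flip {K ι : Type*} [Fintype K] [Fintype ι] (f : (K → ℝ) → ℝ≥0∞)
    (hf : Measurable f) :
    ∫⁻ θ : K → ι → ℝ, ∏ a, f (fun k => θ k a) = (∫⁻ t, f t) ^ Fintype.card ι := by
  have hm : Measurable fun θ : K → ι → ℝ => ∏ a, f (fun k => θ k a) :=
    Finset.measurable_fun_prod _ fun a _ => hf.comp (by fun_prop)
  have h1 := (measurePreserving_curry_pi (ι := K) (κ := ι) (volume : Measure ℝ)).lintegral_comp hm
  have h2 := lintegral_pi_blocks (volume : Measure ℝ) (fun _ : K × ι => True)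
    ((Equiv.prodComm ι K).trans (Equiv.subtypeUnivEquiv fun _ => trivial).symm) f hf (fun _ => 1)
    measurable_const
  have hc : Fintype.card (K × ι) - Fintype.card ι * Fintype.card K = 0 := by
    rw [Fintype.card_prod, mul_comm, Nat.sub_self]
  rw [hc, pow_zero, mul_one] at h2
  simp only [Finset.prod_const_one, mul_one] at h2
  exact h1.symm.trans h2

theorem continuous_curlForm {Λ : Finset (Site d)} (A : edges Λ → Prop) [DecidablePred A] :
    Continuous fun t : {e // A e} → ℝ => curlForm A t := by
  simp only [← dotProduct_curlMat_mulVec]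
  fun_prop

theorem lintegral_exp_neg_sum_curlForm (hd : 0 < d) (hn : 0 < n) (hA : ∀ e, A e → ¬ IsAxial e.1)
    {β : ℝ} (hβ : 0 < β) (c : HaarChart N) :
    ∫⁻ θ : {e // A e} → c.ι → ℝ,
        ENNReal.ofReal (Real.exp (-(β * ∑ a, curlForm A (fun e => θ e a) / 2))) =
      ENNReal.ofReal (Real.sqrt
        ((2 * Real.pi / β) ^ Fintype.card {e // A e} / (curlMat A).det)) ^ (N ^ 2) := by
  have hm : Measurable fun t : {e // A e} → ℝ =>
      ENNReal.ofReal (Real.exp (-(β * (curlForm A t / 2)))) := by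
    have := continuous_curlForm A
    fun_prop
  rw [← lintegral_exp_neg_curlForm hd hn hA hβ, ← c.card_eq, ← lintegral_prod_flip _ hm]
  refine lintegral_congr fun θ => ?_
  rw [← ENNReal.ofReal_prod_of_nonneg fun _ _ => (Real.exp_pos _).le, ← Real.exp_sum,
    Finset.mul_sum, Finset.sum_neg_distrib]

end Coercivity

end LatticeGauge

end

noncomputable section

open scoped ENNReal NNReal

namespace LatticeGauge

/-! ### The partition function of a single box -/

section ChartMeasure

variable {N : ℕ} (c : HaarChart N)

theorem cube_eq_pi (ι : Type*) (r : ℝ) : cube ι r = Set.univ.pi fun _ => Set.Icc (-r) r := by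
  ext θ; simp only [mem_cube, abs_le, Set.mem_univ_pi, Set.mem_Icc]

instance isFiniteMeasure_restrict_cube (ι : Type*) [Fintype ι] (r : ℝ) :
    IsFiniteMeasure ((volume : Measure (ι → ℝ)).restrict (cube ι r)) := by
  refine ⟨?_⟩
  rw [Measure.restrict_apply_univ, cube_eq_pi]
  exact (isCompact_univ_pi fun _ => isCompact_Icc).measure_lt_top

/-- The image in `U(N)` of Lebesgue measure on a cube of the chart. -/
def chartMeasure (r : ℝ) : Measure (UN N) := (volume.restrict (cube c.ι r)).map c.toUN

instance (r : ℝ) : IsFiniteMeasure (chartMeasure c r) := by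
  unfold chartMeasure; infer_instance

theorem measurePreserving_chartMeasure (r : ℝ) :
    MeasurePreserving c.toUN (volume.restrict (cube c.ι r)) (chartMeasure c r) :=
  ⟨c.continuous_toUN.measurable, rfl⟩

theorem chartMeasure_apply (r : ℝ) {s : Set (UN N)} (hs : MeasurableSet s) :
    chartMeasure c r s = ∫⁻ θ in cube c.ι r, s.indicator 1 (c.toUN θ) := by
  rw [chartMeasure, ← lintegral_indicator_one hs,
    lintegral_map (measurable_one.indicator hs) c.continuous_toUN.measurable]

theorem lintegral_pi_chartMeasure {K : Type*} [Fintype K] (r : ℝ) (f : (K → UN N) → ℝ≥0∞)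
    (hf : Measurable f) :
    ∫⁻ U, f U ∂(Measure.pi fun _ => chartMeasure c r) =
      ∫⁻ θ : K → c.ι → ℝ in {θ | ∀ k, θ k ∈ cube c.ι r}, f fun k => c.toUN (θ k) := by
  have h := measurePreserving_pi (fun _ : K => volume.restrict (cube c.ι r))
    (fun _ : K => chartMeasure c r) fun _ => measurePreserving_chartMeasure c r
  rw [← h.lintegral_comp hf]
  have hset : {θ : K → c.ι → ℝ | ∀ k, θ k ∈ cube c.ι r} = Set.univ.pi fun _ => cube c.ι r := by
    ext; simp
  rw [hset, volume_pi (α := fun _ : K => c.ι → ℝ), Measure.restrict_pi_pi]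

theorem measurableSet_forall_mem_cube {K ι : Type*} [Fintype K] [Fintype ι] (r : ℝ) :
    MeasurableSet {θ : K → ι → ℝ | ∀ k, θ k ∈ cube ι r} := by
  rw [Set.ofPred_forall]
  exact MeasurableSet.iInter fun k => (measurable_pi_apply k) (measurableSet_cube r)

end ChartMeasure

section SingleBox

variable {N : ℕ} (c : HaarChart N)

/-- Configurations of action above s²/2 contribute at most exp(−βs²/2), the reference measure having
mass 1. All others have every edge within d·n·s of the identity, so the chart applies, and the
resulting Gaussian integral may be extended to the whole space. -/
theorem exists_fixedZ_le (N : ℕ) : ∃ C L s₀ : ℝ, 0 < C ∧ 0 < L ∧ 0 < s₀ ∧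
    ∀ {d n : ℕ} (A : edges (box d n) → Prop) [DecidablePred A], 0 < d → 0 < n →
      (∀ e, A e → ¬ IsAxial e.1) → ∀ β s : ℝ, 0 < β → 0 ≤ s → d * n * s ≤ s₀ →
      fixedZ N A β ≤ ENNReal.ofReal (Real.exp (-(β * (s ^ 2 / 2))) +
        haarDensity N ^ Fintype.card {e // A e} *
          (Real.exp (β * (Fintype.card (plaquettes (box d n)) * (C * (L * (d * n * s)) ^ 3))) *
            Real.sqrt ((2 * Real.pi / β) ^ Fintype.card {e // A e} / (curlMat A).det) ^ (N ^ 2))) := by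
  have c := HaarChart.std N
  obtain ⟨C, r₀, hC, hr₀, hact⟩ := c.wilsonAction_approx
  obtain ⟨L, s₁, hL, hs₁, hup⟩ := c.upper
  refine ⟨C, L, min s₁ (r₀ / L), hC, hL, lt_min hs₁ (by positivity), ?_⟩
  intro d n A _ hd hn hA β s hβ hs hds
  set σ : ℝ := d * n * s with hσ
  have hσ0 : 0 ≤ σ := by positivity
  have hσ1 : σ ≤ s₁ := hds.trans (min_le_left _ _)
  have hσ2 : L * σ ≤ r₀ := by
    rw [← le_div_iff₀' hL]; exact hds.trans (min_le_right _ _)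
  set D := {U : UN N | udist U ≤ σ} with hD
  have hDm : MeasurableSet D := measurableSet_le continuous_udist.measurable measurable_const
  have hwm : Measurable fun U : {e // A e} → UN N => weight β (extOne A U) :=
    (measurable_weight β).comp (continuous_extOne A).measurable
  set k := Fintype.card {e // A e} with hk
  set P := Fintype.card (plaquettes (box d n))
  have hdens : 0 < ENNReal.ofReal (haarDensity N) := ENNReal.ofReal_pos.2 (haarDensity_pos N)
  have hle : (haarUN N).restrict D ≤ ENNReal.ofReal (haarDensity N) • chartMeasure c (L * σ) := by
    refine Measure.le_iff.2 fun t ht => ?_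
    rw [Measure.smul_apply, chartMeasure_apply _ _ ht, smul_eq_mul]
    refine le_trans (le_of_eq ?_) (hup σ hσ0 hσ1 (t.indicator 1) (measurable_one.indicator ht))
    rw [lintegral_indicator_one ht]
  have hpi := Measure.pi_le_smul_pi (ι := {e // A e}) hdens.ne' ENNReal.ofReal_ne_top hle
  have hsplit : ∀ U : {e // A e} → UN N, weight β (extOne A U) ≤
      ENNReal.ofReal (Real.exp (-(β * (s ^ 2 / 2)))) +
        (Set.univ.pi fun _ => D).indicator (fun U => weight β (extOne A U)) U := by
    intro U
    by_cases h : wilsonAction (extOne A U) ≤ s ^ 2 / 2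
    · have hU : U ∈ Set.univ.pi fun _ : {e // A e} => D :=
        fun e _ => udist_le_of_wilsonAction_le hA hs U h e
      rw [Set.indicator_of_mem hU]
      exact le_add_self
    · push Not at h
      refine le_trans ?_ le_self_add
      refine ENNReal.ofReal_le_ofReal (Real.exp_le_exp.2 ?_)
      have := mul_le_mul_of_nonneg_left h.le hβ.le
      linarith
  have hset : MeasurableSet (Set.univ.pi fun _ : {e // A e} => D) :=
    MeasurableSet.univ_pi fun _ => hDm
  have hmain : ∫⁻ U : {e // A e} → UN N in Set.univ.pi fun _ => D, weight β (extOne A U)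
      ∂(Measure.pi fun _ => haarUN N) ≤ ENNReal.ofReal (haarDensity N) ^ k *
        (ENNReal.ofReal (Real.exp (β * (P * (C * (L * σ) ^ 3)))) *
          ENNReal.ofReal (Real.sqrt ((2 * Real.pi / β) ^ k / (curlMat A).det)) ^ (N ^ 2)) := by
    rw [Measure.restrict_pi_pi]
    refine (lintegral_mono' hpi le_rfl).trans ?_
    rw [lintegral_smul_measure, smul_eq_mul, lintegral_pi_chartMeasure _ _ _ hwm]
    refine mul_le_mul_right ?_ _
    rw [← lintegral_exp_neg_sum_curlForm hd hn hA hβ c,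
      ← lintegral_const_mul' _ _ ENNReal.ofReal_ne_top,
      ← lintegral_indicator (measurableSet_forall_mem_cube _)]
    refine lintegral_mono fun θ => ?_
    refine Set.indicator_apply_le' (fun hθ => ?_) fun _ => zero_le
    have h1 := hact A (L * σ) (by positivity) hσ2 θ hθ
    rw [← ENNReal.ofReal_mul (Real.exp_pos _).le, ← Real.exp_add]
    refine ENNReal.ofReal_le_ofReal (Real.exp_le_exp.2 ?_)
    have h2 := (abs_le.1 h1).1
    have h3 := mul_le_mul_of_nonneg_left h2 hβ.le
    rw [mul_sub] at h3
    linarith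
  rw [ENNReal.ofReal_add (Real.exp_pos _).le (mul_nonneg (pow_nonneg (haarDensity_pos N).le _)
      (mul_nonneg (Real.exp_pos _).le (pow_nonneg (Real.sqrt_nonneg _) _))),
    ENNReal.ofReal_mul (pow_nonneg (haarDensity_pos N).le _),
    ENNReal.ofReal_mul (Real.exp_pos _).le, ENNReal.ofReal_pow (haarDensity_pos N).le,
    ENNReal.ofReal_pow (Real.sqrt_nonneg _)]
  calc fixedZ N A β ≤ ∫⁻ U : {e // A e} → UN N, (ENNReal.ofReal (Real.exp (-(β * (s ^ 2 / 2)))) +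
        (Set.univ.pi fun _ => D).indicator (fun U => weight β (extOne A U)) U)
          ∂(Measure.pi fun _ => haarUN N) := lintegral_mono hsplit
    _ = ENNReal.ofReal (Real.exp (-(β * (s ^ 2 / 2)))) +
        ∫⁻ U : {e // A e} → UN N in Set.univ.pi fun _ => D, weight β (extOne A U)
          ∂(Measure.pi fun _ => haarUN N) := by
        rw [lintegral_add_left measurable_const, lintegral_const, measure_univ, mul_one,
          lintegral_indicator hset]
    _ ≤ _ := by gcongr

/-- Outside the cube some coordinate exceeds r, so the spectral gap makes the exponent large. Half
of the exponent is spent on this. The other half is a Gaussian at β/2, whose mass is larger than the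
original one by the factor √(2^k)^(N²). -/
theorem lintegral_cube_ge_half {d n : ℕ} (A : edges (box d n) → Prop) [DecidablePred A] (hd : 0 < d)
    (hn : 0 < n) (hA : ∀ e, A e → ¬ IsAxial e.1) {β r : ℝ} (hβ : 0 < β) (hr : 0 ≤ r)
    (hsmall : Real.exp (-(β * (gap d n * r ^ 2) / 4)) *
      Real.sqrt (2 ^ Fintype.card {e // A e}) ^ (N ^ 2) ≤ 1 / 2) :
    ENNReal.ofReal (1 / 2 * Real.sqrt
        ((2 * Real.pi / β) ^ Fintype.card {e // A e} / (curlMat A).det) ^ (N ^ 2)) ≤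
      ∫⁻ θ : {e // A e} → c.ι → ℝ in {θ | ∀ k, θ k ∈ cube c.ι r},
        ENNReal.ofReal (Real.exp (-(β * ∑ a, curlForm A (fun e => θ e a) / 2))) := by
  have hG := lintegral_exp_neg_sum_curlForm hd hn hA hβ c
  have hG2 := lintegral_exp_neg_sum_curlForm hd hn hA (half_pos hβ) c
  have hdet := (posDef_curlMat hd hn hA).det_pos
  set D := {θ : {e // A e} → c.ι → ℝ | ∀ k, θ k ∈ cube c.ι r}
  have hDm : MeasurableSet D := measurableSet_forall_mem_cube r
  set k := Fintype.card {e // A e} with hk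
  set G := Real.sqrt ((2 * Real.pi / β) ^ k / (curlMat A).det) ^ (N ^ 2) with hGdef
  have hG0 : 0 ≤ G := pow_nonneg (Real.sqrt_nonneg _) _
  have hrel : Real.sqrt ((2 * Real.pi / (β / 2)) ^ k / (curlMat A).det) ^ (N ^ 2) =
      Real.sqrt (2 ^ k) ^ (N ^ 2) * G := by
    rw [hGdef, ← mul_pow, ← Real.sqrt_mul (pow_nonneg zero_le_two _)]
    congr 2
    rw [← mul_div_assoc, ← mul_pow]
    congr 2
    field_simp
  rw [← ENNReal.ofReal_pow (Real.sqrt_nonneg _)] at hG hG2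
  rw [hrel] at hG2
  have hout : ∫⁻ θ in Dᶜ, ENNReal.ofReal (Real.exp (-(β * ∑ a, curlForm A (fun e => θ e a) / 2))) ≤
      ENNReal.ofReal (1 / 2 * G) := by
    calc ∫⁻ θ in Dᶜ, ENNReal.ofReal (Real.exp (-(β * ∑ a, curlForm A (fun e => θ e a) / 2)))
        ≤ ∫⁻ θ : {e // A e} → c.ι → ℝ, ENNReal.ofReal (Real.exp (-(β * (gap d n * r ^ 2) / 4))) *
          ENNReal.ofReal (Real.exp (-(β / 2 * ∑ a, curlForm A (fun e => θ e a) / 2))) := by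
          rw [← lintegral_indicator hDm.compl]
          refine lintegral_mono fun θ => ?_
          refine Set.indicator_apply_le' (fun hθ => ?_) fun _ => zero_le
          rw [← ENNReal.ofReal_mul (Real.exp_pos _).le, ← Real.exp_add]
          refine ENNReal.ofReal_le_ofReal (Real.exp_le_exp.2 ?_)
          have hθ' : ∃ e a, r < |θ e a| := by
            have : ¬ ∀ k, θ k ∈ cube c.ι r := hθ
            simpa only [mem_cube, not_forall, not_le] using this
          obtain ⟨e, a, hea⟩ := hθ'
          have h1 : r ^ 2 ≤ (fun e => θ e a) ⬝ᵥ fun e => θ e a := by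
            calc r ^ 2 ≤ |θ e a| ^ 2 := by gcongr
              _ = θ e a * θ e a := by rw [sq_abs, sq]
              _ ≤ _ := Finset.single_le_sum (f := fun e => θ e a * θ e a)
                  (fun _ _ => mul_self_nonneg _) (Finset.mem_univ e)
          have h2 : gap d n * r ^ 2 ≤ curlForm A fun e => θ e a :=
            (mul_le_mul_of_nonneg_left h1 (gap_pos hd hn).le).trans
              (gap_mul_le_curlForm hd hn hA _)
          have h3 : curlForm A (fun e => θ e a) / 2 ≤ ∑ a, curlForm A (fun e => θ e a) / 2 :=
            Finset.single_le_sum (f := fun a => curlForm A (fun e => θ e a) / 2)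
              (fun a _ => div_nonneg (curlForm_nonneg A _) zero_le_two) (Finset.mem_univ a)
          have h4 := mul_le_mul_of_nonneg_left (h2.trans (by linarith : _ ≤ 2 * ∑ a, curlForm A
            (fun e => θ e a) / 2)) hβ.le
          linarith
      _ = ENNReal.ofReal (Real.exp (-(β * (gap d n * r ^ 2) / 4)) * (Real.sqrt (2 ^ k) ^ (N ^ 2) * G)) := by
          rw [lintegral_const_mul' _ _ ENNReal.ofReal_ne_top, hG2,
            ENNReal.ofReal_mul (Real.exp_pos _).le]
      _ ≤ _ := by
          refine ENNReal.ofReal_le_ofReal ?_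
          rw [← mul_assoc]
          exact mul_le_mul_of_nonneg_right hsmall hG0
  have htot := lintegral_add_compl (μ := volume) (fun θ : {e // A e} → c.ι → ℝ =>
    ENNReal.ofReal (Real.exp (-(β * ∑ a, curlForm A (fun e => θ e a) / 2)))) hDm
  rw [hG] at htot
  have hhalf : ENNReal.ofReal G = ENNReal.ofReal (1 / 2 * G) + ENNReal.ofReal (1 / 2 * G) := by
    rw [← ENNReal.ofReal_add (by positivity) (by positivity)]
    congr 1
    ring
  rw [hhalf] at htot
  refine ENNReal.le_of_add_le_add_right ENNReal.ofReal_ne_top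
    (a := ENNReal.ofReal (1 / 2 * G)) ?_
  rw [← htot]
  gcongr

/-- Only a small cube of the chart is kept, on which the density is at least κ times its value at
the identity and the action is quadratic up to a cubic error. The constant C does not depend on κ;
the radius r₀ does. -/
theorem exists_le_fixedZ (N : ℕ) : ∃ C : ℝ, 0 < C ∧ ∀ κ : ℝ, 0 < κ → κ < 1 → ∃ r₀ : ℝ, 0 < r₀ ∧
    ∀ {d n : ℕ} (A : edges (box d n) → Prop) [DecidablePred A], 0 < d → 0 < n →
      (∀ e, A e → ¬ IsAxial e.1) → ∀ β r : ℝ, 0 < β → 0 ≤ r → r ≤ r₀ →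
      Real.exp (-(β * (gap d n * r ^ 2) / 4)) *
        Real.sqrt (2 ^ Fintype.card {e // A e}) ^ (N ^ 2) ≤ 1 / 2 →
      ENNReal.ofReal ((κ * haarDensity N) ^ Fintype.card {e // A e} *
          (Real.exp (-(β * (Fintype.card (plaquettes (box d n)) * (C * r ^ 3)))) *
            (1 / 2 * Real.sqrt
              ((2 * Real.pi / β) ^ Fintype.card {e // A e} / (curlMat A).det) ^ (N ^ 2)))) ≤
        fixedZ N A β := by
  have c := HaarChart.std N
  obtain ⟨C, r₁, hC, hr₁, hact⟩ := c.wilsonAction_approx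
  refine ⟨C, hC, fun κ hκ0 hκ1 => ?_⟩
  obtain ⟨r₂, hr₂, hlow⟩ := c.lower κ hκ0 hκ1
  refine ⟨min r₁ r₂, lt_min hr₁ hr₂, ?_⟩
  intro d n A _ hd hn hA β r hβ hr hrr hsmall
  have hhalf := lintegral_cube_ge_half c A hd hn hA hβ hr hsmall
  set k := Fintype.card {e // A e} with hk
  set P := Fintype.card (plaquettes (box d n))
  have hcpos : 0 < κ * haarDensity N := mul_pos hκ0 (haarDensity_pos N)
  set γ := ENNReal.ofReal (κ * haarDensity N) with hγ
  have hγ0 : γ ≠ 0 := (ENNReal.ofReal_pos.2 hcpos).ne'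
  have hγt : γ ≠ ∞ := ENNReal.ofReal_ne_top
  have hwm : Measurable fun U : {e // A e} → UN N => weight β (extOne A U) :=
    (measurable_weight β).comp (continuous_extOne A).measurable
  have hle : chartMeasure c r ≤ γ⁻¹ • haarUN N := by
    refine Measure.le_iff.2 fun t ht => ?_
    rw [Measure.smul_apply, chartMeasure_apply _ _ ht, smul_eq_mul, ← ENNReal.mul_le_iff_le_inv hγ0 hγt]
    have h1 := hlow (t.indicator 1) (measurable_one.indicator ht)
    rw [lintegral_indicator_one ht] at h1
    refine le_trans (mul_le_mul_right ?_ _) h1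
    exact lintegral_mono_set (cube_mono (hrr.trans (min_le_right _ _)))
  have hpi := Measure.pi_le_smul_pi (ι := {e // A e}) (ENNReal.inv_ne_zero.2 hγt)
    (ENNReal.inv_ne_top.2 hγ0) hle
  have h1 : ∫⁻ θ : {e // A e} → c.ι → ℝ in {θ | ∀ k, θ k ∈ cube c.ι r},
      weight β (extOne A fun e => c.toUN (θ e)) ≤ (γ⁻¹) ^ k * fixedZ N A β := by
    rw [← lintegral_pi_chartMeasure c r _ hwm]
    refine (lintegral_mono' hpi le_rfl).trans ?_
    rw [lintegral_smul_measure, smul_eq_mul]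
    exact le_rfl
  have h2 : ENNReal.ofReal (Real.exp (-(β * (P * (C * r ^ 3))))) *
      ∫⁻ θ : {e // A e} → c.ι → ℝ in {θ | ∀ k, θ k ∈ cube c.ι r},
        ENNReal.ofReal (Real.exp (-(β * ∑ a, curlForm A (fun e => θ e a) / 2))) ≤
      ∫⁻ θ : {e // A e} → c.ι → ℝ in {θ | ∀ k, θ k ∈ cube c.ι r},
        weight β (extOne A fun e => c.toUN (θ e)) := by
    rw [← lintegral_const_mul' _ _ ENNReal.ofReal_ne_top]
    refine setLIntegral_mono' (measurableSet_forall_mem_cube r) fun θ hθ => ?_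
    have h3 := hact A r hr (hrr.trans (min_le_left _ _)) θ hθ
    rw [← ENNReal.ofReal_mul (Real.exp_pos _).le, ← Real.exp_add]
    refine ENNReal.ofReal_le_ofReal (Real.exp_le_exp.2 ?_)
    have h4 := mul_le_mul_of_nonneg_left (abs_le.1 h3).2 hβ.le
    rw [mul_sub] at h4
    linarith
  rw [ENNReal.ofReal_mul (pow_nonneg hcpos.le _), ENNReal.ofReal_mul (Real.exp_pos _).le,
    ENNReal.ofReal_pow hcpos.le, ← hγ]
  calc γ ^ k * _ ≤ γ ^ k * ((γ⁻¹) ^ k * fixedZ N A β) := by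
        refine mul_le_mul_right ?_ _
        refine le_trans (mul_le_mul_right hhalf _) (h2.trans h1)
    _ = fixedZ N A β := by
        rw [← mul_assoc, ← mul_pow, ENNReal.mul_inv_cancel hγ0 hγt, one_pow, one_mul]

/-- A lower bound for the Haar measure of small balls. -/
theorem exists_le_haarUN_ball {N : ℕ} (hN : 1 ≤ N) : ∃ b ρ₀ : ℝ, 0 < b ∧ 0 < ρ₀ ∧ ∀ ρ, 0 ≤ ρ → ρ ≤ ρ₀ →
    ENNReal.ofReal ((b * ρ) ^ (N ^ 2)) ≤ haarUN N {U | udist U ≤ ρ} := by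
  have c := HaarChart.std N
  obtain ⟨C, r₁, hC, hr₁, happ⟩ := c.approx
  obtain ⟨r₂, hr₂, hlow⟩ := c.lower (1 / 2) (by norm_num) (by norm_num)
  set L : ℝ := N + C with hL
  have hL0 : 0 < L := by positivity
  set h := 1 / 2 * haarDensity N
  have hh : 0 < h := mul_pos (by norm_num) (haarDensity_pos N)
  -- The chart maps the cube of half-side ρ/L into the ball, and this cube has volume (2ρ/L)^(N²).
  -- The factor h enters the power as min 1 h, which is legitimate since N² ≥ 1.
  refine ⟨min 1 h * (2 / L), L * min 1 (min r₁ r₂), by positivity, by positivity,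
    fun ρ hρ hρ' => ?_⟩
  set r := ρ / L with hr
  have hr0 : 0 ≤ r := by positivity
  have hrr : r ≤ min 1 (min r₁ r₂) := by rw [hr, div_le_iff₀' hL0]; exact hρ'
  have hr1 : r ≤ 1 := hrr.trans (min_le_left _ _)
  have hm : MeasurableSet {U : UN N | udist U ≤ ρ} :=
    measurableSet_le continuous_udist.measurable measurable_const
  have h1 := hlow ({U | udist U ≤ ρ}.indicator 1) (measurable_one.indicator hm)
  rw [lintegral_indicator_one hm] at h1
  refine le_trans ?_ h1
  have h2 : volume (cube c.ι r) ≤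
      ∫⁻ θ in cube c.ι r₂, {U | udist U ≤ ρ}.indicator 1 (c.toUN θ) := by
    rw [← lintegral_indicator_one (measurableSet_cube r), ← lintegral_indicator (measurableSet_cube _)]
    refine lintegral_mono fun θ => ?_
    refine Set.indicator_apply_le' (fun hθ => ?_) fun _ => zero_le
    have hθ2 : θ ∈ cube c.ι r₂ :=
      cube_mono (hrr.trans ((min_le_right _ _).trans (min_le_right _ _))) hθ
    have hu : c.toUN θ ∈ {U : UN N | udist U ≤ ρ} := by
      have e1 := happ r hr0 (hrr.trans ((min_le_right _ _).trans (min_le_left _ _))) θ hθ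
      have e2 := c.hs_lin_le hr0 hθ
      have e3 := hs_add_le ((c.toUN θ : Matrix (Fin N) (Fin N) ℂ) - 1 - c.lin θ) (c.lin θ)
      rw [sub_add_cancel] at e3
      change hs _ ≤ ρ
      have e4 : C * r ^ 2 ≤ C * r := by gcongr; nlinarith
      have e5 : L * r = ρ := by rw [hr]; field_simp
      rw [hL] at e5
      linarith
    rw [Set.indicator_of_mem hθ2, Set.indicator_of_mem hu]
    exact le_rfl
  refine le_trans ?_ (mul_le_mul_right h2 _)
  have hvol : volume (cube c.ι r) = ENNReal.ofReal ((2 * r) ^ (N ^ 2)) := by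
    rw [cube_eq_pi, volume_pi_pi]
    simp only [Real.volume_Icc, sub_neg_eq_add, ← two_mul, Finset.prod_const, Finset.card_univ,
      c.card_eq]
    rw [ENNReal.ofReal_pow (by positivity)]
  rw [hvol, ← ENNReal.ofReal_mul hh.le]
  refine ENNReal.ofReal_le_ofReal ?_
  have e6 : min 1 h * (2 / L) * ρ = min 1 h * (2 * r) := by rw [hr]; ring
  rw [e6, mul_pow]
  gcongr
  calc min 1 h ^ (N ^ 2) ≤ min 1 h ^ 1 := by
        refine pow_le_pow_of_le_one (by positivity) (min_le_left _ _) ?_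
        exact Nat.one_le_iff_ne_zero.2 (by positivity)
    _ ≤ h := by rw [pow_one]; exact min_le_right _ _

end SingleBox

end LatticeGauge

end

noncomputable section

open scoped ENNReal NNReal

namespace LatticeGauge

/-! ### Comparison of the partition functions of a box and of its blocks -/

section Compare

variable {d m n q N : ℕ} (h : m * q ≤ n)

theorem holonomy_shiftPlaq (U : Config N (box d n)) (b : Fin d → Fin q)
    (p : plaquettes (box d m)) :
    holonomy U (shiftPlaq h b p) = holonomy (fun e => U (shiftEdge h b e)) p := by
  simp only [holonomy, edge₁_shiftPlaq, edge₂_shiftPlaq, edge₃_shiftPlaq, edge₄_shiftPlaq]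

/-- The edges lying in some block. -/
def blockEdgeEquiv : (Fin d → Fin q) × edges (box d m) ≃
    {e : edges (box d n) // e ∈ Set.range fun z : (Fin d → Fin q) × edges (box d m) =>
      shiftEdge h z.1 z.2} :=
  Equiv.ofInjective _ (shiftEdge_injective h)

theorem prod_weight (β : ℝ) {B : Type*} [Fintype B] {Λ : Finset (Site d)} (U : B → Config N Λ) :
    ∏ b, weight β (U b) = ENNReal.ofReal (Real.exp (-(β * ∑ b, wilsonAction (U b)))) := by
  unfold weight
  rw [← ENNReal.ofReal_prod_of_nonneg fun _ _ => (Real.exp_pos _).le, ← Real.exp_sum,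
    Finset.mul_sum, Finset.sum_neg_distrib]

/-- The action is a sum of nonnegative terms, so plaquettes outside the blocks may be dropped. The
blocks share no edge, so the integral factors, and each block can afterwards be put in its own axial
gauge. -/
theorem lintegral_weight_le_pow (h : m * q ≤ n) {β : ℝ} (hβ : 0 ≤ β) :
    ∫⁻ U : Config N (box d n), weight β U ∂(Measure.pi fun _ => haarUN N) ≤
      (∫⁻ U : Config N (box d m), weight β U ∂(Measure.pi fun _ => haarUN N)) ^ (q ^ d) := by
  classical
  have h1 := lintegral_pi_blocks (haarUN N) _ (blockEdgeEquiv h) _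
    (measurable_weight (N := N) (Λ := box d m) β) (fun _ => 1) measurable_const
  have hcard : Fintype.card (Fin d → Fin q) = q ^ d := by simp
  simp only [Finset.prod_const_one, mul_one, lintegral_const, measure_univ, one_pow] at h1
  rw [← hcard, ← h1]
  refine lintegral_mono fun U => ?_
  rw [prod_weight]
  refine ENNReal.ofReal_le_ofReal (Real.exp_le_exp.2 ?_)
  have h2 := sum_blocks_le_sum_plaquettes h (fun p => phi (holonomy U p)) fun p => phi_nonneg _
  simp only [holonomy_shiftPlaq] at h2
  have h3 := mul_le_mul_of_nonneg_left h2 hβ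
  exact neg_le_neg h3

theorem hs_mul_sub_mul_le (a b a' b' : UN N) :
    hs (a.1 * b.1 - a'.1 * b'.1) ≤ hs (a.1 - a'.1) + hs (b.1 - b'.1) := by
  have h1 : a.1 * b.1 - a'.1 * b'.1 = (a.1 - a'.1) * b.1 + a'.1 * (b.1 - b'.1) := by
    noncomm_ring
  rw [h1]
  refine (hs_add_le _ _).trans (le_of_eq ?_)
  rw [hs_mul_unitary, hs_unitary_mul]

/-- Moving four edges by at most ρ moves the holonomy by at most 4ρ, and (x + 4ρ)² ≤ (1 + δ)x² + (1
+ 1/δ)16ρ². The multiplicative loss is harmless, as it amounts to a change of β. -/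
theorem phi_holonomy_le {Λ : Finset (Site d)} (U U' : Config N Λ) {ρ δ : ℝ} (hδ : 0 < δ)
    (hU : ∀ e, hs ((U e).1 - (U' e).1) ≤ ρ) (p : plaquettes Λ) :
    phi (holonomy U p) ≤ (1 + δ) * phi (holonomy U' p) + (1 + 1 / δ) * (8 * ρ ^ 2) := by
  rw [phi_eq, phi_eq]
  have hx : udist (holonomy U p) ≤ udist (holonomy U' p) + 4 * ρ := by
    simp only [holonomy, udist_plaquette]
    have h1 := hs_mul_sub_mul_le (U (Plaquette.edge₁ p)) (U (Plaquette.edge₂ p))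
      (U' (Plaquette.edge₁ p)) (U' (Plaquette.edge₂ p))
    have h2 := hs_mul_sub_mul_le (U (Plaquette.edge₄ p)) (U (Plaquette.edge₃ p))
      (U' (Plaquette.edge₄ p)) (U' (Plaquette.edge₃ p))
    have h3 : ∀ x y x' y' : Matrix (Fin N) (Fin N) ℂ,
        hs (x - y) ≤ hs (x' - y') + (hs (x - x') + hs (y - y')) := by
      intro x y x' y'
      have e : x - y = (x' - y') + ((x - x') - (y - y')) := by abel
      rw [e]
      exact (hs_add_le _ _).trans (add_le_add_right (hs_sub_le _ _) _)
    have h4 := h3 ((U (Plaquette.edge₁ p)).1 * (U (Plaquette.edge₂ p)).1)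
      ((U (Plaquette.edge₄ p)).1 * (U (Plaquette.edge₃ p)).1)
      ((U' (Plaquette.edge₁ p)).1 * (U' (Plaquette.edge₂ p)).1)
      ((U' (Plaquette.edge₄ p)).1 * (U' (Plaquette.edge₃ p)).1)
    linarith [hU (Plaquette.edge₁ p), hU (Plaquette.edge₂ p), hU (Plaquette.edge₃ p),
      hU (Plaquette.edge₄ p)]
  have h0 := udist_nonneg (holonomy U p)
  set x := udist (holonomy U' p)
  have h1 : udist (holonomy U p) ^ 2 ≤ (x + 4 * ρ) ^ 2 := by gcongr
  have h2 : (x + 4 * ρ) ^ 2 ≤ (1 + δ) * x ^ 2 + (1 + 1 / δ) * (16 * ρ ^ 2) := by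
    have h3 : (1 + δ) * x ^ 2 + (1 + 1 / δ) * (16 * ρ ^ 2) - (x + 4 * ρ) ^ 2 =
        (δ * x - 4 * ρ) ^ 2 / δ := by field_simp; ring
    have h4 : 0 ≤ (δ * x - 4 * ρ) ^ 2 / δ := by positivity
    linarith
  linarith

theorem extOne_shiftEdge (V : {e : edges (box d n) // IsBlockInterior h e} → UN N)
    (b : Fin d → Fin q) (e : edges (box d m)) :
    extOne _ V (shiftEdge h b e) = extOne IsInterior (fun k => V (blockEquiv h (b, k))) e := by
  by_cases he : IsInterior e
  · rw [extOne_of_pos _ he, extOne_of_pos _ ((isBlockInterior_shiftEdge_iff h b e).2 he)]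
    rfl
  · rw [extOne_of_neg _ he, extOne_of_neg]
    rwa [isBlockInterior_shiftEdge_iff]

theorem wilsonAction_blockInterior_le
    (V : {e : edges (box d n) // IsBlockInterior h e} → UN N) :
    wilsonAction (extOne (IsBlockInterior h) V) ≤ ∑ b : Fin d → Fin q,
      wilsonAction (extOne (IsInterior (m := m)) fun k => V (blockEquiv h (b, k))) := by
  refine (sum_plaquettes_le_sum_blocks h
    (fun p => phi (holonomy (extOne (IsBlockInterior h) V) p)) fun p hp => ?_).trans_eq ?_
  · simp only [Touches, not_or] at hp
    rw [holonomy, extOne_of_neg _ hp.1, extOne_of_neg _ hp.2.1,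
      extOne_of_neg _ hp.2.2.1, extOne_of_neg _ hp.2.2.2, phi_eq]
    simp [udist_one]
  · refine Finset.sum_congr rfl fun b _ => Finset.sum_congr rfl fun p _ => ?_
    rw [holonomy_shiftPlaq]
    simp only [extOne_shiftEdge]

/-- Replacing the values outside the block interiors by the identity moves every edge by at most ρ,
after which the blocks no longer interact. -/
theorem wilsonAction_free_le (V : FreeEdge d n → UN N) {ρ δ : ℝ} (hρ : 0 ≤ ρ) (hδ : 0 < δ)
    (hV : ∀ e : FreeEdge d n, ¬ IsBlockInterior h e.1 → udist (V e) ≤ ρ) :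
    wilsonAction (extOne (fun e : edges (box d n) => ¬ IsAxial e.1) V) ≤
      (1 + δ) * (∑ b : Fin d → Fin q, wilsonAction (extOne (IsInterior (m := m)) fun k =>
        V ⟨(blockEquiv h (b, k)).1, (blockEquiv h (b, k)).2.not_isAxial⟩)) +
      Fintype.card (plaquettes (box d n)) * ((1 + 1 / δ) * (8 * ρ ^ 2)) := by
  have h1 := wilsonAction_blockInterior_le h
    (fun e : {e : edges (box d n) // IsBlockInterior h e} => V ⟨e.1, e.2.not_isAxial⟩)
  set V' : Config N (box d n) := extOne (IsBlockInterior h)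
    (fun e : {e : edges (box d n) // IsBlockInterior h e} => V ⟨e.1, e.2.not_isAxial⟩) with hV'
  have hdiff : ∀ e, hs ((extOne (fun e : edges (box d n) => ¬ IsAxial e.1) V e).1 -
      (V' e).1) ≤ ρ := by
    intro e
    by_cases he : IsBlockInterior h e
    · rw [hV', extOne_of_pos _ he, extOne_of_pos _ (he.not_isAxial)]
      simpa [hs_zero] using hρ
    · rw [hV', extOne_of_neg _ he]
      by_cases hax : ¬ IsAxial e.1
      · rw [extOne_of_pos _ hax]
        exact hV ⟨e, hax⟩ he
      · rw [extOne_of_neg _ hax]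
        simpa [hs_zero] using hρ
  calc wilsonAction (extOne (fun e : edges (box d n) => ¬ IsAxial e.1) V)
      ≤ ∑ p, ((1 + δ) * phi (holonomy V' p) + (1 + 1 / δ) * (8 * ρ ^ 2)) :=
        Finset.sum_le_sum fun p _ => phi_holonomy_le _ _ hδ hdiff p
    _ = (1 + δ) * wilsonAction V' +
        Fintype.card (plaquettes (box d n)) * ((1 + 1 / δ) * (8 * ρ ^ 2)) := by
        rw [Finset.sum_add_distrib, ← Finset.mul_sum, Finset.sum_const, nsmul_eq_mul,
          Finset.card_univ]
        rfl
    _ ≤ _ := by gcongr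

/-- The integral is restricted to configurations whose frozen edges lie within ρ of the identity. It
then factors into blocks with identity boundary values at inverse coupling β(1 + δ), and one ball
volume per frozen edge. -/
theorem le_fixedZ_free (h : m * q ≤ n) {β ρ δ : ℝ} (hβ : 0 ≤ β) (hρ : 0 ≤ ρ) (hδ : 0 < δ) :
    ENNReal.ofReal (Real.exp (-(β * (Fintype.card (plaquettes (box d n)) *
        ((1 + 1 / δ) * (8 * ρ ^ 2)))))) *
      (fixedZ N (IsInterior (d := d) (m := m)) (β * (1 + δ)) ^ (q ^ d) *
        haarUN N {U | udist U ≤ ρ} ^ (Fintype.card (FreeEdge d n) -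
          q ^ d * Fintype.card {e : edges (box d m) // IsInterior e})) ≤
      fixedZ N (fun e : edges (box d n) => ¬ IsAxial e.1) β := by
  set D := {U : UN N | udist U ≤ ρ}
  have hDm : MeasurableSet D := measurableSet_le continuous_udist.measurable measurable_const
  let ε : (Fin d → Fin q) × {e : edges (box d m) // IsInterior e} ≃
      {e : FreeEdge d n // IsBlockInterior h e.1} :=
    (blockEquiv h).trans (Equiv.subtypeSubtypeEquivSubtype
      (p := fun e : edges (box d n) => ¬ IsAxial e.1) (q := IsBlockInterior h)
      fun he => he.not_isAxial).symm
  have hwm : Measurable fun V : {e : edges (box d m) // IsInterior e} → UN N =>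
      weight (β * (1 + δ)) (extOne IsInterior V) :=
    (measurable_weight _).comp (continuous_extOne _).measurable
  have h1 := lintegral_pi_blocks (haarUN N) (fun e : FreeEdge d n => IsBlockInterior h e.1) ε _ hwm
    (D.indicator 1) (measurable_one.indicator hDm)
  have hcard : Fintype.card (Fin d → Fin q) = q ^ d := by simp
  rw [lintegral_indicator_one hDm, hcard] at h1
  change _ = fixedZ N (IsInterior (d := d) (m := m)) (β * (1 + δ)) ^ _ * _ at h1
  rw [← h1, ← lintegral_const_mul' _ _ ENNReal.ofReal_ne_top]
  refine lintegral_mono fun V => ?_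
  by_cases hV : ∀ e : FreeEdge d n, ¬ IsBlockInterior h e.1 → udist (V e) ≤ ρ
  · have h2 : ∏ i : {e : FreeEdge d n // ¬ IsBlockInterior h e.1}, D.indicator (1 : UN N → ℝ≥0∞) (V i) = 1 := by
      refine Finset.prod_eq_one fun i _ => ?_
      have : V i ∈ D := hV i.1 i.2
      rw [Set.indicator_of_mem this]; rfl
    rw [h2, mul_one, prod_weight, ← ENNReal.ofReal_mul (Real.exp_pos _).le, ← Real.exp_add]
    refine ENNReal.ofReal_le_ofReal (Real.exp_le_exp.2 ?_)
    have h3 := mul_le_mul_of_nonneg_left (wilsonAction_free_le h V hρ hδ hV) hβ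
    have h4 : ∀ b k, V (ε (b, k)).1 =
        V ⟨(blockEquiv h (b, k)).1, (blockEquiv h (b, k)).2.not_isAxial⟩ := fun _ _ => rfl
    simp only [h4]
    linarith
  · push Not at hV
    obtain ⟨e, he, hlt⟩ := hV
    have h2 : ∏ i : {e : FreeEdge d n // ¬ IsBlockInterior h e.1}, D.indicator (1 : UN N → ℝ≥0∞) (V i) = 0 := by
      refine Finset.prod_eq_zero (Finset.mem_univ ⟨e, he⟩) (Set.indicator_of_notMem ?_ _)
      exact not_le.2 hlt
    rw [h2, mul_zero, mul_zero]
    exact zero_le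

end Compare

end LatticeGauge

end

noncomputable section

open scoped ENNReal NNReal

namespace LatticeGauge

/-! ### Asymptotics of the partition function of a box of side a small power of `β` -/

section SingleBoxAsymptotics

/-- The logarithm of the Gaussian normalization of the Haar measure. -/
def logConst (N : ℕ) : ℝ := Real.log (haarDensity N) + (N : ℝ) ^ 2 / 2 * Real.log (2 * Real.pi)

/-- The cost per free edge. -/
def edgeCost (N : ℕ) (β : ℝ) : ℝ := (N : ℝ) ^ 2 / 2 * Real.log β - logConst N

theorem log_gaussian_mass (N k : ℕ) {c β D : ℝ} (hc : 0 < c) (hβ : 0 < β) (hD : 0 < D) :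
    Real.log (c ^ k * Real.sqrt ((2 * Real.pi / β) ^ k / D) ^ (N ^ 2)) =
      k * (Real.log c + (N : ℝ) ^ 2 / 2 * Real.log (2 * Real.pi) - (N : ℝ) ^ 2 / 2 * Real.log β) -
        (N : ℝ) ^ 2 / 2 * Real.log D := by
  rw [Real.log_mul (by positivity) (by positivity), Real.log_pow, Real.log_pow,
    Real.log_sqrt (by positivity), Real.log_div (by positivity) hD.ne', Real.log_pow,
    Real.log_div (by positivity) hβ.ne']
  push_cast
  ring

theorem log_gaussian_mass_eq (N k : ℕ) {β D : ℝ} (hβ : 0 < β) (hD : 0 < D) :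
    Real.log (haarDensity N ^ k * Real.sqrt ((2 * Real.pi / β) ^ k / D) ^ (N ^ 2)) =
      -(k * edgeCost N β) - (N : ℝ) ^ 2 / 2 * Real.log D := by
  rw [log_gaussian_mass N k (haarDensity_pos N) hβ hD, edgeCost, logConst]
  ring

theorem log_succ_le (m : ℕ) : Real.log (m + 1) ≤ m := by
  have := Real.log_le_sub_one_of_pos (show (0 : ℝ) < m + 1 by positivity)
  linarith

theorem abs_edgeCost_le (N : ℕ) {m : ℕ} {β : ℝ} (h1 : 1 ≤ β) (h2 : β ≤ ((m : ℝ) + 1) ^ 60) :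
    |edgeCost N β| ≤ 30 * (N : ℝ) ^ 2 * Real.log (m + 1) + |logConst N| := by
  have h3 : Real.log β ≤ 60 * Real.log (m + 1) := by
    have := Real.log_le_log (by linarith) h2
    rwa [Real.log_pow] at this
  have h4 := Real.log_nonneg h1
  rw [edgeCost]
  refine (abs_sub _ _).trans ?_
  rw [abs_of_nonneg (by positivity : 0 ≤ (N : ℝ) ^ 2 / 2 * Real.log β)]
  have : (N : ℝ) ^ 2 / 2 * Real.log β ≤ (N : ℝ) ^ 2 / 2 * (60 * Real.log (m + 1)) := by gcongr
  linarith

variable {d m : ℕ}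

theorem pow_dim_le (hd3 : d ≤ 3) (hm : 1 ≤ m) : (m : ℝ) ^ d ≤ m ^ 3 :=
  pow_le_pow_right₀ (by exact_mod_cast hm) hd3

theorem card_plaquettes_le_real (hd3 : d ≤ 3) :
    (Fintype.card (plaquettes (box d m)) : ℝ) ≤ 9 * (m : ℝ) ^ d := by
  have h1 : (Fintype.card (plaquettes (box d m)) : ℝ) ≤ m ^ d * (d * d) := by
    exact_mod_cast card_plaquettes_le (d := d) (n := m)
  have h2 : (d : ℝ) ≤ 3 := by exact_mod_cast hd3
  have h3 : (d : ℝ) * d ≤ 9 := by nlinarith [Nat.cast_nonneg (α := ℝ) d]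
  have h4 : (0 : ℝ) ≤ (m : ℝ) ^ d := by positivity
  nlinarith

theorem card_freeEdge_le_real (hd3 : d ≤ 3) :
    (Fintype.card (FreeEdge d m) : ℝ) ≤ 2 * (m : ℝ) ^ d := by
  have h1 : (Fintype.card (FreeEdge d m) : ℝ) ≤ m ^ d * (d - 1 : ℕ) := by
    exact_mod_cast card_freeEdge_le (d := d) (n := m)
  have h2 : ((d - 1 : ℕ) : ℝ) ≤ 2 := by exact_mod_cast (by omega : d - 1 ≤ 2)
  have h4 : (0 : ℝ) ≤ (m : ℝ) ^ d := by positivity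
  nlinarith

theorem card_isInterior_le_free :
    Fintype.card {e : edges (box d m) // IsInterior e} ≤ Fintype.card (FreeEdge d m) :=
  Fintype.card_le_of_injective (fun e => ⟨e.1, e.2.not_isAxial⟩) fun _ _ h =>
    Subtype.ext (congrArg (fun z : FreeEdge d m => z.1) h)

theorem eventually_natCast_ge (K : ℝ) : ∀ᶠ m : ℕ in atTop, K ≤ m :=
  tendsto_natCast_atTop_atTop.eventually_ge_atTop K

theorem add_one_pow_sixty_le (hm : 1 ≤ m) : ((m : ℝ) + 1) ^ 60 ≤ 2 ^ 60 * (m : ℝ) ^ 60 := by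
  rw [← mul_pow]
  have : (1 : ℝ) ≤ m := by exact_mod_cast hm
  gcongr
  linarith

/-- Here x is the side m, k the number of free edges, Y the edge cost and D the log determinant. The
Gaussian exponent has lower degree in m than βs²/2 ≥ m^10/2, so the tail in `exists_fixedZ_le` is
dominated by the main term. -/
theorem cost_le_half_pow {x k Y c ν D : ℝ} (hx : 2 ≤ x) (hk0 : 0 ≤ k) (hk : k ≤ 2 * x ^ 3)
    (hY : |Y| ≤ 30 * ν ^ 2 * x + |c|) (hD : D ≤ k * 48) (h : 4 * (54 * ν ^ 2 + |c|) ≤ x) :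
    k * Y + ν ^ 2 / 2 * D ≤ x ^ 10 / 2 := by
  have hc := abs_nonneg c
  have h1 : k * Y ≤ k * (30 * ν ^ 2 * x + |c|) :=
    mul_le_mul_of_nonneg_left ((le_abs_self _).trans hY) hk0
  have h2 : ν ^ 2 / 2 * D ≤ ν ^ 2 / 2 * (k * 48) := mul_le_mul_of_nonneg_left hD (by positivity)
  have h3 : 30 * ν ^ 2 * x + |c| + 24 * ν ^ 2 ≤ x * (54 * ν ^ 2 + |c|) := by
    nlinarith [sq_nonneg ν]
  have h4 : k * Y + ν ^ 2 / 2 * D ≤ k * (x * (54 * ν ^ 2 + |c|)) := by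
    have := mul_le_mul_of_nonneg_left h3 hk0
    linarith
  have h5 : k * (x * (54 * ν ^ 2 + |c|)) ≤ (2 * x ^ 3) * (x * (x / 4)) := by
    refine mul_le_mul hk ?_ (by positivity) (by positivity)
    exact mul_le_mul_of_nonneg_left (by linarith) (by linarith)
  have h6 : x ^ 5 ≤ x ^ 10 := pow_le_pow_right₀ (by linarith) (by norm_num)
  nlinarith

/-- Here G is β times the gap times r², at least of order m^7, whereas √(2^k)^(N²) has a logarithm
of order m³ only; l is log 2. -/
theorem tail_exponent_le {x k ν l G : ℝ} (hx : 1 ≤ x) (hl0 : 0 ≤ l) (hl1 : l ≤ 1)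
    (hk : k ≤ 2 * x ^ 3) (hG : x ^ 7 / 27 ≤ G) (h : 108 * (ν ^ 2 + 1) ≤ x) :
    -(G / 4) + ν ^ 2 * (k * l / 2) ≤ -l := by
  have hx3 : (1 : ℝ) ≤ x ^ 3 := one_le_pow₀ hx
  have h1 : k * l ≤ 2 * x ^ 3 := by
    calc k * l ≤ 2 * x ^ 3 * l := mul_le_mul_of_nonneg_right hk hl0
      _ ≤ 2 * x ^ 3 * 1 := mul_le_mul_of_nonneg_left hl1 (by positivity)
      _ = _ := mul_one _
  have h4 : ν ^ 2 * (k * l / 2) ≤ ν ^ 2 * x ^ 3 :=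
    mul_le_mul_of_nonneg_left (by linarith) (sq_nonneg ν)
  have h6 : 108 * (ν ^ 2 + 1) * x ^ 3 ≤ x ^ 7 := by
    calc _ ≤ x * x ^ 3 := mul_le_mul_of_nonneg_right h (by positivity)
      _ = x ^ 4 := by ring
      _ ≤ _ := pow_le_pow_right₀ hx (by norm_num)
  linarith

set_option maxHeartbeats 1000000 in
theorem eventually_fixedZ_le (hd : 2 ≤ d) (hd3 : d ≤ 3) (N : ℕ) :
    ∀ᶠ m : ℕ in atTop, ∀ β : ℝ, (m : ℝ) ^ 60 ≤ β → β ≤ ((m : ℝ) + 1) ^ 60 →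
      fixedZ N (fun e : edges (box d m) => ¬ IsAxial e.1) β ≤
        ENNReal.ofReal (Real.exp (-(Fintype.card (FreeEdge d m) * edgeCost N β) -
          (N : ℝ) ^ 2 / 2 * (m ^ d * logDet d m) + 1)) := by
  obtain ⟨C, L, s₀, hC, hL, hs₀, hZ⟩ := exists_fixedZ_le N
  filter_upwards [eventually_ge_atTop 1, eventually_natCast_ge (3 / s₀),
    eventually_natCast_ge (4 * (2 ^ 60 * 9 * (C * (3 * L) ^ 3))),
    eventually_natCast_ge (4 * (54 * (N : ℝ) ^ 2 + |logConst N|)),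
    eventually_ge_atTop 2] with m hm1 hm2 hm3 hm4 hm5 β hβ1 hβ2
  have hm : (1 : ℝ) ≤ m := by exact_mod_cast hm1
  have hm0 : (0 : ℝ) < m := by linarith
  have hβ : 1 ≤ β := (one_le_pow₀ hm).trans hβ1
  have hβ0 : 0 < β := by linarith
  have hd0 : 0 < d := by omega
  have hdR : (d : ℝ) ≤ 3 := by exact_mod_cast hd3
  have hA : ∀ e : edges (box d m), ¬ IsAxial e.1 → ¬ IsAxial e.1 := fun _ h => h
  -- With this exponent βs² ≥ m^10 makes the tail negligible, while the cubic error β·m³·(ms)³ is of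
  -- order m^(60+3−72) = m^(−9).
  set s : ℝ := 1 / (m : ℝ) ^ 25 with hs
  have hs0 : 0 ≤ s := by positivity
  have hσ : d * m * s ≤ 3 / (m : ℝ) ^ 24 := by
    have : d * m * s = d / (m : ℝ) ^ 24 := by rw [hs]; field_simp
    rw [this]; gcongr
  have hσ1 : d * m * s ≤ s₀ := by
    refine hσ.trans ?_
    rw [div_le_iff₀ hs₀] at hm2
    rw [div_le_iff₀ (by positivity)]
    have : (m : ℝ) ≤ (m : ℝ) ^ 24 := le_self_pow₀ hm (by norm_num)
    nlinarith
  have hdet := (posDef_curlMat (A := fun e : edges (box d m) => ¬ IsAxial e.1) hd0 hm1 hA).det_pos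
  have hlogdet := log_det_curlMat_le (A := fun e : edges (box d m) => ¬ IsAxial e.1) hd0 hm1 hA
  have hlogdet' : Real.log (curlMat fun e : edges (box d m) => ¬ IsAxial e.1).det =
      m ^ d * logDet d m := by
    rw [logDet]; field_simp
  refine (hZ (fun e : edges (box d m) => ¬ IsAxial e.1) hd0 hm1 hA β s hβ0 hs0 hσ1).trans ?_
  have hk := card_freeEdge_le_real (m := m) hd3
  have hP := card_plaquettes_le_real (m := m) hd3
  have hmass := log_gaussian_mass_eq N (Fintype.card (FreeEdge d m)) hβ0 hdet
  have hY := abs_edgeCost_le N hβ hβ2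
  rw [hlogdet'] at hmass
  rw [hlogdet'] at hlogdet
  have hpos : 0 < haarDensity N ^ Fintype.card (FreeEdge d m) * Real.sqrt ((2 * Real.pi / β) ^
      Fintype.card (FreeEdge d m) / (curlMat fun e : edges (box d m) => ¬ IsAxial e.1).det) ^
        (N ^ 2) := by
    refine mul_pos (pow_pos (haarDensity_pos N) _) (pow_pos (Real.sqrt_pos.2 (div_pos
      (pow_pos (by positivity) _) hdet)) _)
  set k := Fintype.card (FreeEdge d m)
  set P := Fintype.card (plaquettes (box d m))
  set Gp := Real.sqrt ((2 * Real.pi / β) ^ k /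
    (curlMat fun e : edges (box d m) => ¬ IsAxial e.1).det) ^ (N ^ 2)
  set X := -(k * edgeCost N β) - (N : ℝ) ^ 2 / 2 * (m ^ d * logDet d m) with hX
  have hGX : haarDensity N ^ k * Gp = Real.exp X := by rw [← hmass, Real.exp_log hpos]
  clear_value Gp k P
  have hm3d := pow_dim_le hd3 hm1
  have hv : β * (P * (C * (L * (d * m * s)) ^ 3)) ≤ 1 / 4 := by
    calc β * (P * (C * (L * (d * m * s)) ^ 3))
        ≤ (2 ^ 60 * (m : ℝ) ^ 60) * ((9 * (m : ℝ) ^ 3) * (C * (L * (3 / (m : ℝ) ^ 24)) ^ 3)) := by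
          have := hβ2.trans (add_one_pow_sixty_le hm1)
          have h9 : (P : ℝ) ≤ 9 * (m : ℝ) ^ 3 := hP.trans (by gcongr)
          gcongr
      _ = (2 ^ 60 * 9 * (C * (3 * L) ^ 3)) / (m : ℝ) ^ 9 := by field_simp
      _ ≤ 1 / 4 := by
          rw [div_le_iff₀ (by positivity)]
          have : (m : ℝ) ≤ (m : ℝ) ^ 9 := le_self_pow₀ hm (by norm_num)
          linarith
  have hu : -(β * (s ^ 2 / 2)) ≤ X := by
    have h1 : (m : ℝ) ^ 10 / 2 ≤ β * (s ^ 2 / 2) := by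
      calc (m : ℝ) ^ 10 / 2 = (m : ℝ) ^ 60 * (s ^ 2 / 2) := by rw [hs]; field_simp
        _ ≤ _ := by gcongr
    have hkm : (k : ℝ) ≤ 2 * (m : ℝ) ^ 3 := hk.trans (by gcongr)
    have h2 : |edgeCost N β| ≤ 30 * (N : ℝ) ^ 2 * m + |logConst N| :=
      hY.trans (add_le_add_left (mul_le_mul_of_nonneg_left (log_succ_le m) (by positivity)) _)
    have h3 : m ^ d * logDet d m ≤ k * 48 := by
      refine hlogdet.trans (mul_le_mul_of_nonneg_left ?_ (Nat.cast_nonneg k))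
      exact (Real.log_le_self (by positivity)).trans (by linarith)
    have h4 := cost_le_half_pow (by exact_mod_cast hm5) (Nat.cast_nonneg k) hkm h2 h3 hm4
    rw [hX]
    linarith
  refine ENNReal.ofReal_le_ofReal ?_
  calc Real.exp (-(β * (s ^ 2 / 2))) + haarDensity N ^ k *
        (Real.exp (β * (P * (C * (L * (d * m * s)) ^ 3))) * Gp)
      = Real.exp (-(β * (s ^ 2 / 2))) +
        Real.exp (β * (P * (C * (L * (d * m * s)) ^ 3))) * Real.exp X := by rw [← hGX]; ring
    _ ≤ Real.exp X + Real.exp (1 / 4) * Real.exp X := by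
        gcongr
    _ = (1 + Real.exp (1 / 4)) * Real.exp X := by ring
    -- Since 1 + e^(1/4) < e, both losses fit into the summand 1 of the exponent.
    _ ≤ Real.exp 1 * Real.exp X := by
        gcongr
        have h1 := Real.exp_bound_div_one_sub_of_interval (x := 1 / 4) (by norm_num) (by norm_num)
        have h2 := Real.exp_one_gt_d9
        norm_num at h1 h2 ⊢
        linarith
    _ = Real.exp (X + 1) := by rw [← Real.exp_add, add_comm]

set_option maxHeartbeats 1000000 in
theorem eventually_le_fixedZ (hd : 2 ≤ d) (hd3 : d ≤ 3) (N : ℕ) {κ : ℝ} (hκ0 : 0 < κ) (hκ1 : κ < 1) :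
    ∀ᶠ m : ℕ in atTop, ∀ β : ℝ, (m : ℝ) ^ 60 ≤ β → β ≤ 2 * ((m : ℝ) + 1) ^ 60 →
      ENNReal.ofReal (Real.exp (-(Fintype.card {e : edges (box d m) // IsInterior e} *
          (edgeCost N β - Real.log κ)) -
          (N : ℝ) ^ 2 / 2 * Real.log (curlMat (IsInterior (d := d) (m := m))).det - 1)) ≤
        fixedZ N (IsInterior (d := d) (m := m)) β := by
  obtain ⟨C, hC, hZ'⟩ := exists_le_fixedZ N
  obtain ⟨r₀, hr₀, hZ⟩ := hZ' κ hκ0 hκ1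
  filter_upwards [eventually_ge_atTop 1, eventually_natCast_ge (1 / r₀),
    eventually_natCast_ge (4 * (2 ^ 61 * 9 * C)),
    eventually_natCast_ge (108 * ((N : ℝ) ^ 2 + 1))] with m hm1 hm2 hm3 hm4 β hβ1 hβ2
  have hm : (1 : ℝ) ≤ m := by exact_mod_cast hm1
  have hm0 : (0 : ℝ) < m := by linarith
  have hβ : 1 ≤ β := (one_le_pow₀ hm).trans hβ1
  have hβ0 : 0 < β := by linarith
  have hd0 : 0 < d := by omega
  have hdR : (d : ℝ) ≤ 3 := by exact_mod_cast hd3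
  have hA : ∀ e : edges (box d m), IsInterior e → ¬ IsAxial e.1 := fun _ h => h.not_isAxial
  -- The cubic error βm³r³ is of order m^(−9), and as the gap is at least 1/(27m^5), the tail
  -- exponent is at least of order m^(60−5−48) = m^7. The range of β is doubled to allow for the
  -- coupling β(1 + 1/m) of the frozen comparison.
  set r : ℝ := 1 / (m : ℝ) ^ 24 with hr
  have hr0 : 0 ≤ r := by positivity
  have hrr : r ≤ r₀ := by
    rw [div_le_iff₀ hr₀] at hm2
    rw [hr, div_le_iff₀ (by positivity)]
    have : (m : ℝ) ≤ (m : ℝ) ^ 24 := le_self_pow₀ hm (by norm_num)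
    nlinarith
  have hdet := (posDef_curlMat (A := IsInterior (d := d) (m := m)) hd0 hm1 hA).det_pos
  have hk : (Fintype.card {e : edges (box d m) // IsInterior e} : ℝ) ≤ 2 * (m : ℝ) ^ 3 := by
    refine le_trans ?_ ((card_freeEdge_le_real (m := m) hd3).trans
      (mul_le_mul_of_nonneg_left (pow_dim_le hd3 hm1) zero_le_two))
    exact_mod_cast card_isInterior_le_free (d := d) (m := m)
  have hP := (card_plaquettes_le_real (m := m) hd3).trans
    (mul_le_mul_of_nonneg_left (pow_dim_le hd3 hm1) (by norm_num))
  have hmass := log_gaussian_mass N (Fintype.card {e : edges (box d m) // IsInterior e})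
    (mul_pos hκ0 (haarDensity_pos N)) hβ0 hdet
  have hpos : 0 < (κ * haarDensity N) ^ Fintype.card {e : edges (box d m) // IsInterior e} *
      Real.sqrt ((2 * Real.pi / β) ^ Fintype.card {e : edges (box d m) // IsInterior e} /
        (curlMat (IsInterior (d := d) (m := m))).det) ^ (N ^ 2) := by
    refine mul_pos (pow_pos (mul_pos hκ0 (haarDensity_pos N)) _) (pow_pos (Real.sqrt_pos.2 (div_pos
      (pow_pos (by positivity) _) hdet)) _)
  have hmain := hZ (IsInterior (d := d) (m := m)) hd0 hm1 hA β r hβ0 hr0 hrr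
  set k := Fintype.card {e : edges (box d m) // IsInterior e}
  set P := Fintype.card (plaquettes (box d m))
  set Gp := Real.sqrt ((2 * Real.pi / β) ^ k / (curlMat (IsInterior (d := d) (m := m))).det) ^ (N ^ 2)
  set X := -(k * (edgeCost N β - Real.log κ)) -
    (N : ℝ) ^ 2 / 2 * Real.log (curlMat (IsInterior (d := d) (m := m))).det with hX
  have hGX : (κ * haarDensity N) ^ k * Gp = Real.exp X := by
    rw [← Real.exp_log hpos, hmass, Real.log_mul hκ0.ne' (haarDensity_pos N).ne', hX, edgeCost,
      logConst]
    congr 1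
    ring
  clear_value Gp k P
  have hv : β * (P * (C * r ^ 3)) ≤ 1 / 4 := by
    calc β * (P * (C * r ^ 3))
        ≤ (2 ^ 61 * (m : ℝ) ^ 60) * ((9 * (m : ℝ) ^ 3) * (C * r ^ 3)) := by
          have := add_one_pow_sixty_le hm1
          gcongr
          linarith
      _ = (2 ^ 61 * 9 * C) / (m : ℝ) ^ 9 := by rw [hr]; field_simp
      _ ≤ 1 / 4 := by
          rw [div_le_iff₀ (by positivity)]
          have : (m : ℝ) ≤ (m : ℝ) ^ 9 := le_self_pow₀ hm (by norm_num)
          linarith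
  have hgap : (m : ℝ) ^ 7 / 27 ≤ β * (gap d m * r ^ 2) := by
    have h1 : 1 / (27 * (m : ℝ) ^ 5) ≤ gap d m := by
      rw [gap]
      refine one_div_le_one_div_of_le (by positivity) ?_
      calc (m : ℝ) ^ d * d * (d * m) ^ 2 ≤ (m : ℝ) ^ 3 * 3 * (3 * m) ^ 2 := by
            have := pow_dim_le hd3 hm1
            gcongr
        _ = _ := by ring
    calc (m : ℝ) ^ 7 / 27 = (m : ℝ) ^ 60 * (1 / (27 * (m : ℝ) ^ 5) * r ^ 2) := by
          rw [hr]; field_simp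
      _ ≤ _ := by gcongr
  have hsmall : Real.exp (-(β * (gap d m * r ^ 2) / 4)) * Real.sqrt (2 ^ k) ^ (N ^ 2) ≤ 1 / 2 := by
    have h2 : Real.sqrt (2 ^ k) ^ (N ^ 2) = Real.exp ((N : ℝ) ^ 2 * (k * Real.log 2 / 2)) := by
      rw [← Real.exp_log (pow_pos (Real.sqrt_pos.2 (pow_pos two_pos k)) (N ^ 2)), Real.log_pow,
        Real.log_sqrt (pow_pos two_pos k).le, Real.log_pow]
      push_cast
      rfl
    have h3 : (1 / 2 : ℝ) = Real.exp (-Real.log 2) := by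
      rw [Real.exp_neg, Real.exp_log two_pos]; norm_num
    rw [h2, h3, ← Real.exp_add]
    refine Real.exp_le_exp.2 ?_
    have hl0 : 0 ≤ Real.log 2 := Real.log_nonneg (by norm_num)
    have hl1 : Real.log 2 ≤ 1 := by have := Real.log_two_lt_d9; linarith
    exact tail_exponent_le hm hl0 hl1 hk hgap hm4
  refine le_trans (ENNReal.ofReal_le_ofReal ?_) (hmain hsmall)
  calc Real.exp (X - 1) ≤ Real.exp (X - 1 / 4 - Real.log 2) := by
        refine Real.exp_le_exp.2 ?_
        have := Real.log_two_lt_d9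
        linarith
    _ = Real.exp (-(1 / 4)) * (1 / 2) * Real.exp X := by
        rw [show X - 1 / 4 - Real.log 2 = -(1 / 4) + -Real.log 2 + X by ring, Real.exp_add,
          Real.exp_add, Real.exp_neg (Real.log 2), Real.exp_log two_pos]
        ring
    _ ≤ Real.exp (-(β * (P * (C * r ^ 3)))) * (1 / 2) * Real.exp X := by gcongr
    _ = _ := by rw [← hGX]; ring

end SingleBoxAsymptotics

end LatticeGauge

end

noncomputable section

open scoped ENNReal NNReal

namespace LatticeGauge

/-! ### Asymptotics of the partition function -/

section Asymptotics

/-- The partition function at inverse coupling `β`, as an extended nonnegative number. -/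
def boxZ (d N n : ℕ) (β : ℝ) : ℝ≥0∞ :=
  ∫⁻ U : Config N (box d n), weight β U ∂(Measure.pi fun _ => haarUN N)

variable {d N n m : ℕ} {β : ℝ}

theorem boxZ_pos : 0 < boxZ d N n β := by
  rw [boxZ, lintegral_pos_iff_support (measurable_weight β)]
  have : Function.support (fun U : Config N (box d n) => weight β U) = Set.univ := by
    ext U
    simp [weight, Real.exp_pos]
  rw [this, measure_univ]
  exact one_pos

theorem boxZ_lt_top (hβ : 0 ≤ β) : boxZ d N n β < ∞ := by
  refine lt_of_le_of_lt (b := 1) ?_ ENNReal.one_lt_top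
  calc boxZ d N n β ≤ ∫⁻ _U : Config N (box d n), 1 ∂(Measure.pi fun _ => haarUN N) := by
        refine lintegral_mono fun U => ?_
        rw [weight, ENNReal.ofReal_le_one, Real.exp_le_one_iff]
        have := mul_nonneg hβ (wilsonAction_nonneg U)
        linarith
    _ = 1 := by simp

theorem log_boxZ_le (hβ : 0 ≤ β) {x : ℝ} (h : boxZ d N n β ≤ ENNReal.ofReal (Real.exp x)) :
    Real.log (boxZ d N n β).toReal ≤ x := by
  have h1 : (boxZ d N n β).toReal ≤ Real.exp x :=
    ENNReal.toReal_le_of_le_ofReal (Real.exp_pos _).le h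
  have h2 : 0 < (boxZ d N n β).toReal := ENNReal.toReal_pos boxZ_pos.ne' (boxZ_lt_top hβ).ne
  simpa using Real.log_le_log h2 h1

theorem le_log_boxZ (hβ : 0 ≤ β) {x : ℝ} (h : ENNReal.ofReal (Real.exp x) ≤ boxZ d N n β) :
    x ≤ Real.log (boxZ d N n β).toReal := by
  have h1 : Real.exp x ≤ (boxZ d N n β).toReal :=
    (ENNReal.ofReal_le_iff_le_toReal (boxZ_lt_top hβ).ne).1 h
  simpa using Real.log_le_log (Real.exp_pos _) h1

theorem div_add_le (hm : 1 ≤ m) (hn : m ^ 2 ≤ n) : (m : ℝ) / n + 3 / m ≤ 4 / m := by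
  have hm0 : (0 : ℝ) < m := by exact_mod_cast hm
  have hn' : (m : ℝ) ^ 2 ≤ n := by exact_mod_cast hn
  have hn0 : (0 : ℝ) < n := lt_of_lt_of_le (by positivity) hn'
  have h1 : (m : ℝ) / n ≤ 1 / m := by
    rw [div_le_div_iff₀ hn0 hm0]; nlinarith
  have h2 : (4 : ℝ) / m = 1 / m + 3 / m := by ring
  linarith

theorem block_count_mul_le (n m d : ℕ) : ((n / m : ℕ) : ℝ) ^ d * (m : ℝ) ^ d ≤ (n : ℝ) ^ d := by
  rw [← mul_pow]
  gcongr
  rw [mul_comm]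
  exact_mod_cast Nat.mul_div_le n m

theorem block_count_le (hd : 1 ≤ d) (hm : 1 ≤ m) :
    ((n / m : ℕ) : ℝ) ^ d ≤ (n : ℝ) ^ d * (1 / m) := by
  have hm0 : (1 : ℝ) ≤ m := by exact_mod_cast hm
  rw [mul_one_div, le_div_iff₀ (by linarith)]
  refine le_trans ?_ (block_count_mul_le n m d)
  gcongr
  exact le_self_pow₀ hm0 (by omega)

/-- An upper bound for the free energy of a box in terms of the free energy of its blocks. -/
theorem log_boxZ_le_of_block (hd : 1 ≤ d) (hm : 4 ≤ m) (hn : m ^ 2 ≤ n) (hβ : 0 ≤ β)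
    (hY : 0 ≤ edgeCost N β)
    (h : fixedZ N (fun e : edges (box d m) => ¬ IsAxial e.1) β ≤
        ENNReal.ofReal (Real.exp (-(Fintype.card (FreeEdge d m) * edgeCost N β) -
          (N : ℝ) ^ 2 / 2 * (m ^ d * logDet d m) + 1))) :
    Real.log (boxZ d N n β).toReal ≤ (n : ℝ) ^ d * (-((d - 1 : ℕ) * edgeCost N β) -
      (N : ℝ) ^ 2 / 2 * logDet d m + d * (4 / m) * ((d - 1 : ℕ) * edgeCost N β +
        (N : ℝ) ^ 2 / 2 * logDet d m) + 1 / m) := by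
  have hm1 : 1 ≤ m := by omega
  have hmn : m ≤ n := le_trans (by nlinarith) hn
  set Y := edgeCost N β
  set a := logDet d m with ha
  have ha0 : 0 ≤ a := logDet_nonneg hd hm1
  have hk : ((m - 3 : ℕ) : ℝ) ^ d * (d - 1 : ℕ) ≤ Fintype.card (FreeEdge d m) := by
    have := card_isInterior_le_free (d := d) (m := m)
    rw [card_isInterior] at this
    exact_mod_cast this
  have hvol := block_volume_ge (d := d) hd hm hmn
  have hle := div_add_le hm1 hn
  have hcnt := block_count_le (n := n) hd hm1
  have hZ : boxZ d N n β ≤ ENNReal.ofReal (Real.exp (((n / m : ℕ) : ℝ) ^ d *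
      (-(Fintype.card (FreeEdge d m) * Y) - (N : ℝ) ^ 2 / 2 * (m ^ d * a) + 1))) := by
    refine (lintegral_weight_le_pow (Nat.mul_div_le n m) hβ).trans ?_
    rw [lintegral_weight_eq_fixedZ]
    refine (pow_le_pow_left₀ zero_le h _).trans ?_
    rw [← ENNReal.ofReal_pow (Real.exp_pos _).le, ← Real.exp_nat_mul]
    push_cast
    exact le_rfl
  refine (log_boxZ_le hβ hZ).trans ?_
  set k : ℝ := (Fintype.card (FreeEdge d m) : ℝ)
  set Q : ℝ := ((n / m : ℕ) : ℝ) ^ d with hQ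
  have hQ0 : 0 ≤ Q := by positivity
  set D : ℝ := ((d - 1 : ℕ) : ℝ)
  have hD0 : 0 ≤ D := Nat.cast_nonneg _
  set ν : ℝ := (n : ℝ) ^ d
  have hν0 : 0 ≤ ν := by positivity
  rw [mul_pow, ← hQ] at hvol
  have hd0 : (0 : ℝ) ≤ d := Nat.cast_nonneg d
  have hvol' : ν * (1 - d * (4 / m)) ≤ Q * ((m - 3 : ℕ) : ℝ) ^ d := by
    refine le_trans ?_ hvol
    exact mul_le_mul_of_nonneg_left (by nlinarith) hν0
  -- The edge cost and the log determinant are nonnegative and enter with a minus sign, so what is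
  -- needed is a lower bound on the covered volume.
  have h1 : ν * (1 - d * (4 / m)) * (D * Y) ≤ Q * (k * Y) := by
    calc _ ≤ Q * ((m - 3 : ℕ) : ℝ) ^ d * (D * Y) :=
          mul_le_mul_of_nonneg_right hvol' (mul_nonneg hD0 hY)
      _ = Q * ((((m - 3 : ℕ) : ℝ) ^ d * D) * Y) := by ring
      _ ≤ _ := mul_le_mul_of_nonneg_left (mul_le_mul_of_nonneg_right hk hY) hQ0
  have h2 : ν * (1 - d * (4 / m)) * a ≤ Q * (m ^ d * a) := by
    calc _ ≤ Q * ((m - 3 : ℕ) : ℝ) ^ d * a := mul_le_mul_of_nonneg_right hvol' ha0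
      _ ≤ Q * (m : ℝ) ^ d * a := by
          gcongr
          exact Nat.sub_le _ _
      _ = _ := by ring
  have h3 := mul_le_mul_of_nonneg_left h2 (by positivity : 0 ≤ (N : ℝ) ^ 2 / 2)
  calc Q * (-(k * Y) - (N : ℝ) ^ 2 / 2 * (m ^ d * a) + 1)
      = -(Q * (k * Y)) - (N : ℝ) ^ 2 / 2 * (Q * (m ^ d * a)) + Q := by ring
    _ ≤ -(ν * (1 - d * (4 / m)) * (D * Y)) - (N : ℝ) ^ 2 / 2 * (ν * (1 - d * (4 / m)) * a) +
        ν * (1 / m) := by linarith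
    _ = _ := by ring

/-- The error in the comparison of determinants. -/
def detError (d m : ℕ) : ℝ :=
  (d - 1 : ℕ) * (d * (3 / m)) * (3 * Real.log d + (d + 2) * Real.log m)

/-- A lower bound for the free energy of a box in terms of the free energy of its blocks. -/
theorem le_log_boxZ_of_block (hd : 1 ≤ d) (hd3 : d ≤ 3) (hm : 4 ≤ m) (hn : m ^ 2 ≤ n)
    (hβ : 1 ≤ β) (hβ' : β ≤ ((m : ℝ) + 1) ^ 60) (hY : 0 ≤ edgeCost N β) {κ b : ℝ} (hκ0 : 0 < κ)
    (hκ1 : κ < 1) (hb : 0 < b)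
    (hball : ENNReal.ofReal ((b * (1 / (m : ℝ) ^ 31)) ^ (N ^ 2)) ≤
      haarUN N {U | udist U ≤ 1 / (m : ℝ) ^ 31})
    (hblog : Real.log b ≤ 31 * Real.log m)
    (h : ENNReal.ofReal (Real.exp (-(Fintype.card {e : edges (box d m) // IsInterior e} *
          (edgeCost N (β * (1 + 1 / m)) - Real.log κ)) -
          (N : ℝ) ^ 2 / 2 * Real.log (curlMat (IsInterior (d := d) (m := m))).det - 1)) ≤
        fixedZ N (IsInterior (d := d) (m := m)) (β * (1 + 1 / m))) :
    (n : ℝ) ^ d * (-((d - 1 : ℕ) * edgeCost N β) - (N : ℝ) ^ 2 / 2 * logDet d m -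
      (2 ^ 61 * 72 / m + (d - 1 : ℕ) * ((N : ℝ) ^ 2 / 2 * (1 / m) - Real.log κ) +
        (N : ℝ) ^ 2 / 2 * detError d m + 1 / m +
        (d - 1 : ℕ) * (d * (4 / m)) * ((N : ℝ) ^ 2 * (31 * Real.log m - Real.log b)))) ≤
      Real.log (boxZ d N n β).toReal := by
  have hm1 : 1 ≤ m := by omega
  have hmR : (1 : ℝ) ≤ m := by exact_mod_cast hm1
  have hm0 : (0 : ℝ) < m := by linarith
  have hmn : m ≤ n := le_trans (by nlinarith) hn
  have hβ0 : 0 < β := by linarith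
  have hq : m * (n / m) ≤ n := Nat.mul_div_le n m
  have hdetW := log_det_interior_le (d := d) hd hm
  have hdetW0 := log_det_curlMat_nonneg (A := IsInterior (d := d) (m := m)) hd hm1
    fun e he => he.not_isAxial
  have hfr := card_frozen_le (d := d) hd hm hmn
  have hcardle : (n / m) ^ d * Fintype.card {e : edges (box d m) // IsInterior e} ≤
      Fintype.card (FreeEdge d n) := by
    rw [← card_isBlockInterior hq]
    exact Fintype.card_le_of_injective (fun e => ⟨e.1, e.2.not_isAxial⟩) fun _ _ h =>
      Subtype.ext (congrArg (fun z : FreeEdge d n => z.1) h)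
  have hkW : (Fintype.card {e : edges (box d m) // IsInterior e} : ℝ) ≤
      (m : ℝ) ^ d * (d - 1 : ℕ) := by
    rw [card_isInterior]
    push_cast
    gcongr
    exact Nat.sub_le _ _
  have hP := card_plaquettes_le_real (d := d) (m := n) hd3
  have hle := div_add_le hm1 hn
  have hcnt := block_count_le (n := n) hd hm1
  have hcnt' := block_count_mul_le n m d
  have hYβ : edgeCost N (β * (1 + 1 / m)) ≤ edgeCost N β + (N : ℝ) ^ 2 / 2 * (1 / m) := by
    rw [edgeCost, edgeCost, Real.log_mul hβ0.ne' (by positivity)]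
    have h1 : Real.log (1 + 1 / (m : ℝ)) ≤ 1 / m := by
      have := Real.log_le_sub_one_of_pos (show (0 : ℝ) < 1 + 1 / m by positivity)
      linarith
    have := mul_le_mul_of_nonneg_left h1 (by positivity : 0 ≤ (N : ℝ) ^ 2 / 2)
    linarith
  have hbρ : 0 < b * (1 / (m : ℝ) ^ 31) := by positivity
  have hlogbρ : Real.log (b * (1 / (m : ℝ) ^ 31)) = Real.log b - 31 * Real.log m := by
    rw [Real.log_mul hb.ne' (by positivity), one_div, Real.log_inv, Real.log_pow]
    push_cast
    ring
  -- With ρ = m^(−31) and δ = 1/m the freezing error β·n^d·m·ρ² is of order n^d/m, and the ball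
  -- volumes cost O(log m) for each of the O(n^d/m) frozen edges.
  have hZ := le_fixedZ_free (d := d) (N := N) hq hβ0.le
    (by positivity : (0 : ℝ) ≤ 1 / (m : ℝ) ^ 31) (by positivity : (0 : ℝ) < 1 / m)
  rw [← lintegral_weight_eq_fixedZ, one_div_one_div] at hZ
  have hElt : ((Fintype.card (FreeEdge d n) - (n / m) ^ d *
      Fintype.card {e : edges (box d m) // IsInterior e} : ℕ) : ℝ) ≤
      (n : ℝ) ^ d * ((d - 1 : ℕ) * (d * (4 / m))) := by
    rw [Nat.cast_sub hcardle]
    push_cast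
    refine hfr.trans ?_
    gcongr
  set E := Fintype.card (FreeEdge d n) - (n / m) ^ d *
      Fintype.card {e : edges (box d m) // IsInterior e}
  set X := -(Fintype.card {e : edges (box d m) // IsInterior e} *
          (edgeCost N (β * (1 + 1 / m)) - Real.log κ)) -
          (N : ℝ) ^ 2 / 2 * Real.log (curlMat (IsInterior (d := d) (m := m))).det - 1 with hX
  set A := β * (Fintype.card (plaquettes (box d n)) * ((1 + m) * (8 * (1 / (m : ℝ) ^ 31) ^ 2)))
    with hA
  have hexp : Real.exp (-A + (((n / m : ℕ) : ℝ) ^ d * X +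
      E * ((N : ℝ) ^ 2 * (Real.log b - 31 * Real.log m)))) =
      Real.exp (-A) * (Real.exp X ^ ((n / m) ^ d) * ((b * (1 / (m : ℝ) ^ 31)) ^ (N ^ 2)) ^ E) := by
    rw [Real.exp_add, Real.exp_add, ← Real.exp_nat_mul, ← pow_mul,
      ← Real.exp_log (pow_pos hbρ (N ^ 2 * E)), Real.log_pow, hlogbρ]
    push_cast
    congr 3
    ring
  have hlow : ENNReal.ofReal (Real.exp (-A + (((n / m : ℕ) : ℝ) ^ d * X +
      E * ((N : ℝ) ^ 2 * (Real.log b - 31 * Real.log m))))) ≤ boxZ d N n β := by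
    refine le_trans ?_ hZ
    rw [hexp, ENNReal.ofReal_mul (Real.exp_pos _).le,
      ENNReal.ofReal_mul (pow_nonneg (Real.exp_pos _).le _),
      ENNReal.ofReal_pow (Real.exp_pos _).le, ENNReal.ofReal_pow (pow_nonneg hbρ.le _)]
    exact mul_le_mul_right (mul_le_mul' (pow_le_pow_left₀ zero_le h _)
      (pow_le_pow_left₀ zero_le hball _)) _
  refine le_trans ?_ (le_log_boxZ hβ0.le hlow)
  have hAle : A ≤ (n : ℝ) ^ d * (2 ^ 61 * 72 / m) := by
    have h1 := hβ'.trans (add_one_pow_sixty_le hm1)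
    calc A ≤ (2 ^ 60 * (m : ℝ) ^ 60) * ((9 * (n : ℝ) ^ d) * ((m + m) *
          (8 * (1 / (m : ℝ) ^ 31) ^ 2))) := by
          rw [hA]
          gcongr
      _ = _ := by field_simp; ring
  clear_value E
  have hETle : E * ((N : ℝ) ^ 2 * (31 * Real.log m - Real.log b)) ≤
      (n : ℝ) ^ d * ((d - 1 : ℕ) * (d * (4 / m))) *
        ((N : ℝ) ^ 2 * (31 * Real.log m - Real.log b)) :=
    mul_le_mul_of_nonneg_right hElt (mul_nonneg (by positivity) (by linarith))
  have hlogκ : 0 ≤ -Real.log κ := by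
    have := Real.log_nonpos hκ0.le hκ1.le
    linarith
  set kW : ℝ := (Fintype.card {e : edges (box d m) // IsInterior e} : ℝ)
  have hkW0 : 0 ≤ kW := Nat.cast_nonneg _
  clear_value kW
  set Q : ℝ := ((n / m : ℕ) : ℝ) ^ d with hQ
  have hQ0 : 0 ≤ Q := by positivity
  set D : ℝ := ((d - 1 : ℕ) : ℝ)
  have hD0 : 0 ≤ D := Nat.cast_nonneg _
  have hν0 : 0 ≤ (n : ℝ) ^ d := by positivity
  have hQk : Q * kW ≤ (n : ℝ) ^ d * D := by
    calc Q * kW ≤ Q * ((m : ℝ) ^ d * D) := mul_le_mul_of_nonneg_left hkW hQ0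
      _ = Q * (m : ℝ) ^ d * D := by ring
      _ ≤ _ := mul_le_mul_of_nonneg_right hcnt' hD0
  have hT0 : 0 ≤ edgeCost N β + (N : ℝ) ^ 2 / 2 * (1 / m) - Real.log κ := by
    have : 0 ≤ (N : ℝ) ^ 2 / 2 * (1 / m) := by positivity
    linarith
  have h1 : Q * (kW * (edgeCost N (β * (1 + 1 / m)) - Real.log κ)) ≤
      (n : ℝ) ^ d * D * (edgeCost N β + (N : ℝ) ^ 2 / 2 * (1 / m) - Real.log κ) := by
    calc _ = Q * kW * (edgeCost N (β * (1 + 1 / m)) - Real.log κ) := by ring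
      _ ≤ Q * kW * (edgeCost N β + (N : ℝ) ^ 2 / 2 * (1 / m) - Real.log κ) :=
          mul_le_mul_of_nonneg_left (by linarith) (mul_nonneg hQ0 hkW0)
      _ ≤ _ := mul_le_mul_of_nonneg_right hQk hT0
  set W := Real.log (curlMat (IsInterior (d := d) (m := m))).det
  have hW2 : W ≤ (m : ℝ) ^ d * (logDet d m + detError d m) := hdetW
  have hsum0 : 0 ≤ logDet d m + detError d m :=
    nonneg_of_mul_nonneg_right (hdetW0.trans hW2) (by positivity)
  have h2 : Q * W ≤ (n : ℝ) ^ d * (logDet d m + detError d m) := by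
    calc Q * W ≤ Q * ((m : ℝ) ^ d * (logDet d m + detError d m)) :=
          mul_le_mul_of_nonneg_left hW2 hQ0
      _ = Q * (m : ℝ) ^ d * (logDet d m + detError d m) := by ring
      _ ≤ _ := mul_le_mul_of_nonneg_right hcnt' hsum0
  have h3 := mul_le_mul_of_nonneg_left h2 (by positivity : 0 ≤ (N : ℝ) ^ 2 / 2)
  have hQX : Q * X = -(Q * (kW * (edgeCost N (β * (1 + 1 / m)) - Real.log κ))) -
      (N : ℝ) ^ 2 / 2 * (Q * W) - Q := by rw [hX]; ring
  rw [hQX]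
  clear_value A X W
  linarith

end Asymptotics

end LatticeGauge

end

noncomputable section

open scoped ENNReal NNReal

namespace LatticeGauge

/-! ### Free energy bounds uniform in β and n, and the constants of the theorem -/

section Conclusion

variable {d N : ℕ}

theorem tendsto_log_succ_div : Tendsto (fun m : ℕ => Real.log (m + 1) / m) atTop (𝓝 0) := by
  have h1 : Tendsto (fun m : ℕ => Real.log (m + 1 : ℕ) / (m + 1 : ℕ) * (1 + 1 / (m : ℝ))) atTop
      (𝓝 (0 * (1 + 0))) := by
    refine Tendsto.mul ?_ (tendsto_const_nhds.add tendsto_one_div_atTop_nhds_zero_nat)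
    have := (Real.isLittleO_log_id_atTop.comp_tendsto
      (tendsto_natCast_atTop_atTop.comp (tendsto_add_atTop_nat 1))).tendsto_div_nhds_zero
    simpa using this
  rw [zero_mul] at h1
  refine h1.congr' ?_
  filter_upwards [eventually_ge_atTop 1] with m hm
  have : (0 : ℝ) < m := by exact_mod_cast hm
  push_cast
  field_simp

theorem tendsto_log_div : Tendsto (fun m : ℕ => Real.log m / m) atTop (𝓝 0) := by
  have := (Real.isLittleO_log_id_atTop.comp_tendsto
    tendsto_natCast_atTop_atTop).tendsto_div_nhds_zero
  simpa using this

theorem tendsto_const_div_nat (c : ℝ) : Tendsto (fun m : ℕ => c / (m : ℝ)) atTop (𝓝 0) :=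
  tendsto_const_div_atTop_nhds_zero_nat c

theorem eventually_edgeCost_nonneg (hN : 1 ≤ N) :
    ∀ᶠ m : ℕ in atTop, ∀ β : ℝ, (m : ℝ) ^ 60 ≤ β → 0 ≤ edgeCost N β := by
  have h := (Real.tendsto_log_atTop.comp tendsto_natCast_atTop_atTop).eventually_ge_atTop
    |logConst N|
  filter_upwards [h, eventually_ge_atTop 1] with m hm hm1 β hβ
  have hm0 : (0 : ℝ) < m := by exact_mod_cast hm1
  have h1 : 60 * Real.log m ≤ Real.log β := by
    have := Real.log_le_log (by positivity) hβ
    rwa [Real.log_pow] at this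
  have hN1 : (1 : ℝ) ≤ (N : ℝ) ^ 2 := one_le_pow₀ (by exact_mod_cast hN)
  have h0 : |logConst N| ≤ Real.log m := hm
  have h2 := le_abs_self (logConst N)
  have h3 := abs_nonneg (logConst N)
  rw [edgeCost]
  nlinarith

/-- The edge cost is O(log m) because β ≤ (m + 1)^60, and in the error it is multiplied by a
multiple of 1/m. Hence all errors per site vanish as m → ∞, uniformly in β in its window and in n ≥
m². -/
theorem eventually_log_boxZ_le (hd : 2 ≤ d) (hd3 : d ≤ 3) (hN : 1 ≤ N) {l : ℝ}
    (hl : Tendsto (logDet d) atTop (𝓝 l)) {δ : ℝ} (hδ : 0 < δ) :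
    ∀ᶠ m : ℕ in atTop, ∀ β : ℝ, (m : ℝ) ^ 60 ≤ β → β ≤ ((m : ℝ) + 1) ^ 60 → ∀ n, m ^ 2 ≤ n →
      Real.log (boxZ d N n β).toReal ≤
        (n : ℝ) ^ d * (-((d - 1 : ℕ) * edgeCost N β) - (N : ℝ) ^ 2 / 2 * l + δ) := by
  set D : ℝ := ((d - 1 : ℕ) : ℝ)
  have herr : Tendsto (fun m : ℕ => (N : ℝ) ^ 2 / 2 * (l - logDet d m) +
      ((4 * d * D * (30 * (N : ℝ) ^ 2)) * (Real.log (m + 1) / m) +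
        (4 * d * D * |logConst N|) / m +
        (4 * d * ((N : ℝ) ^ 2 / 2)) / m * logDet d m) + 1 / (m : ℝ)) atTop
      (𝓝 ((N : ℝ) ^ 2 / 2 * (l - l) + (4 * d * D * (30 * (N : ℝ) ^ 2) * 0 + 0 + 0 * l) + 0)) := by
    refine Tendsto.add (Tendsto.add ?_ (Tendsto.add (Tendsto.add ?_ ?_) ?_)) ?_
    · exact (tendsto_const_nhds.sub hl).const_mul _
    · exact tendsto_log_succ_div.const_mul _
    · exact tendsto_const_div_nat _
    · exact (tendsto_const_div_nat _).mul hl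
    · exact tendsto_const_div_nat 1
  simp only [sub_self, mul_zero, zero_mul, add_zero] at herr
  filter_upwards [eventually_ge_atTop 4, eventually_fixedZ_le hd hd3 N,
    eventually_edgeCost_nonneg hN, herr.eventually_le_const hδ] with m hm hZ hY he β hβ1 hβ2 n hn
  have hmR : (1 : ℝ) ≤ m := by exact_mod_cast (by omega : 1 ≤ m)
  have hβ : 1 ≤ β := (one_le_pow₀ hmR).trans hβ1
  refine (log_boxZ_le_of_block (by omega) hm hn (by linarith) (hY β hβ1) (hZ β hβ1 hβ2)).trans ?_
  refine mul_le_mul_of_nonneg_left ?_ (by positivity)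
  have hYle := (le_abs_self _).trans (abs_edgeCost_le N hβ hβ2)
  have hD0 : 0 ≤ D := Nat.cast_nonneg _
  have h1 : d * (4 / (m : ℝ)) * (D * edgeCost N β) ≤
      d * (4 / (m : ℝ)) * (D * (30 * (N : ℝ) ^ 2 * Real.log (m + 1) + |logConst N|)) := by
    gcongr
  have h2 : d * (4 / (m : ℝ)) * (D * (30 * (N : ℝ) ^ 2 * Real.log (m + 1) + |logConst N|)) =
      (4 * d * D * (30 * (N : ℝ) ^ 2)) * (Real.log (m + 1) / m) + (4 * d * D * |logConst N|) / m := by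
    ring
  have h3 : d * (4 / (m : ℝ)) * ((N : ℝ) ^ 2 / 2 * logDet d m) =
      (4 * d * ((N : ℝ) ^ 2 / 2)) / m * logDet d m := by ring
  rw [mul_add]
  linarith

theorem eventually_le_log_boxZ (hd : 2 ≤ d) (hd3 : d ≤ 3) (hN : 1 ≤ N) {l : ℝ}
    (hl : Tendsto (logDet d) atTop (𝓝 l)) {δ : ℝ} (hδ : 0 < δ) :
    ∀ᶠ m : ℕ in atTop, ∀ β : ℝ, (m : ℝ) ^ 60 ≤ β → β ≤ ((m : ℝ) + 1) ^ 60 → ∀ n, m ^ 2 ≤ n →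
      (n : ℝ) ^ d * (-((d - 1 : ℕ) * edgeCost N β) - (N : ℝ) ^ 2 / 2 * l - δ) ≤
        Real.log (boxZ d N n β).toReal := by
  set D : ℝ := ((d - 1 : ℕ) : ℝ) with hD
  have hD2 : D ≤ 2 := by rw [hD]; exact_mod_cast (by omega : d - 1 ≤ 2)
  have hD0 : 0 ≤ D := Nat.cast_nonneg _
  obtain ⟨b, ρ₀, hb, hρ₀, hball⟩ := exists_le_haarUN_ball hN
  -- There are at most d − 1 ≤ 2 free edges per site, so the density loss κ costs at most δ/2 per
  -- site. The other errors share the remaining δ/2.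
  set κ := Real.exp (-(δ / 4)) with hκ
  have hκ0 : 0 < κ := Real.exp_pos _
  have hκ1 : κ < 1 := Real.exp_lt_one_iff.2 (by linarith)
  have hlogκ : Real.log κ = -(δ / 4) := Real.log_exp _
  have herr : Tendsto (fun m : ℕ => 2 ^ 61 * 72 / (m : ℝ) + (D * (N : ℝ) ^ 2 / 2) / m +
      (N : ℝ) ^ 2 / 2 * (logDet d m - l) +
      ((N : ℝ) ^ 2 / 2 * (9 * D * d * Real.log d) / m +
        (N : ℝ) ^ 2 / 2 * (3 * D * d * (d + 2)) * (Real.log m / m)) + 1 / (m : ℝ) +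
      (4 * D * d * (N : ℝ) ^ 2 * 31 * (Real.log m / m) -
        4 * D * d * (N : ℝ) ^ 2 * Real.log b / m)) atTop
      (𝓝 (0 + 0 + (N : ℝ) ^ 2 / 2 * (l - l) +
        (0 + (N : ℝ) ^ 2 / 2 * (3 * D * d * (d + 2)) * 0) + 0 +
        (4 * D * d * (N : ℝ) ^ 2 * 31 * 0 - 0))) := by
    refine Tendsto.add (Tendsto.add (Tendsto.add (Tendsto.add (Tendsto.add ?_ ?_) ?_)
      (Tendsto.add ?_ ?_)) ?_) (Tendsto.sub ?_ ?_)
    · exact tendsto_const_div_nat _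
    · exact tendsto_const_div_nat _
    · exact (hl.sub tendsto_const_nhds).const_mul _
    · exact tendsto_const_div_nat _
    · exact tendsto_log_div.const_mul _
    · exact tendsto_const_div_nat _
    · exact tendsto_log_div.const_mul _
    · exact tendsto_const_div_nat _
  simp only [sub_self, mul_zero, add_zero] at herr
  have hlogm := (Real.tendsto_log_atTop.comp tendsto_natCast_atTop_atTop).eventually_ge_atTop
    |Real.log b|
  filter_upwards [eventually_ge_atTop 4, eventually_le_fixedZ hd hd3 N hκ0 hκ1,
    eventually_edgeCost_nonneg hN, herr.eventually_le_const (half_pos hδ), hlogm,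
    eventually_natCast_ge (1 / ρ₀)] with m hm hZ hY he hlb hρ β hβ1 hβ2 n hn
  have hmR : (1 : ℝ) ≤ m := by exact_mod_cast (by omega : 1 ≤ m)
  have hm0 : (0 : ℝ) < m := by linarith
  have hβ : 1 ≤ β := (one_le_pow₀ hmR).trans hβ1
  have hρ1 : 1 / (m : ℝ) ^ 31 ≤ ρ₀ := by
    rw [div_le_iff₀ hρ₀] at hρ
    rw [div_le_iff₀ (by positivity)]
    have : (m : ℝ) ≤ (m : ℝ) ^ 31 := le_self_pow₀ hmR (by norm_num)
    nlinarith
  have hlb' : Real.log b ≤ 31 * Real.log m := by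
    have h1 : |Real.log b| ≤ Real.log m := hlb
    have h2 := le_abs_self (Real.log b)
    have h3 := abs_nonneg (Real.log b)
    linarith
  have h1m : 1 / (m : ℝ) ≤ 1 := by rw [div_le_one hm0]; exact hmR
  have hβ'1 : (m : ℝ) ^ 60 ≤ β * (1 + 1 / m) := by
    refine hβ1.trans (le_mul_of_one_le_right (by linarith) ?_)
    have : 0 ≤ 1 / (m : ℝ) := by positivity
    linarith
  have hβ'2 : β * (1 + 1 / m) ≤ 2 * ((m : ℝ) + 1) ^ 60 := by
    have : β * (1 + 1 / m) ≤ β * 2 := mul_le_mul_of_nonneg_left (by linarith) (by linarith)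
    linarith
  refine le_trans ?_ (le_log_boxZ_of_block (by omega) hd3 hm hn hβ hβ2 (hY β hβ1) hκ0 hκ1 hb
    (hball _ (by positivity) hρ1) hlb' (hZ _ hβ'1 hβ'2))
  refine mul_le_mul_of_nonneg_left ?_ (by positivity)
  have e1 : (N : ℝ) ^ 2 / 2 * detError d m =
      (N : ℝ) ^ 2 / 2 * (9 * D * d * Real.log d) / m +
        (N : ℝ) ^ 2 / 2 * (3 * D * d * (d + 2)) * (Real.log m / m) := by
    rw [detError]; ring
  have e2 : D * (d * (4 / (m : ℝ))) * ((N : ℝ) ^ 2 * (31 * Real.log m - Real.log b)) =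
      4 * D * d * (N : ℝ) ^ 2 * 31 * (Real.log m / m) -
        4 * D * d * (N : ℝ) ^ 2 * Real.log b / m := by ring
  have e3 : D * ((N : ℝ) ^ 2 / 2 * (1 / m) - Real.log κ) =
      (D * (N : ℝ) ^ 2 / 2) / m + D * (δ / 4) := by rw [hlogκ]; ring
  rw [e1, e2, e3]
  have e4 : D * (δ / 4) ≤ 2 * (δ / 4) := mul_le_mul_of_nonneg_right hD2 (by linarith)
  linarith

/-- The powers of 2π in `haarDensity N` add up to N(N + 1)/2, and the Gaussian normalization cancels
N²/2 of them. Since 0! = 1, the product may start at 1. -/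
theorem logConst_eq (hN : 1 ≤ N) :
    logConst N = Real.log ((∏ j ∈ Finset.Icc 1 (N - 1), (j ! : ℝ)) /
      (2 * Real.pi) ^ ((N : ℝ) / 2)) := by
  have hpi : (0 : ℝ) < 2 * Real.pi := by positivity
  have hprod : ∏ j ∈ Finset.Icc 1 (N - 1), (j ! : ℝ) = ∏ j ∈ Finset.range N, (j ! : ℝ) := by
    obtain ⟨M, rfl⟩ : ∃ M, N = M + 1 := ⟨N - 1, by omega⟩
    rw [Finset.prod_range_succ', Nat.add_sub_cancel, Nat.factorial_zero, Nat.cast_one, mul_one,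
      Finset.range_eq_Ico, Finset.prod_Ico_add' (fun j => (j ! : ℝ)) 0 M 1]
    congr 1
  have hsum : ∀ K : ℕ, Real.log (haarDensity K) = Real.log (∏ j ∈ Finset.range K, (j ! : ℝ)) -
      (K : ℝ) * (K + 1) / 2 * Real.log (2 * Real.pi) := by
    intro K
    induction K with
    | zero => simp [haarDensity]
    | succ K ih =>
      have hf : (0 : ℝ) < (K ! : ℝ) := by exact_mod_cast Nat.factorial_pos K
      have hpr : (∏ j ∈ Finset.range K, (j ! : ℝ)) ≠ 0 :=
        Finset.prod_ne_zero_iff.2 fun j _ => by exact_mod_cast (Nat.factorial_pos j).ne'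
      rw [HaarChart.haarDensity_succ, Real.log_mul (by positivity) (haarDensity_pos K).ne', ih,
        Real.log_div hf.ne' (by positivity), Real.log_pow, Finset.prod_range_succ,
        Real.log_mul hpr hf.ne']
      push_cast
      ring
  have hpr : (∏ j ∈ Finset.range N, (j ! : ℝ)) ≠ 0 :=
    Finset.prod_ne_zero_iff.2 fun j _ => by exact_mod_cast (Nat.factorial_pos j).ne'
  rw [logConst, hsum, hprod, Real.log_div hpr (by positivity), Real.log_rpow hpi]
  ring

theorem exists_nat_pow_sixty {β : ℝ} (hβ : 0 ≤ β) :
    ∃ m : ℕ, (m : ℝ) ^ 60 ≤ β ∧ β < ((m : ℝ) + 1) ^ 60 := by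
  classical
  have hex : ∃ m : ℕ, β < ((m : ℝ) + 1) ^ 60 := by
    obtain ⟨m, hm⟩ := exists_nat_gt β
    refine ⟨m, hm.trans_le ?_⟩
    have : ((m : ℝ) + 1) ≤ ((m : ℝ) + 1) ^ 60 :=
      le_self_pow₀ (by linarith [Nat.cast_nonneg (α := ℝ) m]) (by norm_num)
    linarith
  refine ⟨Nat.find hex, ?_, Nat.find_spec hex⟩
  rcases Nat.eq_zero_or_pos (Nat.find hex) with h0 | h0
  · rw [h0]; simpa using hβ
  · have := Nat.find_min hex (Nat.sub_lt h0 one_pos)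
    rw [not_lt] at this
    rw [Nat.cast_pred h0] at this
    simpa using this

end Conclusion

end LatticeGauge

end

theorem theorem2p2 (d : ℕ) (hd : d = 2 ∨ d = 3) :
    ∃ K : ℝ, Tendsto (fun n : ℕ => LatticeGauge.Knd n d) atTop (𝓝 K) ∧
      ∀ (N : ℕ), 1 ≤ N → ∀ (g : ℝ), 0 < g →
        ∀ {ι : Type*} (l : Filter ι) (n : ι → ℕ) (ε : ι → ℝ),
          Tendsto n l atTop → Tendsto ε l (𝓝[>] 0) →
          (∃ c : ℝ, 0 < c ∧ ∀ᶠ i in l, c ≤ (n i : ℝ) * ε i) →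
          (fun i => Real.log (LatticeGauge.scaledPartitionFunction d N (n i) (ε i) g) -
              (n i : ℝ) ^ d *
                ((1 / 2) * ((d : ℝ) - 1) * (N : ℝ) ^ 2 *
                    Real.log (g ^ 2 * ε i ^ (4 - (d : ℤ))) +
                  ((d : ℝ) - 1) *
                    Real.log ((∏ j ∈ Finset.Icc 1 (N - 1), (j ! : ℝ)) /
                      (2 * Real.pi) ^ ((N : ℝ) / 2)) +
                  (N : ℝ) ^ 2 * K))
            =o[l] fun i => (n i : ℝ) ^ d := by
  have hd2 : 2 ≤ d := by omega
  have hd3 : d ≤ 3 := by omega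
  obtain ⟨a, ha⟩ := LatticeGauge.tendsto_logDet (d := d) (by omega)
  refine ⟨-a / 2, ?_, ?_⟩
  · simp only [LatticeGauge.Knd_eq]
    exact ha.neg.div_const 2
  intro N hN g hg ι l n ε _ hε hc
  obtain ⟨c, hc0, hc⟩ := hc
  rw [isLittleO_iff]
  intro δ hδ
  -- One threshold for the block side. Its last condition, m ≥ 1/(cg)², serves to turn the bound on
  -- nε into m² ≤ n.
  obtain ⟨M, hM⟩ := eventually_atTop.1 ((LatticeGauge.eventually_log_boxZ_le hd2 hd3 hN ha hδ).and
    ((LatticeGauge.eventually_le_log_boxZ hd2 hd3 hN ha hδ).and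
      ((eventually_ge_atTop 1).and (LatticeGauge.eventually_natCast_ge (1 / (c * g) ^ 2)))))
  -- For ε ≤ 1 below this value, ε^(4−d) ≤ ε gives β ≥ (M + 1)^60, so the block side is at least M.
  have hB : (0 : ℝ) < 1 / (g ^ 2 * (M + 1) ^ 60) := by positivity
  rw [tendsto_nhdsWithin_iff] at hε
  filter_upwards [hc, hε.2, hε.1.eventually_lt_const hB, hε.1.eventually_le_const one_pos]
    with i hci hεi hεB hε1
  have hε0 : 0 < ε i := hεi
  have hdz : (4 - (d : ℤ)) = 2 ∨ (4 - (d : ℤ)) = 1 := by omega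
  set x : ℝ := ε i ^ (4 - (d : ℤ)) with hx
  have hx0 : 0 < x := by positivity
  have hx1 : x ≤ ε i := by
    rcases hdz with h | h <;> rw [hx, h]
    · rw [zpow_ofNat]; nlinarith
    · simp
  have hx2 : ε i ^ 2 ≤ x := by
    rcases hdz with h | h <;> rw [hx, h]
    · rw [zpow_ofNat]
    · rw [zpow_one]; nlinarith
  set β : ℝ := 1 / (g ^ 2 * x) with hβ
  have hβ0 : 0 < β := by positivity
  obtain ⟨m, hm1, hm2⟩ := LatticeGauge.exists_nat_pow_sixty hβ0.le
  have hMm : M ≤ m := by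
    by_contra hlt
    push Not at hlt
    have h1 : ((m : ℝ) + 1) ^ 60 ≤ ((M : ℝ) + 1) ^ 60 := by
      have : (m : ℝ) ≤ M := by exact_mod_cast hlt.le
      gcongr
    have h2 : ((M : ℝ) + 1) ^ 60 ≤ β := by
      rw [hβ, le_div_iff₀ (by positivity)]
      have h3 : ε i * (g ^ 2 * (M + 1) ^ 60) ≤ 1 := by
        have := hεB.le
        rwa [le_div_iff₀ (by positivity)] at this
      have h4 : ((M : ℝ) + 1) ^ 60 * (g ^ 2 * x) ≤ ((M : ℝ) + 1) ^ 60 * (g ^ 2 * ε i) := by gcongr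
      linarith
    linarith
  obtain ⟨hup, hlow, hm0, hmc⟩ := hM m hMm
  have hmR : (1 : ℝ) ≤ m := by exact_mod_cast hm0
  -- Since ε² ≤ ε^(4−d), one has m^60 ≤ β ≤ 1/(gε)². With c ≤ nε this gives m^60 ≤ n²/(cg)² ≤ n²m,
  -- and hence m^4 ≤ n².
  have hn : m ^ 2 ≤ n i := by
    have h1 : (m : ℝ) ^ 60 * (g ^ 2 * ε i ^ 2) ≤ 1 := by
      rw [hβ, le_div_iff₀ (by positivity)] at hm1
      refine le_trans ?_ hm1
      gcongr
    have h2 : c ^ 2 ≤ (n i : ℝ) ^ 2 * ε i ^ 2 := by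
      rw [← mul_pow]; gcongr
    rw [div_le_iff₀ (by positivity)] at hmc
    have h3 : ((m : ℝ) ^ 2) ^ 2 ≤ (n i : ℝ) ^ 2 := by
      have h4 : (m : ℝ) ^ 5 ≤ (m : ℝ) ^ 60 := pow_le_pow_right₀ hmR (by norm_num)
      have h5 : (m : ℝ) ^ 4 * (1 * (ε i ^ 2)) ≤ (n i : ℝ) ^ 2 * ε i ^ 2 := by
        calc (m : ℝ) ^ 4 * (1 * (ε i ^ 2)) ≤ (m : ℝ) ^ 4 * (m * (c * g) ^ 2 * ε i ^ 2) := by gcongr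
          _ = (m : ℝ) ^ 5 * (g ^ 2 * ε i ^ 2) * c ^ 2 := by ring
          _ ≤ (m : ℝ) ^ 60 * (g ^ 2 * ε i ^ 2) * c ^ 2 := by gcongr
          _ ≤ 1 * c ^ 2 := by gcongr
          _ ≤ _ := by linarith
      have h6 : 0 < ε i ^ 2 := by positivity
      rw [one_mul] at h5
      have := le_of_mul_le_mul_right h5 h6
      linarith
    have h7 := abs_le_of_sq_le_sq' h3 (Nat.cast_nonneg _) |>.2
    exact_mod_cast h7
  have h1 := hup β hm1 hm2.le (n i) hn
  have h2 := hlow β hm1 hm2.le (n i) hn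
  have hZ : LatticeGauge.scaledPartitionFunction d N (n i) (ε i) g =
      (LatticeGauge.boxZ d N (n i) β).toReal :=
    LatticeGauge.partitionFunction_eq_toReal N _
  have hlog : Real.log (g ^ 2 * x) = -Real.log β := by
    rw [hβ, one_div, Real.log_inv, neg_neg]
  have hD : ((d - 1 : ℕ) : ℝ) = (d : ℝ) - 1 := by
    rw [Nat.cast_sub (by omega)]; simp
  rw [hZ, hlog, ← LatticeGauge.logConst_eq hN]
  rw [LatticeGauge.edgeCost, hD] at h1 h2
  have hν : 0 ≤ (n i : ℝ) ^ d := by positivity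
  rw [Real.norm_eq_abs, Real.norm_of_nonneg hν, abs_le]
  constructor <;> linarith
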